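/- **Setting.** Let $K\ge 2$ and let $G=([K],E)$ be a directed graph (self-loops allowed) that is weakly observable: for every arm $i$ there is an arm $j$ with $(j,i)\in E$. In each of $T$ rounds the environment generates a loss vector $\ell_t\in[-1,1]^K$, the learner plays an arm $A_t\in[K]$, suffers $\ell_{t,A_t}$ and observes exactly the losses $\ell_{t,j}$ with $(A_t,j)\in E$. The environment may be randomized and may depend on the whole past, including the learner's past random choices, but, given the past, $\ell_t$ is independent of the learner's random choices in round $t$. Write $\mathcal F_{t-1}$ for the information before round $t$. A set $D\subseteq[K]$ is weakly dominating if every $j\in[K]$ has some $i\in D$ with $(i,j)\in E$; $\delta$ is the minimum size of such a set. Fix a weakly dominating set $D$ with $|D|=\delta$ and, for each arm $i$, a revealing arm $\mathrm{rev}(i)$ with $(\mathrm{rev}(i),i)\in E$. **Algorithm.** Parameters $a,b>0$; put $c=a\,\delta\log K$ and $c'=b\,(c^{1/3}+c)$. *(Base: EXP3 on $[K]\setminus\{\hat x\}$.)* In its round $t$ it receives an update probability $q_t\in(0,1]$ and lets $$\eta_t=\Big(\big(\tfrac{\sqrt\delta\sum_{s\le t}q_s^{-1/2}}{\log K}\big)^{2/3}+\tfrac{4\delta}{\min_{s\le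 t}q_s}\Big)^{-1},\qquad \gamma_t=\sqrt{\eta_t\delta/q_t},$$ $$P_t=\arg\min_{x}\Big\{\sum_{\tau<t}\langle x,\hat\ell_\tau\rangle+\tfrac1{\eta_t}\sum_i x_i\log x_i\Big\}$$ over distributions $x$ on $[K]$ with $x_{\hat x}=0$, and $p_t=(1-\gamma_t)P_t+\gamma_t\,\mathrm{unif}(D)$. It samples $\tilde A_t\sim p_t$; if the feedback of $\tilde A_t$ is received (probability $q_t$), then $\hat\ell_{t,i}=\ell_{t,i}\mathbb I\{(\tilde A_t,i)\in E\}/\big(q_t\sum_{j:(j,i)\in E}p_{t,j}\big)$, otherwise $\hat\ell_t=0$. *($\frac23$-Corral with candidate $\hat x$.)* Let $\eta_t=(t^{2/3}+8c^{1/3})^{-1}$, $\beta=1/(8c)$ and $$\bar q_t=\arg\min_{q}\Big\{\Big\langle q,\sum_{\tau<t}z_\tau-(0,B_{t-1})\Big\rangle-\tfrac3{\eta_t}\sum_{i=1}^2 q_i^{2/3}+\tfrac1\beta\sum_{i=1}^2\ln\tfrac1{q_i}\Big\}$$ over the probability vectors $q=(q_1,q_2)$ with positive entries, and $q_t=(1-\gamma_t)\bar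 q_t$, where $\gamma_t\in(0,1)$ is the unique number with $\gamma_t=\max\{\sqrt{\eta_t}\,q_{t,2}^{2/3},\eta_t q_{t,2}^{1/3}\}$. The base algorithm, with update probability $q_{t,2}$, proposes $\tilde A_t$. Independently, $j_t\sim\mathrm{Bernoulli}(\gamma_t)$; the index $i_t\in\{1,2\}$ follows $\bar q_t$ if $j_t=0$ and is uniform if $j_t=1$. Put $\bar A_t=\hat x$ if $i_t=1$ and $\bar A_t=\tilde A_t$ if $i_t=2$. If $j_t=0$, play $A_t=\bar A_t$; if $j_t=1$, play $A_t=\mathrm{rev}(\bar A_t)$. The base algorithm receives its feedback iff $i_t=2$ and $j_t=0$. Finally $z_{t,i}=2\,\ell_{t,\bar A_t}\mathbb I\{i_t=i,\,j_t=1\}/\gamma_t$, $B_0=0$ and $B_t=c^{1/3}\big(\sum_{\tau\le t}q_{\tau,2}^{-1/2}\big)^{2/3}+c/\min_{\tau\le t}q_{\tau,2}$. *(Outer algorithm.)* Let $T_1=0$, $T_0=-c'\log T$ and $\hat x_1\sim\mathrm{unif}([K])$. Epoch $k$ starts after round $T_k$ and runs a fresh copy of $\frac23$-Corral with candidate $\hat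 x_k$, counting the plays $N_k(x)$ of each arm $x$ during the epoch. It ends after the first round $t$ with $t-T_k\ge 2(T_k-T_{k-1})$ for which some arm $x\ne\hat x_k$ has $N_k(x)\ge (t-T_k)/2$; then $\hat x_{k+1}$ is such an $x$ (chosen by a fixed rule if there are several) and $T_{k+1}=t$. **Claim.** There are universal constants $a,b,M>0$ such that, for all $K,T,G,D,\mathrm{rev}$ and all environments as above, the algorithm with parameters $a,b$ satisfies simultaneously: 1. (Adversarial regime.) For every arm $u$, $$\mathbb E\Big[\sum_{t=1}^T(\ell_{t,A_t}-\ell_{t,u})\Big]\le M\,(\delta\log K)^{1/3}\,T^{2/3}.$$ 2. (Corrupted stochastic regime.) Suppose $T\ge2$ and there are an arm $x^\star$, a number $\Delta>0$ and numbers $C_1,\dots,C_T\ge0$ such that $\mathbb E[\ell_{t,x}-\ell_{t,x^\star}\mid\mathcal F_{t-1}]\ge\Delta-C_t$ almost surely for all $t\le T$ and all $x\ne x^\star$. Then, with $C=\sum_{t=1}^TC_t$, for every arm $u$, $$\mathbb E\Big[\sum_{t=1}^T(\ell_{t,A_t}-\ell_{t,u})\Big]\le M\Big(\frac{\delta\log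 K\log T}{\Delta^2}+\Big(\frac{C^2\,\delta\log K\log T}{\Delta^2}\Big)^{1/3}\Big).$$ -/

import Mathlib

open MeasureTheory

namespace GraphBandit

noncomputable section

/-! ### Feedback graphs -/

/-- Every arm is observed by at least one arm. -/
def IsWeaklyObservable {K : ℕ} (G : Digraph (Fin K)) : Prop :=
  ∀ i, ∃ j, G.Adj j i

/-- Every arm is observed by some arm of `D`. -/
def IsWeaklyDominating {K : ℕ} (G : Digraph (Fin K)) (D : Finset (Fin K)) : Prop :=
  ∀ j, ∃ i ∈ D, G.Adj i j

/-- The weakly dominating number: the size of a smallest weakly dominating set. -/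
def weakDomNumber {K : ℕ} (G : Digraph (Fin K)) : ℕ :=
  sInf {n | ∃ D : Finset (Fin K), IsWeaklyDominating G D ∧ D.card = n}

open scoped Classical in
/-- What the learner sees after playing `a`: the losses of the out-neighbours of `a`.
Unobserved entries are masked by `0`. -/
def feedback {K : ℕ} (G : Digraph (Fin K)) (a : Fin K) (l : Fin K → ℝ) : Fin K → ℝ :=
  fun j => if G.Adj a j then l j else 0

/-- A minimizer of `f` over `s`. -/
def argminOn {α : Type*} [Nonempty α] (f : α → ℝ) (s : Set α) : α :=
  Classical.epsilon fun x => x ∈ s ∧ IsMinOn f s x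

/-- The data that the learner is run with: the graph, an exploration set `D`, a choice
`rev i` of an action that reveals the loss of arm `i`, the stability constants `c₁, c₂` of the
base algorithm, the constant `c₃` used by the outer restarting scheme, and the horizon `T`. -/
structure Setup (K : ℕ) where
  G : Digraph (Fin K)
  D : Finset (Fin K)
  rev : Fin K → Fin K
  c₁ : ℝ
  c₂ : ℝ
  c₃ : ℝ
  T : ℕ

variable {K : ℕ}

/-! ### EXP3 for weakly observable graphs, on the arms other than `xhat` -/

/-- The memory of EXP3: the cumulative loss estimates `∑ ℓ̂_τ`, the sum `∑ 1/√q_τ` and the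
minimum `min q_τ` of the update probabilities received so far (they are at most `1`, so the
empty minimum is set to `1`). -/
structure Exp3State (K : ℕ) where
  cumLoss : Fin K → ℝ
  sumInvSqrt : ℝ
  minProb : ℝ

def Exp3State.start (K : ℕ) : Exp3State K := ⟨0, 0, 1⟩

/-- Receive the update probability `q` of the current round. -/
def Exp3State.receive (s : Exp3State K) (q : ℝ) : Exp3State K :=
  ⟨s.cumLoss, s.sumInvSqrt + 1 / √q, min s.minProb q⟩

/-- The learning rate, computed after the update probability of the round was received. -/
def exp3Eta (P : Setup K) (s : Exp3State K) : ℝ :=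
  ((√(weakDomNumber P.G) * s.sumInvSqrt / Real.log K) ^ (2 / 3 : ℝ)
    + 4 * weakDomNumber P.G / s.minProb)⁻¹

def exp3Gamma (P : Setup K) (s : Exp3State K) (q : ℝ) : ℝ :=
  √(exp3Eta P (s.receive q) * weakDomNumber P.G / q)

/-- The follow-the-regularized-leader distribution over the arms other than `xhat`, with the
negative Shannon entropy as regularizer. -/
def exp3Leader (P : Setup K) (xhat : Fin K) (s : Exp3State K) (q : ℝ) : Fin K → ℝ :=
  argminOn
    (fun x => ∑ i, x i * s.cumLoss i
      + (1 / exp3Eta P (s.receive q)) * ∑ i, x i * Real.log (x i))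
    {x | x ∈ stdSimplex ℝ (Fin K) ∧ x xhat = 0}

open scoped Classical in
/-- The sampling distribution of EXP3: the leader mixed with the uniform distribution on `D`. -/
def exp3Prob (P : Setup K) (xhat : Fin K) (s : Exp3State K) (q : ℝ) (a : Fin K) : ℝ :=
  (1 - exp3Gamma P s q) * exp3Leader P xhat s q a
    + exp3Gamma P s q * (if a ∈ P.D then 1 / (P.D.card : ℝ) else 0)

open scoped Classical in
/-- The loss estimate after the arm `a` was sampled by EXP3; `upd` tells whether the feedback
`obs` of the arm `a` was received. -/
def exp3Estimate (P : Setup K) (xhat : Fin K) (s : Exp3State K) (q : ℝ) (a : Fin K)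
    (upd : Prop) (obs : Fin K → ℝ) (i : Fin K) : ℝ :=
  if upd ∧ P.G.Adj a i then
    obs i / ((∑ j with P.G.Adj j i, exp3Prob P xhat s q j) * q)
  else 0

def exp3Step (P : Setup K) (xhat : Fin K) (s : Exp3State K) (q : ℝ) (a : Fin K)
    (upd : Prop) (obs : Fin K → ℝ) : Exp3State K :=
  { s.receive q with
    cumLoss := fun i => s.cumLoss i + exp3Estimate P xhat s q a upd obs i }

/-! ### The Corral algorithm for exponent `2/3` over the candidate and EXP3

Index `0` of `Fin 2` stands for the candidate, index `1` for the base algorithm. -/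

/-- The memory of Corral: the candidate, the number of completed rounds, `∑ z_τ`,
`∑ 1/√q_{τ,2}`, `min q_{τ,2}` and the memory of the base algorithm. -/
structure CorralState (K : ℕ) where
  xhat : Fin K
  rounds : ℕ
  cumZ : Fin 2 → ℝ
  sumInvSqrt : ℝ
  minProb : ℝ
  base : Exp3State K

def CorralState.start (xhat : Fin K) : CorralState K :=
  ⟨xhat, 0, 0, 0, 1, Exp3State.start K⟩

/-- The bonus `B_{t-1}` available in round `t`, with `B_0 = 0`. -/
def bonus (P : Setup K) (s : CorralState K) : ℝ :=
  if s.rounds = 0 then 0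
  else P.c₁ ^ (1 / 3 : ℝ) * s.sumInvSqrt ^ (2 / 3 : ℝ) + P.c₂ / s.minProb

/-- The learning rate `η_t`, where `t = s.rounds + 1` is the current round. -/
def corralEta (P : Setup K) (s : CorralState K) : ℝ :=
  1 / (((s.rounds + 1 : ℕ) : ℝ) ^ (2 / 3 : ℝ) + 8 * P.c₁ ^ (1 / 3 : ℝ))

def corralBeta (P : Setup K) : ℝ := 1 / (8 * P.c₂)

/-- The hybrid regularizer: `2/3`-Tsallis entropy plus log-barrier. -/
def corralPotential (P : Setup K) (s : CorralState K) (q : Fin 2 → ℝ) : ℝ :=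
  -(3 / corralEta P s) * ∑ i, q i ^ (2 / 3 : ℝ)
    + (1 / corralBeta P) * ∑ i, Real.log (1 / q i)

/-- `q̄_t`. The log-barrier is infinite on the boundary of the simplex, so the minimum is over
the relative interior. -/
def corralLeader (P : Setup K) (s : CorralState K) : Fin 2 → ℝ :=
  argminOn
    (fun q => ∑ i, q i * (s.cumZ i - ![0, bonus P s] i) + corralPotential P s q)
    {q | (∀ i, 0 < q i) ∧ ∑ i, q i = 1}

/-- `γ_t`, the solution in `(0, 1)` of
`γ = max {√η_t q_{t,2}^{2/3}, η_t q_{t,2}^{1/3}}` with `q_{t,2} = (1 - γ) q̄_{t,2}`. The right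
side is continuous and decreasing in `γ`, positive at `0` and `0` at `1`, so the solution exists
and is unique. -/
def corralGamma (P : Setup K) (s : CorralState K) : ℝ :=
  Classical.epsilon fun γ : ℝ => 0 < γ ∧ γ < 1 ∧
    γ = max (√(corralEta P s) * ((1 - γ) * corralLeader P s 1) ^ (2 / 3 : ℝ))
          (corralEta P s * ((1 - γ) * corralLeader P s 1) ^ (1 / 3 : ℝ))

/-- `q_{t,2}`, the probability that the base algorithm receives its feedback in this round. -/
def baseProb (P : Setup K) (s : CorralState K) : ℝ :=
  (1 - corralGamma P s) * corralLeader P s 1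

/-- The random choices of one round: the proposal of the base algorithm, whether the round is
an exploration round, and the index that is followed or explored. -/
structure Draw (K : ℕ) where
  proposal : Fin K
  explore : Bool
  index : Fin 2

/-- The probability of a draw. The proposal follows EXP3, independently the round explores
with probability `γ_t`; the index follows `q̄_t` if the round does not explore, and it is
uniform if the round explores. -/
def drawProb (P : Setup K) (s : CorralState K) (d : Draw K) : ℝ :=
  exp3Prob P s.xhat s.base (baseProb P s) d.proposal *
    (if d.explore then corralGamma P s * (1 / 2)
      else (1 - corralGamma P s) * corralLeader P s d.index)

/-- The arm that is followed or explored. -/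
def target (s : CorralState K) (d : Draw K) : Fin K :=
  if d.index = 0 then s.xhat else d.proposal

/-- The arm that is played. -/
def action (P : Setup K) (s : CorralState K) (d : Draw K) : Fin K :=
  if d.explore then P.rev (target s d) else target s d

/-- The loss estimate `z_{t,i}`, conditionally unbiased: given that the round explores, each index
is explored with probability `1/2`. -/
def lossEstimate (P : Setup K) (s : CorralState K) (d : Draw K) (obs : Fin K → ℝ)
    (i : Fin 2) : ℝ :=
  if d.explore = true ∧ d.index = i then 2 * obs (target s d) / corralGamma P s else 0

def corralStep (P : Setup K) (s : CorralState K) (d : Draw K) (obs : Fin K → ℝ) :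
    CorralState K where
  xhat := s.xhat
  rounds := s.rounds + 1
  cumZ := fun i => s.cumZ i + lossEstimate P s d obs i
  sumInvSqrt := s.sumInvSqrt + 1 / √(baseProb P s)
  minProb := min s.minProb (baseProb P s)
  base := exp3Step P s.xhat s.base (baseProb P s) d.proposal
    (d.explore = false ∧ d.index = 1) obs

/-! ### The outer algorithm: restarts with a new candidate -/

/-- The memory of the whole learner: the state of the current Corral instance, the numbers
of plays `N_k(x)` in the current epoch, and the length `T_k - T_{k-1}` of the previous epoch. -/
structure State (K : ℕ) where
  corral : CorralState K
  count : Fin K → ℕ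
  prevLength : ℝ

/-- Start with candidate `xhat`; the fictitious previous epoch has length `c₃ log T`. -/
def State.start (P : Setup K) (xhat : Fin K) : State K :=
  ⟨CorralState.start xhat, 0, P.c₃ * Real.log P.T⟩

open scoped Classical in
/-- One round: advance Corral, count the play, and restart with candidate `x` if the current
epoch is at least twice as long as the previous one and some `x` other than the
current candidate was played in at least half of its rounds. -/
def State.step (P : Setup K) (s : State K) (d : Draw K) (obs : Fin K → ℝ) : State K :=
  let c := corralStep P s.corral d obs
  let N : Fin K → ℕ := fun x => s.count x + if action P s.corral d = x then 1 else 0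
  if h : 2 * s.prevLength ≤ (c.rounds : ℝ) ∧
      ∃ x, x ≠ s.corral.xhat ∧ (c.rounds : ℝ) / 2 ≤ (N x : ℝ) then
    ⟨CorralState.start h.2.choose, 0, (c.rounds : ℝ)⟩
  else
    ⟨c, N, s.prevLength⟩

/-! ### The interaction with the environment -/

/-- The interaction over rounds `0, …, T - 1` on a probability space. `ℱ t` is the information of the
environment before round `t`; it contains all past losses and all past random choices of the
learner. The loss vectors `ℓ t` are otherwise arbitrary in `[-1, 1]^K`. Given `ℱ t` and `ℓ t`, the
learner's draw `d t` has the law prescribed by its state `s t`; then the state is updated from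
the graph feedback alone. -/
structure IsRun {Ω : Type*} [mΩ : MeasurableSpace Ω] (μ : Measure Ω) (P : Setup K)
    (ℱ : Filtration ℕ mΩ) (ℓ : ℕ → Ω → Fin K → ℝ) (x₁ : Ω → Fin K)
    (d : ℕ → Ω → Draw K) (s : ℕ → Ω → State K) : Prop where
  loss_measurable : ∀ t < P.T, Measurable[ℱ (t + 1)] (ℓ t)
  loss_bounded : ∀ t < P.T, ∀ ω i, ℓ t ω i ∈ Set.Icc (-1 : ℝ) 1
  candidate_measurable : Measurable[ℱ 0] x₁
  candidate_uniform : ∀ x, μ.real {ω | x₁ ω = x} = 1 / (K : ℝ)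
  draw_measurable : ∀ t < P.T, ∀ e, MeasurableSet[ℱ (t + 1)] {ω | d t ω = e}
  draw_law : ∀ t < P.T, ∀ e,
    μ[Set.indicator {ω | d t ω = e} (fun _ => (1 : ℝ)) |
        ℱ t ⊔ MeasurableSpace.comap (ℓ t) inferInstance]
      =ᵐ[μ] fun ω => drawProb P (s t ω).corral e
  state_zero : ∀ ω, s 0 ω = State.start P (x₁ ω)
  state_succ : ∀ t < P.T, ∀ ω, s (t + 1) ω =
    (s t ω).step P (d t ω) (feedback P.G (action P (s t ω).corral (d t ω)) (ℓ t ω))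

/-- The pseudo-regret of the learner against the fixed arm `u`. -/
def pseudoRegret {Ω : Type*} [MeasurableSpace Ω] (μ : Measure Ω) (P : Setup K)
    (ℓ : ℕ → Ω → Fin K → ℝ) (d : ℕ → Ω → Draw K) (s : ℕ → Ω → State K) (u : Fin K) : ℝ :=
  ∫ ω, ∑ t ∈ Finset.range P.T, (ℓ t ω (action P (s t ω).corral (d t ω)) - ℓ t ω u) ∂μ

/-- The corrupted stochastic regime: in round `t`, given the past, every arm `x ≠ xstar` is in
expectation worse than `xstar` by at least `Δ - C t`. -/
def IsCorruptedStochastic {Ω : Type*} [mΩ : MeasurableSpace Ω] (μ : Measure Ω) (T : ℕ)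
    (ℱ : Filtration ℕ mΩ) (ℓ : ℕ → Ω → Fin K → ℝ) (xstar : Fin K) (Δ : ℝ) (C : ℕ → ℝ) : Prop :=
  ∀ t < T, 0 ≤ C t ∧ ∀ x, x ≠ xstar →
    ∀ᵐ ω ∂μ, Δ - C t ≤ (μ[fun ω' => ℓ t ω' x - ℓ t ω' xstar | ℱ t]) ω

/-- The learner for the graph `G` with exploration set `D`, revealing actions `rev` and
horizon `T`, tuned with `c₁ = c₂ = a δ log K` and `c₃ = b (c₁^{1/3} + c₂)`. -/
def tunedSetup (a b : ℝ) (G : Digraph (Fin K)) (D : Finset (Fin K)) (rev : Fin K → Fin K)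
    (T : ℕ) : Setup K where
  G := G
  D := D
  rev := rev
  c₁ := a * (weakDomNumber G * Real.log K)
  c₂ := a * (weakDomNumber G * Real.log K)
  c₃ := b * ((a * (weakDomNumber G * Real.log K)) ^ (1 / 3 : ℝ)
    + a * (weakDomNumber G * Real.log K))
  T := T

end

end GraphBandit

namespace GraphBandit
noncomputable section

/-! ### Cube roots -/

/-! The proof is a potential argument. For Corral, the potential `corralRegretPotential` against an
arm u is the value of the regularized leader problem, minus the linear loss of a comparator close to
the vertex standing for u, minus (when u is not the candidate) the potential `exp3Potential` of the
base algorithm. By `corral_regret_step`, the conditional regret of a round is at most the expected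
growth of this potential plus the explicit `corralCost` and a boundary term 2ε.

Two facts make this work. First, the bonus pays for EXP3: its potential, however small the update
probabilities were, is at least minus half the bonus (`neg_exp3Potential_le`). A comparator with
weight at least 1/2 on the base collects at least half the bonus, so the Corral potential never
exceeds a multiple of c log(1/ε) (`corralRegretPotential_le`). Second, the leader is stable
(`leadVal_step`). The Tsallis part yields the usual local-norm term for the loss estimates; if the
weight of the base grows by more than a factor 8, Tsallis part and log-barrier together make the
divergence large enough to absorb both loss and bonus.

The costs of an epoch are summed in two ways. By length they give c^{1/3} n^{2/3}
(`corralCost_le_length`). With a free parameter λ, Young's inequality gives λ ∑ q_t plus c/λ² times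
logarithms (`corralCost_le_prob`). Completed epochs always use the first way: lengths at least
double, so the sum of n^{2/3} is geometric and is governed by the last completed epoch
(`IsPath.costs`). Each restart loses O(c log ρ) of potential, and doubling bounds the number of
restarts. The smallest update probability is controlled by the total size W of the loss estimates,
whose mean is at most 2T. Since log is concave, log(4 + W/(4c)) is bounded pathwise by its tangent
at ρ = `barrierScale`, the value for W = 2T, and only then are expectations taken.

In the adversarial regime the sum over lengths gives the claim. In the stochastic regime, let N
count the plays of arms other than x*. An epoch whose candidate is not x*, and any epoch ended by a
restart, has length O(N + c log T) (`IsPath.counts`). While x* is the candidate, following the base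
usually plays another arm, so the mean of ∑ q_t is at most twice that of N
(`IsRun.integral_baseMass_le`). Altogether the regret is O(λ E N + c log T / λ²), whereas the gap
condition bounds the regret against x* below by Δ E N - C. Eliminating E N and optimizing λ is
`self_bounding`. If C is at least TΔ/2, the adversarial bound is already good enough.

Measurability needs an argument because the algorithm is defined through choice of minimizers.
Leader and exploration probability are monotone functions of one real variable, the EXP3 minimizer
is an explicit softmax, and the next candidate depends only on a finite set. Crude deterministic
bounds at each time give integrability. -/

lemma rpow_third_pow {x : ℝ} (hx : 0 ≤ x) : (x ^ (1 / 3 : ℝ)) ^ 3 = x := by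
  rw [← Real.rpow_natCast, ← Real.rpow_mul hx]; norm_num

lemma rpow_two_thirds_eq {x : ℝ} (hx : 0 ≤ x) : x ^ (2 / 3 : ℝ) = (x ^ (1 / 3 : ℝ)) ^ 2 := by
  rw [← Real.rpow_natCast, ← Real.rpow_mul hx]; norm_num

/-! ### The hybrid regularizer in one variable -/

/-- The hybrid regularizer of the point `(1 - x, x)` of the simplex, with inverse learning rate `A`,
normalized to have no Tsallis part at the vertices. -/
def hybridReg (A c x : ℝ) : ℝ :=
  -3 * A * (x ^ (2 / 3 : ℝ) + (1 - x) ^ (2 / 3 : ℝ) - 1) - 8 * c * (Real.log x + Real.log (1 - x))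

/-- The derivative of `hybridReg`. -/
def hybridRegDeriv (A c x : ℝ) : ℝ :=
  -2 * A * ((x ^ (1 / 3 : ℝ))⁻¹ - ((1 - x) ^ (1 / 3 : ℝ))⁻¹) - 8 * c * (1 / x - 1 / (1 - x))

/-- The Bregman divergence of `-3 A x^{2/3} - 8 c log x`. -/
def coordDiv (A c x y : ℝ) : ℝ :=
  A * (-3 * x ^ (2 / 3 : ℝ) + 3 * y ^ (2 / 3 : ℝ) + 2 * (y ^ (1 / 3 : ℝ))⁻¹ * (x - y))
    + 8 * c * (x / y - 1 - Real.log (x / y))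

lemma hybridReg_sub {A c x y : ℝ} (hx : x ∈ Set.Ioo (0 : ℝ) 1) (hy : y ∈ Set.Ioo (0 : ℝ) 1) :
    hybridReg A c x - hybridReg A c y
      = hybridRegDeriv A c y * (x - y) + coordDiv A c x y + coordDiv A c (1 - x) (1 - y) := by
  have hx0 : x ≠ 0 := hx.1.ne'
  have hy0 : y ≠ 0 := hy.1.ne'
  have hx1 : 1 - x ≠ 0 := by linarith [hx.2]
  have hy1 : 1 - y ≠ 0 := by linarith [hy.2]
  unfold hybridReg hybridRegDeriv coordDiv
  rw [Real.log_div hx0 hy0, Real.log_div hx1 hy1]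
  have e1 : x / y = x * (1 / y) := by ring
  have e2 : (1 - x) / (1 - y) = (1 - x) * (1 / (1 - y)) := by ring
  have e3 : y * (1 / y) = 1 := by field_simp
  have e4 : (1 - y) * (1 / (1 - y)) = 1 := by field_simp
  rw [e1, e2]
  linear_combination (-8 * c) * e3 - (8 * c) * e4

/-- In the cube roots X and Y of x and y the divergence is a polynomial divided by Y, with a double
zero at X = Y. All estimates of the Tsallis part thereby become polynomial inequalities. -/
lemma tsallis_div_eq {x y : ℝ} (hx : 0 ≤ x) (hy : 0 < y) :
    -3 * x ^ (2 / 3 : ℝ) + 3 * y ^ (2 / 3 : ℝ) + 2 * (y ^ (1 / 3 : ℝ))⁻¹ * (x - y)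
      = (x ^ (1 / 3 : ℝ) - y ^ (1 / 3 : ℝ)) ^ 2
          * (y ^ (1 / 3 : ℝ) + 2 * x ^ (1 / 3 : ℝ)) / y ^ (1 / 3 : ℝ) := by
  have hX := rpow_third_pow hx
  have hY := rpow_third_pow hy.le
  rw [rpow_two_thirds_eq hx, rpow_two_thirds_eq hy.le]
  have hY0 : 0 < y ^ (1 / 3 : ℝ) := by positivity
  set X := x ^ (1 / 3 : ℝ)
  set Y := y ^ (1 / 3 : ℝ)
  rw [← hX, ← hY]
  field_simp
  ring

lemma sub_log_nonneg {r : ℝ} (hr : 0 < r) : 0 ≤ r - 1 - Real.log r := by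
  linarith [Real.log_le_sub_one_of_pos hr]

lemma tsallis_div_nonneg {x y : ℝ} (hx : 0 ≤ x) (hy : 0 < y) :
    0 ≤ -3 * x ^ (2 / 3 : ℝ) + 3 * y ^ (2 / 3 : ℝ) + 2 * (y ^ (1 / 3 : ℝ))⁻¹ * (x - y) := by
  rw [tsallis_div_eq hx hy]; positivity

lemma coordDiv_nonneg {A c x y : ℝ} (hA : 0 ≤ A) (hc : 0 ≤ c) (hx : 0 < x) (hy : 0 < y) :
    0 ≤ coordDiv A c x y := by
  have h1 := tsallis_div_nonneg hx.le hy
  have h2 := sub_log_nonneg (div_pos hx hy)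
  unfold coordDiv
  positivity

lemma coordDiv_pos {A c x y : ℝ} (hA : 0 ≤ A) (hc : 0 < c) (hx : 0 < x) (hy : 0 < y)
    (hxy : x ≠ y) : 0 < coordDiv A c x y := by
  have h1 := tsallis_div_nonneg hx.le hy
  have h2 : 0 < x / y - 1 - Real.log (x / y) := by
    have : x / y ≠ 1 := by rwa [Ne, div_eq_one_iff_eq hy.ne']
    linarith [Real.log_lt_sub_one_of_pos (div_pos hx hy) this]
  unfold coordDiv
  positivity

/-- Points far above `y` have large divergence. -/
lemma coordDiv_ge_of_far {A c x y : ℝ} (hA : 0 ≤ A) (hc : 0 ≤ c) (hy : 0 < y) (hxy : 8 * y ≤ x) :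
    (x / y - 1) * (A * y ^ (2 / 3 : ℝ) / 2 + 4 * c) ≤ coordDiv A c x y := by
  have hx : 0 < x := by linarith
  unfold coordDiv
  rw [tsallis_div_eq hx.le hy, rpow_two_thirds_eq hy.le]
  have hX := rpow_third_pow hx.le
  have hY := rpow_third_pow hy.le
  have hY0 : 0 < y ^ (1 / 3 : ℝ) := by positivity
  have hX0 : 0 < x ^ (1 / 3 : ℝ) := by positivity
  have hr8 : 8 ≤ x / y := by rw [le_div_iff₀ hy]; exact hxy
  -- The tangent of log at 8 together with log 8 ≤ 2.1; this is where the factor 8 enters.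
  have hlog : Real.log (x / y) ≤ (x / y - 1) / 2 := by
    have h1 := Real.log_le_sub_one_of_pos (show 0 < (x / y) / 8 by positivity)
    rw [Real.log_div (by positivity) (by norm_num)] at h1
    have h2 : Real.log 8 ≤ 2.1 := by
      have : (8 : ℝ) = 2 ^ 3 := by norm_num
      rw [this, Real.log_pow]
      have := Real.log_two_lt_d9
      norm_num; linarith
    linarith
  have h2 : (x / y - 1) * (4 * c) ≤ 8 * c * (x / y - 1 - Real.log (x / y)) := by
    nlinarith
  have h3 : (x / y - 1) * (y ^ (1 / 3 : ℝ)) ^ 2 / 2 ≤ (x ^ (1 / 3 : ℝ) - y ^ (1 / 3 : ℝ)) ^ 2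
          * (y ^ (1 / 3 : ℝ) + 2 * x ^ (1 / 3 : ℝ)) / y ^ (1 / 3 : ℝ) := by
    set X := x ^ (1 / 3 : ℝ)
    set Y := y ^ (1 / 3 : ℝ)
    have hXY : 2 * Y ≤ X := by
      by_contra hlt
      push Not at hlt
      have : X ^ 3 < (2 * Y) ^ 3 := pow_lt_pow_left₀ hlt hX0.le (by norm_num)
      nlinarith
    rw [← hX, ← hY, le_div_iff₀ hY0]
    have : (X ^ 3 / Y ^ 3 - 1) * Y ^ 2 / 2 * Y = (X ^ 3 - Y ^ 3) / 2 := by field_simp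
    rw [this]
    -- In terms of u = X - 2Y ≥ 0 the difference of the two sides has only nonnegative coefficients.
    obtain ⟨u, hu⟩ : ∃ u, u = X - 2 * Y := ⟨_, rfl⟩
    have hu0 : 0 ≤ u := by linarith
    have hXe : X = u + 2 * Y := by linarith
    rw [hXe]
    nlinarith [mul_nonneg hu0 hY0.le, pow_nonneg hu0 3, mul_nonneg (mul_nonneg hu0 hu0) hY0.le,
      mul_nonneg hu0 (mul_nonneg hY0.le hY0.le), pow_pos hY0 3]
  nlinarith [mul_le_mul_of_nonneg_left h3 hA]

/-- For x ≤ 8y the Tsallis divergence dominates the square A (x - y)² / (10 y^{4/3}), and the linear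
term is split by the arithmetic-geometric mean inequality. The log-barrier part is only used to be
nonnegative. -/
lemma linear_le_coordDiv_of_near {A c x y w : ℝ} (hA : 0 < A) (hc : 0 ≤ c) (hx : 0 < x) (hy : 0 < y)
    (hxy : x ≤ 8 * y) :
    (y - x) * w ≤ coordDiv A c x y + 5 / 2 * y ^ (4 / 3 : ℝ) * w ^ 2 / A := by
  unfold coordDiv
  have h2 := sub_log_nonneg (div_pos hx hy)
  have h2' : 0 ≤ 8 * c * (x / y - 1 - Real.log (x / y)) := by positivity
  rw [tsallis_div_eq hx.le hy]
  have hX := rpow_third_pow hx.le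
  have hY := rpow_third_pow hy.le
  have hY0 : 0 < y ^ (1 / 3 : ℝ) := by positivity
  have hX0 : 0 < x ^ (1 / 3 : ℝ) := by positivity
  have h43 : y ^ (4 / 3 : ℝ) = (y ^ (1 / 3 : ℝ)) ^ 4 := by
    rw [← Real.rpow_natCast, ← Real.rpow_mul hy.le]; norm_num
  rw [h43]
  set X := x ^ (1 / 3 : ℝ)
  set Y := y ^ (1 / 3 : ℝ)
  have hXY : X ≤ 2 * Y := by
    by_contra hlt
    push Not at hlt
    have : (2 * Y) ^ 3 < X ^ 3 := pow_lt_pow_left₀ hlt (by positivity) (by norm_num)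
    nlinarith
  have key : (Y ^ 3 - X ^ 3) * w ≤ A * ((X - Y) ^ 2 * (Y + 2 * X) / Y) + 5 / 2 * Y ^ 4 * w ^ 2 / A := by
    -- This compares the divergence with the square of Y³ - X³. The constant 10 is nearly tight at X
    -- = 2Y, where the sides are 49 Y⁴ and 50 Y⁴.
    have hpoly : (Y ^ 2 + X * Y + X ^ 2) ^ 2 ≤ 10 * (Y ^ 3 * (Y + 2 * X)) := by
      obtain ⟨u, hu⟩ : ∃ u, u = 2 * Y - X := ⟨_, rfl⟩
      have hu0 : 0 ≤ u := by linarith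
      have h5 : 10 * (Y ^ 3 * (Y + 2 * X)) - (Y ^ 2 + X * Y + X ^ 2) ^ 2
        = 9 * Y ^ 4 + X * (18 * Y ^ 3 - 3 * X * Y ^ 2 - 2 * X ^ 2 * Y - X ^ 3) := by ring
      have h6 : 18 * Y ^ 3 - 3 * X * Y ^ 2 - 2 * X ^ 2 * Y - X ^ 3 ≥ -4 * Y ^ 3 := by
        have a1 : X * Y ^ 2 ≤ 2 * Y ^ 3 := by nlinarith [pow_pos hY0 2]
        have a2 : X ^ 2 * Y ≤ 4 * Y ^ 3 := by nlinarith [pow_le_pow_left₀ hX0.le hXY 2]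
        have a3 : X ^ 3 ≤ 8 * Y ^ 3 := by nlinarith [pow_le_pow_left₀ hX0.le hXY 3]
        linarith
      have h7 : X * (18 * Y ^ 3 - 3 * X * Y ^ 2 - 2 * X ^ 2 * Y - X ^ 3) ≥ X * (-4 * Y ^ 3) :=
        mul_le_mul_of_nonneg_left h6 hX0.le
      have h8 : X * Y ^ 3 ≤ 2 * Y * Y ^ 3 := mul_le_mul_of_nonneg_right hXY (by positivity)
      nlinarith [pow_pos hY0 4]
    have e : A * ((X - Y) ^ 2 * (Y + 2 * X) / Y) + 5 / 2 * Y ^ 4 * w ^ 2 / A - (Y ^ 3 - X ^ 3) * w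
      = (A ^ 2 * ((X - Y) ^ 2 * (Y + 2 * X)) + 5 / 2 * Y ^ 5 * w ^ 2 - (Y ^ 3 - X ^ 3) * w * A * Y)
        / (A * Y) := by
      field_simp
    have hnum : 0 ≤ A ^ 2 * ((X - Y) ^ 2 * (Y + 2 * X)) + 5 / 2 * Y ^ 5 * w ^ 2
        - (Y ^ 3 - X ^ 3) * w * A * Y := by
      have hf : Y ^ 3 - X ^ 3 = (Y - X) * (Y ^ 2 + X * Y + X ^ 2) := by ring
      rw [hf]
      set S := Y + 2 * X with hS
      have hS0 : 0 < S := by positivity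
      set Q := Y ^ 2 + X * Y + X ^ 2
      -- Completing the square after multiplication by S; `hpoly` bounds the leftover square of Q.
      have h9 : 0 ≤ (A * (Y - X) * S - Q * w * Y / 2) ^ 2 := sq_nonneg _
      have h10 : Q ^ 2 * (w ^ 2 * Y ^ 2 / 4) ≤ 10 * (Y ^ 3 * S) * (w ^ 2 * Y ^ 2 / 4) :=
        mul_le_mul_of_nonneg_right hpoly (by positivity)
      have h11 : 0 ≤ S * (A ^ 2 * ((X - Y) ^ 2 * S) + 5 / 2 * Y ^ 5 * w ^ 2
        - (Y - X) * Q * w * A * Y) := by nlinarith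
      exact nonneg_of_mul_nonneg_right h11 hS0
    have : 0 ≤ A * ((X - Y) ^ 2 * (Y + 2 * X) / Y) + 5 / 2 * Y ^ 4 * w ^ 2 / A
        - (Y ^ 3 - X ^ 3) * w := by rw [e]; positivity
    linarith
  rw [hX, hY] at key
  linarith

/-! ### The leader of the one-dimensional problem -/

/-- Adding the Bregman identities for the pairs (x, y) and (y, x) leaves the product of the
increments of derivative and argument equal to a positive sum of divergences. -/
lemma hybridRegDeriv_strictMono {A c x y : ℝ} (hA : 0 ≤ A) (hc : 0 < c) (hx : x ∈ Set.Ioo (0 : ℝ) 1)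
    (hy : y ∈ Set.Ioo (0 : ℝ) 1) (hxy : x < y) : hybridRegDeriv A c x < hybridRegDeriv A c y := by
  have h1 := hybridReg_sub (A := A) (c := c) hx hy
  have h2 := hybridReg_sub (A := A) (c := c) hy hx
  have h3 := coordDiv_pos hA hc hx.1 hy.1 hxy.ne
  have h4 := coordDiv_pos hA hc hy.1 hx.1 hxy.ne'
  have h5 := coordDiv_nonneg hA hc.le (sub_pos.2 hx.2) (sub_pos.2 hy.2)
  have h6 := coordDiv_nonneg hA hc.le (sub_pos.2 hy.2) (sub_pos.2 hx.2)
  nlinarith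

lemma hybridRegDeriv_le {A c x : ℝ} (hA : 0 ≤ A) (hc : 0 ≤ c) (hx : 0 < x) (hx2 : x ≤ 1 / 2) :
    hybridRegDeriv A c x ≤ 16 * c - 8 * c / x := by
  unfold hybridRegDeriv
  have h1 : ((1 - x) ^ (1 / 3 : ℝ))⁻¹ ≤ (x ^ (1 / 3 : ℝ))⁻¹ :=
    inv_anti₀ (by positivity) (Real.rpow_le_rpow hx.le (by linarith) (by norm_num))
  have h2 : 1 / (1 - x) ≤ 2 := by rw [div_le_iff₀ (by linarith)]; linarith
  have h3 := mul_nonneg hA (sub_nonneg.2 h1)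
  have h4 := mul_le_mul_of_nonneg_left h2 hc
  have h5 : 8 * c / x = 8 * (c * (1 / x)) := by ring
  rw [h5]
  linarith

lemma hybridRegDeriv_symm (A c x : ℝ) : hybridRegDeriv A c (1 - x) = -hybridRegDeriv A c x := by
  unfold hybridRegDeriv
  rw [sub_sub_cancel]
  ring

lemma exists_stationary {A c : ℝ} (hA : 0 ≤ A) (hc : 0 < c) (G : ℝ) :
    ∃ x ∈ Set.Ioo (0 : ℝ) 1, G + hybridRegDeriv A c x = 0 := by
  -- Here 8c / x₀ = |G| + 17c exceeds 16c + |G| by c, so the derivative at x₀ lies below -|G|; by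
  -- symmetry it lies above |G| at 1 - x₀.
  set x₀ := 8 * c / (|G| + 17 * c) with hx₀
  have hx0 : 0 < x₀ := by positivity
  have hx2 : x₀ ≤ 1 / 2 := by
    rw [hx₀, div_le_iff₀ (by positivity)]; linarith [abs_nonneg G]
  have hd : hybridRegDeriv A c x₀ ≤ -|G| - c := by
    have h := hybridRegDeriv_le hA hc.le hx0 hx2
    have h2 : 8 * c / x₀ = |G| + 17 * c := by rw [hx₀]; field_simp
    linarith
  have hcont : ContinuousOn (fun x => G + hybridRegDeriv A c x) (Set.Icc x₀ (1 - x₀)) := by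
    unfold hybridRegDeriv
    have p1 : ∀ x ∈ Set.Icc x₀ (1 - x₀), x ≠ 0 := fun x hx => by linarith [hx.1]
    have p2 : ∀ x ∈ Set.Icc x₀ (1 - x₀), 1 - x ≠ 0 := fun x hx => by linarith [hx.2]
    have p3 : ∀ x ∈ Set.Icc x₀ (1 - x₀), x ^ (1 / 3 : ℝ) ≠ 0 := fun x hx => by
      have : 0 < x := by linarith [hx.1]
      positivity
    have p4 : ∀ x ∈ Set.Icc x₀ (1 - x₀), (1 - x) ^ (1 / 3 : ℝ) ≠ 0 := fun x hx => by
      have : 0 < 1 - x := by linarith [hx.2]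
      positivity
    refine continuousOn_const.add (((continuousOn_const.mul (((continuousOn_id.rpow_const ?_).inv₀
      p3).sub (((continuousOn_const.sub continuousOn_id).rpow_const ?_).inv₀ p4)))).sub
      (continuousOn_const.mul ((continuousOn_const.div continuousOn_id p1).sub
        (continuousOn_const.div (continuousOn_const.sub continuousOn_id) p2))))
    · intro x hx; exact Or.inl (p1 x hx)
    · intro x hx; exact Or.inl (p2 x hx)
  have hle : x₀ ≤ 1 - x₀ := by linarith
  have hmem : (0 : ℝ) ∈ Set.Icc (G + hybridRegDeriv A c x₀) (G + hybridRegDeriv A c (1 - x₀)) := by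
    rw [hybridRegDeriv_symm]
    constructor
    · linarith [le_abs_self G]
    · linarith [neg_abs_le G]
  obtain ⟨x, hx, hx'⟩ := intermediate_value_Icc hle hcont hmem
  exact ⟨x, ⟨by linarith [hx.1], by linarith [hx.2]⟩, hx'⟩

/-- The weight of the second index in the leader, as a function of the difference `G` of the
cumulative losses. -/
def lead (A c G : ℝ) : ℝ :=
  Classical.epsilon fun x => x ∈ Set.Ioo (0 : ℝ) 1 ∧ G + hybridRegDeriv A c x = 0

lemma lead_spec {A c : ℝ} (hA : 0 ≤ A) (hc : 0 < c) (G : ℝ) :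
    lead A c G ∈ Set.Ioo (0 : ℝ) 1 ∧ G + hybridRegDeriv A c (lead A c G) = 0 := by
  obtain ⟨x, hx⟩ := exists_stationary hA hc G
  exact Classical.epsilon_spec (p := fun x => x ∈ Set.Ioo (0 : ℝ) 1 ∧ G + hybridRegDeriv A c x = 0)
    ⟨x, hx⟩

/-- Monotonicity matters mainly because it makes the leader measurable. -/
lemma lead_antitone {A c : ℝ} (hA : 0 ≤ A) (hc : 0 < c) : Antitone (lead A c) := by
  intro G₁ G₂ h
  by_contra hlt
  push Not at hlt
  have h1 := lead_spec hA hc G₁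
  have h2 := lead_spec hA hc G₂
  have := hybridRegDeriv_strictMono hA hc h1.1 h2.1 hlt
  linarith [h1.2, h2.2]

/-- The log-barrier at work: at a weight x below 1/2 its derivative contributes about -8c/x, which
stationarity forces to be balanced by the gap G. -/
lemma one_div_lead_le {A c : ℝ} (hA : 0 ≤ A) (hc : 0 < c) (G : ℝ) {W : ℝ} (hW : 0 ≤ W)
    (hG : G ≤ W) : 1 / lead A c G ≤ 2 + W / (8 * c) := by
  obtain ⟨h1, h2⟩ := lead_spec hA hc G
  have hd : 0 ≤ W / (8 * c) := by positivity
  rcases le_total (lead A c G) (1 / 2) with h | h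
  · have h3 := hybridRegDeriv_le hA hc.le h1.1 h
    have h4 : 8 * c / lead A c G ≤ 16 * c + W := by linarith
    have h5 : 8 * c / lead A c G = 8 * c * (1 / lead A c G) := by ring
    have h6 : 8 * c * (W / (8 * c)) = W := by field_simp
    have h7 : 8 * c * (1 / lead A c G) ≤ 8 * c * (2 + W / (8 * c)) := by linarith
    exact le_of_mul_le_mul_left h7 (by positivity)
  · have : 1 / lead A c G ≤ 2 := by
      rw [div_le_iff₀ h1.1]; linarith
    linarith

lemma lead_isMin {A c : ℝ} (hA : 0 ≤ A) (hc : 0 < c) (G : ℝ) {x : ℝ} (hx : x ∈ Set.Ioo (0 : ℝ) 1) :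
    G * lead A c G + hybridReg A c (lead A c G) + coordDiv A c x (lead A c G)
      ≤ G * x + hybridReg A c x := by
  obtain ⟨h1, h2⟩ := lead_spec hA hc G
  have h3 := hybridReg_sub (A := A) (c := c) hx h1
  have h4 := coordDiv_nonneg hA hc.le (sub_pos.2 hx.2) (sub_pos.2 h1.2)
  have h5 : hybridRegDeriv A c (lead A c G) = -G := by linarith
  rw [h5] at h3
  linarith

/-- The value of the leader. -/
def leadVal (A c G : ℝ) : ℝ := G * lead A c G + hybridReg A c (lead A c G)

lemma leadVal_le {A c : ℝ} (hA : 0 ≤ A) (hc : 0 < c) (G : ℝ) {x : ℝ} (hx : x ∈ Set.Ioo (0 : ℝ) 1) :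
    leadVal A c G ≤ G * x + hybridReg A c x := by
  have h1 := lead_isMin hA hc G hx
  have h2 := coordDiv_nonneg hA hc.le hx.1 (lead_spec hA hc G).1.1
  unfold leadVal
  linarith

lemma tsallis_nonneg {x : ℝ} (hx : x ∈ Set.Icc (0 : ℝ) 1) :
    0 ≤ x ^ (2 / 3 : ℝ) + (1 - x) ^ (2 / 3 : ℝ) - 1 := by
  have h1 := Real.rpow_le_rpow_of_exponent_ge' hx.1 hx.2 (by norm_num) (show (2 / 3 : ℝ) ≤ 1 by norm_num)
  have h2 := Real.rpow_le_rpow_of_exponent_ge' (sub_nonneg.2 hx.2) (by linarith [hx.1]) (by norm_num)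
    (show (2 / 3 : ℝ) ≤ 1 by norm_num)
  rw [Real.rpow_one] at h1 h2
  linarith

lemma tsallis_le {x : ℝ} (hx : x ∈ Set.Icc (0 : ℝ) 1) :
    x ^ (2 / 3 : ℝ) + (1 - x) ^ (2 / 3 : ℝ) - 1 ≤ x ^ (2 / 3 : ℝ) := by
  have := Real.rpow_le_one (sub_nonneg.2 hx.2) (by linarith [hx.1]) (show (0 : ℝ) ≤ 2 / 3 by norm_num)
  linarith

lemma hybridReg_le {A c x : ℝ} (hA : 0 ≤ A) (hx : x ∈ Set.Ioo (0 : ℝ) 1) :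
    hybridReg A c x ≤ 8 * c * Real.log (1 / (x * (1 - x))) := by
  have h := tsallis_nonneg ⟨hx.1.le, hx.2.le⟩
  have h2 := mul_nonneg hA h
  unfold hybridReg
  rw [one_div, Real.log_inv, Real.log_mul hx.1.ne' (by linarith [hx.2])]
  linarith

lemma leadVal_ge {A c : ℝ} (hA : 0 ≤ A) (hc : 0 < c) (G : ℝ) : -|G| - 3 * A ≤ leadVal A c G := by
  obtain ⟨⟨h0, h1⟩, -⟩ := lead_spec hA hc G
  unfold leadVal hybridReg
  set x := lead A c G
  have e1 := tsallis_le (x := x) ⟨h0.le, h1.le⟩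
  have e2 := Real.rpow_le_one h0.le h1.le (show (0 : ℝ) ≤ 2 / 3 by norm_num)
  have e3 := Real.log_nonpos h0.le h1.le
  have e4 := Real.log_nonpos (sub_nonneg.2 h1.le) (by linarith)
  have e5 : -|G| ≤ G * x := by
    have : |G * x| ≤ |G| := by
      rw [abs_mul, abs_of_pos h0]; nlinarith [abs_nonneg G]
    linarith [neg_abs_le (G * x)]
  have e6 : A * (x ^ (2 / 3 : ℝ) + (1 - x) ^ (2 / 3 : ℝ) - 1) ≤ A * 1 :=
    mul_le_mul_of_nonneg_left (e1.trans e2) hA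
  have e7 : 0 ≤ c * (-(Real.log x + Real.log (1 - x))) := mul_nonneg hc.le (by linarith)
  nlinarith

/-- Changing the learning rate. -/
lemma leadVal_rate {A A' c : ℝ} (hA : 0 ≤ A) (hAA' : A ≤ A') (hc : 0 < c) (G : ℝ) :
    leadVal A c G - 3 * (A' - A) * (lead A' c G) ^ (2 / 3 : ℝ) ≤ leadVal A' c G := by
  obtain ⟨h1, -⟩ := lead_spec (hA.trans hAA') hc G
  have h2 := leadVal_le hA hc G h1
  have h3 : leadVal A' c G = G * lead A' c G + hybridReg A c (lead A' c G)
      - 3 * (A' - A) * ((lead A' c G) ^ (2 / 3 : ℝ) + (1 - lead A' c G) ^ (2 / 3 : ℝ) - 1) := by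
    unfold leadVal hybridReg; ring
  have h4 := mul_le_mul_of_nonneg_left (tsallis_le ⟨h1.1.le, h1.2.le⟩) (sub_nonneg.2 hAA')
  rw [h3]
  linarith

/-- Stability of follow-the-regularized-leader under a loss `w` and a bonus `b`. -/
lemma leadVal_step {A c : ℝ} (hA : 0 < A) (hc : 1000 ≤ c) (G w b : ℝ) (hb : 0 ≤ b)
    (hb' : lead A c G * b ≤ 8 / 7 * c + 1 / 7 * (A * lead A c G ^ (2 / 3 : ℝ)))
    (hw : (lead A c G * w) ^ 2 ≤ 9 * (A * lead A c G ^ (2 / 3 : ℝ))) :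
    leadVal A c G + lead A c G * (w - b) - 5 / 2 * lead A c G ^ (4 / 3 : ℝ) * w ^ 2 / A
      - 7 * (lead A c G * b) ≤ leadVal A c (G + (w - b)) := by
  have hc0 : 0 < c := by linarith
  obtain ⟨hy, -⟩ := lead_spec hA.le hc0 G
  obtain ⟨hx, -⟩ := lead_spec hA.le hc0 (G + (w - b))
  have hmin := lead_isMin hA.le hc0 G hx
  set y := lead A c G
  set x := lead A c (G + (w - b)) with hxdef
  have hval : leadVal A c (G + (w - b)) = G * x + hybridReg A c x + x * (w - b) := by
    unfold leadVal; rw [← hxdef]; ring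
  have hvalG : leadVal A c G = G * y + hybridReg A c y := rfl
  have hdiv : 0 ≤ 5 / 2 * y ^ (4 / 3 : ℝ) * w ^ 2 / A := by
    have := hy.1
    positivity
  suffices h : (y - x) * (w - b) ≤ coordDiv A c x y + 5 / 2 * y ^ (4 / 3 : ℝ) * w ^ 2 / A
      + 7 * (y * b) by
    rw [hval, hvalG]
    linarith
  -- Up to a factor 8 the loss is absorbed by the quadratic bound and the bonus costs (x - y) b ≤ 7
  -- y b. Beyond it, the divergence grows linearly in x/y - 1 with a slope that exceeds y (b - w).
  rcases le_total x (8 * y) with h | h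
  · have h1 := linear_le_coordDiv_of_near (w := w) hA hc0.le hx.1 hy.1 h
    have h2 : (x - y) * b ≤ 7 * y * b := mul_le_mul_of_nonneg_right (by linarith) hb
    linarith
  · have h1 := coordDiv_ge_of_far hA.le hc0.le hy.1 h
    have hr : 0 ≤ x / y - 1 := by
      rw [sub_nonneg, le_div_iff₀ hy.1]; linarith [hy.1]
    have hxy : x - y = (x / y - 1) * y := by
      have := hy.1.ne'
      field_simp
    set Y := A * y ^ (2 / 3 : ℝ)
    have hY : 0 ≤ Y := by have := hy.1; positivity
    -- The square of the right side contains the cross term 4cY/7, which exceeds 9Y because c ≥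
    -- 1000.
    have h3 : -(y * w) ≤ 2 * c + Y / 7 := by
      by_contra hlt
      push Not at hlt
      have h4 : (2 * c + Y / 7) ^ 2 < (-(y * w)) ^ 2 := pow_lt_pow_left₀ hlt (by positivity) (by norm_num)
      nlinarith
    have h5 : y * (b - w) ≤ Y / 2 + 4 * c := by linarith
    have h6 := mul_le_mul_of_nonneg_left h5 hr
    have h7 : (y - x) * (w - b) = (x / y - 1) * (y * (b - w)) := by
      have : y - x = -((x / y - 1) * y) := by linarith
      rw [this]; ring
    have := hy.1
    have h8 : 0 ≤ 7 * (y * b) := by positivity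
    linarith

/-! ### The exploration probability of Corral -/

/-- The right side of the equation for the exploration probability. -/
def exploreMap (η x γ : ℝ) : ℝ :=
  max (√η * ((1 - γ) * x) ^ (2 / 3 : ℝ)) (η * ((1 - γ) * x) ^ (1 / 3 : ℝ))

lemma exploreMap_mono {η x₁ x₂ γ₁ γ₂ : ℝ} (hη : 0 ≤ η) (h0 : 0 ≤ (1 - γ₁) * x₁)
    (h : (1 - γ₁) * x₁ ≤ (1 - γ₂) * x₂) : exploreMap η x₁ γ₁ ≤ exploreMap η x₂ γ₂ := by
  unfold exploreMap
  gcongr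

/-- The exploration probability as a function of the learning rate and of the leader. -/
def exploreProb (η x : ℝ) : ℝ :=
  Classical.epsilon fun γ : ℝ => 0 < γ ∧ γ < 1 ∧ γ = exploreMap η x γ

lemma exploreProb_spec {η x : ℝ} (hη : 0 < η) (hx : 0 < x) :
    0 < exploreProb η x ∧ exploreProb η x < 1 ∧ exploreProb η x = exploreMap η x (exploreProb η x) := by
  refine Classical.epsilon_spec (p := fun γ : ℝ => 0 < γ ∧ γ < 1 ∧ γ = exploreMap η x γ) ?_
  have hcont : ContinuousOn (fun γ => γ - exploreMap η x γ) (Set.Icc 0 1) := by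
    refine Continuous.continuousOn (continuous_id.sub ?_)
    unfold exploreMap
    exact (continuous_const.mul (((continuous_const.sub continuous_id).mul
      continuous_const).rpow_const fun _ => Or.inr (by norm_num))).max
      (continuous_const.mul (((continuous_const.sub continuous_id).mul
      continuous_const).rpow_const fun _ => Or.inr (by norm_num)))
  have h0 : 0 < exploreMap η x 0 := by
    unfold exploreMap
    refine lt_max_of_lt_right ?_
    simp only [sub_zero, one_mul]
    positivity
  have h1 : exploreMap η x 1 = 0 := by
    unfold exploreMap
    norm_num
  have hmem : (0 : ℝ) ∈ Set.Icc (0 - exploreMap η x 0) (1 - exploreMap η x 1) := by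
    rw [h1]; constructor <;> linarith
  obtain ⟨γ, hγ, hγ'⟩ := intermediate_value_Icc zero_le_one hcont hmem
  have hγ'' : γ = exploreMap η x γ := by simpa [sub_eq_zero] using hγ'
  refine ⟨γ, lt_of_le_of_ne hγ.1 ?_, lt_of_le_of_ne hγ.2 ?_, hγ''⟩
  · rintro rfl; linarith
  · rintro rfl; linarith

/-- If γ decreased while x increased, then (1 - γ) x and hence the right side of the fixed-point
equation would not decrease, a contradiction. It serves measurability. -/
lemma exploreProb_monotoneOn {η : ℝ} (hη : 0 < η) : MonotoneOn (exploreProb η) (Set.Ioi 0) := by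
  intro x₁ h₁ x₂ h₂ h
  obtain ⟨a1, a2, a3⟩ := exploreProb_spec hη h₁
  obtain ⟨b1, b2, b3⟩ := exploreProb_spec hη h₂
  by_contra hlt
  push Not at hlt
  have hx1 : 0 < x₁ := h₁
  have h5 := exploreMap_mono hη.le (x₁ := x₁) (x₂ := x₂) (γ₁ := exploreProb η x₁)
    (γ₂ := exploreProb η x₂) (mul_nonneg (by linarith) hx1.le)
    (mul_le_mul (by linarith) h hx1.le (by linarith))
  linarith

end
end GraphBandit
namespace GraphBandit
noncomputable section
variable {K : ℕ}

/-! ### Tuned parameters -/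

/-- The standing assumptions on the parameters of the learner. -/
structure IsTuned (P : Setup K) (c : ℝ) : Prop where
  two_le : 2 ≤ K
  c₁_eq : P.c₁ = c
  c₂_eq : P.c₂ = c
  c₃_eq : P.c₃ = c ^ (1 / 3 : ℝ) + c
  c_eq : c = 1728 * (weakDomNumber P.G * Real.log K)
  dom : IsWeaklyDominating P.G P.D
  card : P.D.card = weakDomNumber P.G
  rev : ∀ i, P.G.Adj (P.rev i) i

namespace IsTuned

variable {P : Setup K} {c : ℝ}

lemma one_le_weakDomNumber (H : IsTuned P c) : (1 : ℝ) ≤ weakDomNumber P.G := by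
  obtain ⟨i, hi, -⟩ := H.dom ⟨0, by have := H.two_le; omega⟩
  rw [← H.card]
  exact_mod_cast Finset.card_pos.2 ⟨i, hi⟩

lemma log_ge (H : IsTuned P c) : (0.69 : ℝ) ≤ Real.log K := by
  have h1 : Real.log 2 ≤ Real.log K :=
    Real.log_le_log (by norm_num) (by exact_mod_cast H.two_le)
  linarith [Real.log_two_gt_d9]

lemma log_pos (H : IsTuned P c) : 0 < Real.log K := by linarith [H.log_ge]

lemma c_ge (H : IsTuned P c) : 1000 ≤ c := by
  rw [H.c_eq]
  nlinarith [H.one_le_weakDomNumber, H.log_ge]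

/-- The parameter a = 1728 = 12³ is a cube so that c^{1/3} is a clean multiple of (δ log K)^{1/3}.
-/
lemma rpow_c (H : IsTuned P c) : c ^ (1 / 3 : ℝ)
    = 12 * ((weakDomNumber P.G : ℝ) ^ (1 / 3 : ℝ) * (Real.log K) ^ (1 / 3 : ℝ)) := by
  have h1 := H.one_le_weakDomNumber
  have h2 := H.log_pos
  rw [H.c_eq, Real.mul_rpow (by norm_num) (by positivity), Real.mul_rpow (by positivity) h2.le]
  congr 1
  rw [show (1728 : ℝ) = 12 ^ (3 : ℝ) by norm_num, ← Real.rpow_mul (by norm_num)]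
  norm_num

lemma rpow_c_ge (H : IsTuned P c) : 10 ≤ c ^ (1 / 3 : ℝ) := by
  have : (1000 : ℝ) ^ (1 / 3 : ℝ) = 10 := by
    rw [show (1000 : ℝ) = 10 ^ (3 : ℝ) by norm_num, ← Real.rpow_mul (by norm_num)]
    norm_num
  rw [← this]
  exact Real.rpow_le_rpow (by norm_num) H.c_ge (by norm_num)

lemma rpow_c_le (H : IsTuned P c) : c ^ (1 / 3 : ℝ) ≤ c := by
  have := Real.rpow_le_rpow_of_exponent_le (by linarith [H.c_ge] : 1 ≤ c)
    (by norm_num : (1 / 3 : ℝ) ≤ 1)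
  rwa [Real.rpow_one] at this

end IsTuned

/-! ### Minimizers and increments of powers -/

/-- A strict minimizer is the only minimizer, so the choice in `argminOn` is forced. -/
lemma argminOn_eq {α : Type*} [Nonempty α] {f : α → ℝ} {s : Set α} {x : α} (hx : x ∈ s)
    (h : ∀ y ∈ s, y ≠ x → f x < f y) : argminOn f s = x := by
  have hmin : IsMinOn f s x := fun y hy => by
    change f x ≤ f y
    rcases eq_or_ne y x with hxy | hne
    · rw [hxy]
    · exact (h y hy hne).le
  have hs := Classical.epsilon_spec (p := fun x => x ∈ s ∧ IsMinOn f s x) ⟨x, hx, hmin⟩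
  by_contra hne
  have h1 := h _ hs.1 hne
  have h2 : f _ ≤ f x := hs.2 hx
  exact absurd h1 (not_lt.2 h2)

/-- The tangent of the concave function t^{2/3} at S'. It makes sums of increments divided by
S'^{1/3} telescope. -/
lemma rpow_two_thirds_sub_ge {S S' : ℝ} (hS : 0 ≤ S) (hS' : 0 < S') :
    2 / 3 * ((S' - S) / S' ^ (1 / 3 : ℝ)) ≤ S' ^ (2 / 3 : ℝ) - S ^ (2 / 3 : ℝ) := by
  rw [rpow_two_thirds_eq hS, rpow_two_thirds_eq hS'.le]
  have hX := rpow_third_pow hS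
  have hY := rpow_third_pow hS'.le
  have hY0 : 0 < S' ^ (1 / 3 : ℝ) := by positivity
  have hX0 : 0 ≤ S ^ (1 / 3 : ℝ) := by positivity
  set X := S ^ (1 / 3 : ℝ)
  set Y := S' ^ (1 / 3 : ℝ)
  rw [← hX, ← hY, ← mul_div_assoc, div_le_iff₀ hY0]
  have : 0 ≤ (Y - X) ^ 2 * (Y + 2 * X) := by positivity
  nlinarith

lemma rpow_two_thirds_sub_le {S S' : ℝ} (hS : 0 ≤ S) (hSS' : S ≤ S') (hS' : 0 < S') :
    S' ^ (2 / 3 : ℝ) - S ^ (2 / 3 : ℝ) ≤ (S' - S) / S' ^ (1 / 3 : ℝ) := by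
  have hXY : S ^ (1 / 3 : ℝ) ≤ S' ^ (1 / 3 : ℝ) := Real.rpow_le_rpow hS hSS' (by norm_num)
  rw [rpow_two_thirds_eq hS, rpow_two_thirds_eq hS'.le]
  have hX := rpow_third_pow hS
  have hY := rpow_third_pow hS'.le
  have hY0 : 0 < S' ^ (1 / 3 : ℝ) := by positivity
  have hX0 : 0 ≤ S ^ (1 / 3 : ℝ) := by positivity
  set X := S ^ (1 / 3 : ℝ)
  set Y := S' ^ (1 / 3 : ℝ)
  rw [le_div_iff₀ hY0, ← hX, ← hY]
  have : X ^ 2 * X ≤ X ^ 2 * Y := mul_le_mul_of_nonneg_left hXY (by positivity)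
  nlinarith

/-! ### Exponential weights -/

/-- The partition function of exponential weights on the arms other than `xhat`. -/
def partition (xhat : Fin K) (η : ℝ) (L : Fin K → ℝ) : ℝ :=
  ∑ i ∈ Finset.univ.erase xhat, Real.exp (-(η * L i))

/-- Exponential weights on the arms other than `xhat`. -/
def softmax (xhat : Fin K) (η : ℝ) (L : Fin K → ℝ) (i : Fin K) : ℝ :=
  if i = xhat then 0 else Real.exp (-(η * L i)) / partition xhat η L

/-- The normalized logarithm of the partition function. -/
def freeEnergy (xhat : Fin K) (η : ℝ) (L : Fin K → ℝ) : ℝ :=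
  1 / η * Real.log (partition xhat η L / (K - 1))

lemma card_erase_real (xhat : Fin K) : ((Finset.univ.erase xhat).card : ℝ) = K - 1 := by
  rw [Finset.card_erase_of_mem (Finset.mem_univ _), Finset.card_univ, Fintype.card_fin,
    Nat.cast_sub (by have := xhat.2; omega), Nat.cast_one]

lemma erase_nonempty (hK : 2 ≤ K) (xhat : Fin K) : (Finset.univ.erase xhat).Nonempty := by
  rw [← Finset.card_pos, Finset.card_erase_of_mem (Finset.mem_univ _), Finset.card_univ,
    Fintype.card_fin]
  omega

lemma partition_pos (hK : 2 ≤ K) (xhat : Fin K) (η : ℝ) (L : Fin K → ℝ) :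
    0 < partition xhat η L :=
  Finset.sum_pos (fun _ _ => Real.exp_pos _) (erase_nonempty hK xhat)

lemma sum_softmax_mul (xhat : Fin K) (η : ℝ) (L f : Fin K → ℝ) :
    ∑ i, softmax xhat η L i * f i
      = (∑ i ∈ Finset.univ.erase xhat, Real.exp (-(η * L i)) * f i) / partition xhat η L := by
  rw [← Finset.add_sum_erase _ _ (Finset.mem_univ xhat), Finset.sum_div]
  simp only [softmax, if_true, zero_mul, zero_add]
  refine Finset.sum_congr rfl fun i hi => ?_
  rw [if_neg (Finset.ne_of_mem_erase hi)]
  ring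

lemma softmax_nonneg (hK : 2 ≤ K) (xhat : Fin K) (η : ℝ) (L : Fin K → ℝ) (i : Fin K) :
    0 ≤ softmax xhat η L i := by
  have := partition_pos hK xhat η L
  unfold softmax
  split_ifs <;> positivity

lemma sum_softmax (hK : 2 ≤ K) (xhat : Fin K) (η : ℝ) (L : Fin K → ℝ) :
    ∑ i, softmax xhat η L i = 1 := by
  have h := sum_softmax_mul xhat η L (fun _ => 1)
  simp only [mul_one] at h
  rw [h]
  exact div_self (partition_pos hK xhat η L).ne'

lemma sub_le_mul_log {y p : ℝ} (hy : 0 ≤ y) (hp : 0 < p) (hne : y ≠ p) :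
    y - p < y * Real.log y - y * Real.log p := by
  rcases hy.eq_or_lt with rfl | hy0
  · simpa using hp
  · have h1 := Real.log_lt_sub_one_of_pos (div_pos hp hy0)
      (by rw [Ne, div_eq_one_iff_eq hy0.ne']; exact hne.symm)
    rw [Real.log_div hp.ne' hy0.ne'] at h1
    have h2 := mul_lt_mul_of_pos_left h1 hy0
    have h3 : y * (p / y - 1) = p - y := by field_simp
    linarith

lemma argminOn_entropy_eq (hK : 2 ≤ K) (xhat : Fin K) {η : ℝ} (hη : 0 < η) (L : Fin K → ℝ) :
    argminOn (fun x : Fin K → ℝ => ∑ i, x i * L i + (1 / η) * ∑ i, x i * Real.log (x i))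
      {x | x ∈ stdSimplex ℝ (Fin K) ∧ x xhat = 0} = softmax xhat η L := by
  have hZ := partition_pos hK xhat η L
  set Z := partition xhat η L with hZdef
  have hpos : ∀ i, i ≠ xhat → 0 < softmax xhat η L i := fun i hi => by
    rw [softmax, if_neg hi]; positivity
  -- Gibbs' variational identity: the objective is the relative entropy with respect to the softmax,
  -- up to the factor 1/η and a constant.
  have hval : ∀ y : Fin K → ℝ, (∑ i, y i = 1) → y xhat = 0 →
      ∑ i, y i * L i + (1 / η) * ∑ i, y i * Real.log (y i)
        = (1 / η) * (∑ i, (y i * Real.log (y i) - y i * Real.log (softmax xhat η L i))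
          - Real.log Z) := by
    intro y hy1 hy0
    have h1 : ∀ i, y i * Real.log (softmax xhat η L i) = -η * (y i * L i) - y i * Real.log Z := by
      intro i
      rcases eq_or_ne i xhat with rfl | hi
      · rw [hy0]; ring
      · rw [softmax, if_neg hi, Real.log_div (Real.exp_ne_zero _) hZ.ne', Real.log_exp]
        ring
    simp only [h1, Finset.sum_sub_distrib, ← Finset.mul_sum, ← Finset.sum_mul, hy1]
    field_simp
    ring
  have hxhat : softmax xhat η L xhat = 0 := by simp [softmax]
  refine argminOn_eq ⟨⟨softmax_nonneg hK xhat η L, sum_softmax hK xhat η L⟩, hxhat⟩ ?_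
  rintro y ⟨⟨hy0, hy1⟩, hyx⟩ hne
  rw [hval y hy1 hyx, hval _ (sum_softmax hK xhat η L) hxhat]
  refine mul_lt_mul_of_pos_left (sub_lt_sub_right ?_ _) (by positivity)
  have h2 : ∑ i, (y i - softmax xhat η L i)
      < ∑ i, (y i * Real.log (y i) - y i * Real.log (softmax xhat η L i)) := by
    refine Finset.sum_lt_sum (fun i _ => ?_) ?_
    · rcases eq_or_ne i xhat with rfl | hi
      · rw [hyx, hxhat]; simp
      · rcases eq_or_ne (y i) (softmax xhat η L i) with h | h
        · rw [h]; simp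
        · exact (sub_le_mul_log (hy0 i) (hpos i hi) h).le
    · obtain ⟨i, hi⟩ := Function.ne_iff.1 hne
      refine ⟨i, Finset.mem_univ _, sub_le_mul_log (hy0 i) (hpos i ?_) hi⟩
      rintro rfl
      exact hi (by rw [hyx, hxhat])
  rw [Finset.sum_sub_distrib, hy1, sum_softmax hK xhat η L] at h2
  simpa using h2

/-- Power mean inequality with exponent η/η' ≥ 1 for uniform weights. Dividing the partition
function by K - 1 makes it a mean, so decreasing the learning rate costs nothing. -/
lemma freeEnergy_mono (hK : 2 ≤ K) (xhat : Fin K) {η η' : ℝ} (hη' : 0 < η') (h : η' ≤ η)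
    (L : Fin K → ℝ) : freeEnergy xhat η' L ≤ freeEnergy xhat η L := by
  have hη : 0 < η := hη'.trans_le h
  have hn : (0 : ℝ) < K - 1 := by
    have : (2 : ℝ) ≤ K := by exact_mod_cast hK
    linarith
  have h1 := Real.rpow_arith_mean_le_arith_mean_rpow (Finset.univ.erase xhat)
    (fun _ => 1 / ((K : ℝ) - 1)) (fun i => Real.exp (-(η' * L i))) (fun _ _ => by positivity)
    (by rw [Finset.sum_const, nsmul_eq_mul, card_erase_real]; field_simp)
    (fun _ _ => (Real.exp_pos _).le) (show 1 ≤ η / η' by rwa [one_le_div hη'])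
  have h2 : ∀ i, (Real.exp (-(η' * L i))) ^ (η / η') = Real.exp (-(η * L i)) := fun i => by
    rw [← Real.exp_mul]; congr 1; field_simp
  simp only [h2, ← Finset.mul_sum] at h1
  have hp := partition_pos hK xhat η' L
  have hp2 := partition_pos hK xhat η L
  change (1 / ((K : ℝ) - 1) * partition xhat η' L) ^ (η / η')
    ≤ 1 / ((K : ℝ) - 1) * partition xhat η L at h1
  rw [one_div_mul_eq_div, one_div_mul_eq_div] at h1
  have h3 := Real.log_le_log (by positivity) h1
  rw [Real.log_rpow (by positivity)] at h3
  unfold freeEnergy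
  have h4 := mul_le_mul_of_nonneg_left h3 (show 0 ≤ 1 / η by positivity)
  refine le_trans (le_of_eq ?_) h4
  field_simp

lemma freeEnergy_ge (hK : 2 ≤ K) {xhat u : Fin K} (hu : u ≠ xhat) {η : ℝ} (hη : 0 < η)
    (L : Fin K → ℝ) : -L u - Real.log K / η ≤ freeEnergy xhat η L := by
  have hK2 : (2 : ℝ) ≤ K := by exact_mod_cast hK
  have hZ : Real.exp (-(η * L u)) ≤ partition xhat η L :=
    Finset.single_le_sum (f := fun i => Real.exp (-(η * L i))) (fun _ _ => (Real.exp_pos _).le)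
      (Finset.mem_erase.2 ⟨hu, Finset.mem_univ _⟩)
  have h1 : Real.exp (-(η * L u)) / K ≤ partition xhat η L / (K - 1) :=
    div_le_div₀ (partition_pos hK xhat η L).le hZ (by linarith) (by linarith)
  have h2 := Real.log_le_log (by positivity) h1
  rw [Real.log_div (Real.exp_ne_zero _) (by positivity), Real.log_exp] at h2
  have h3 := mul_le_mul_of_nonneg_left h2 (show 0 ≤ 1 / η by positivity)
  refine le_trans (le_of_eq ?_) h3
  field_simp

lemma abs_freeEnergy_le (hK : 2 ≤ K) (xhat : Fin K) {η M : ℝ} (hη : 0 < η) {L : Fin K → ℝ}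
    (hM : ∀ i, |L i| ≤ M) : |freeEnergy xhat η L| ≤ M := by
  have hn : (0 : ℝ) < K - 1 := by
    have : (2 : ℝ) ≤ K := by exact_mod_cast hK
    linarith
  have hZ := partition_pos hK xhat η L
  have h1 : Real.exp (-(η * M)) ≤ partition xhat η L / (K - 1) := by
    rw [le_div_iff₀ hn, ← card_erase_real xhat, mul_comm, ← nsmul_eq_mul]
    refine Finset.card_nsmul_le_sum _ _ _ fun i _ => Real.exp_le_exp.2 ?_
    have := (abs_le.1 (hM i)).2
    nlinarith
  have h2 : partition xhat η L / (K - 1) ≤ Real.exp (η * M) := by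
    rw [div_le_iff₀ hn, ← card_erase_real xhat, mul_comm, ← nsmul_eq_mul]
    refine Finset.sum_le_card_nsmul _ _ _ fun i _ => Real.exp_le_exp.2 ?_
    have := (abs_le.1 (hM i)).1
    nlinarith
  have h3 := Real.log_le_log (Real.exp_pos _) h1
  have h4 := Real.log_le_log (by positivity) h2
  rw [Real.log_exp] at h3 h4
  unfold freeEnergy
  rw [one_div_mul_eq_div, abs_le, le_div_iff₀ hη, div_le_iff₀ hη]
  constructor <;> linarith

lemma freeEnergy_zero (hK : 2 ≤ K) (xhat : Fin K) {η : ℝ} (hη : 0 < η) :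
    freeEnergy xhat η 0 = 0 := by
  have := abs_freeEnergy_le hK xhat hη (L := 0) (M := 0) (by simp)
  exact abs_nonpos_iff.1 this

/-- The standard second-order step of exponential weights: e^{-v} ≤ 1 - v + v² for |v| ≤ 1, followed
by log r ≤ r - 1. Losses of either sign are allowed. -/
lemma freeEnergy_add_le (hK : 2 ≤ K) (xhat : Fin K) {η : ℝ} (hη : 0 < η) (L l : Fin K → ℝ)
    (hl : ∀ i, |η * l i| ≤ 1) :
    freeEnergy xhat η (fun i => L i + l i) ≤ freeEnergy xhat η L
      - ∑ i, softmax xhat η L i * l i + η * ∑ i, softmax xhat η L i * l i ^ 2 := by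
  have hn : (0 : ℝ) < K - 1 := by
    have : (2 : ℝ) ≤ K := by exact_mod_cast hK
    linarith
  have hZ := partition_pos hK xhat η L
  have hZ' := partition_pos hK xhat η (fun i => L i + l i)
  have h1 : partition xhat η (fun i => L i + l i)
      ≤ partition xhat η L - η * (∑ i ∈ Finset.univ.erase xhat, Real.exp (-(η * L i)) * l i)
        + η ^ 2 * ∑ i ∈ Finset.univ.erase xhat, Real.exp (-(η * L i)) * l i ^ 2 := by
    unfold partition
    rw [Finset.mul_sum, Finset.mul_sum, ← Finset.sum_sub_distrib, ← Finset.sum_add_distrib]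
    refine Finset.sum_le_sum fun i _ => ?_
    have h2 := Real.abs_exp_sub_one_sub_id_le (x := -(η * l i)) (by rw [abs_neg]; exact hl i)
    have h3 := (abs_le.1 h2).2
    have h4 : Real.exp (-(η * (L i + l i))) = Real.exp (-(η * L i)) * Real.exp (-(η * l i)) := by
      rw [← Real.exp_add]; congr 1; ring
    rw [h4]
    have h5 : Real.exp (-(η * l i)) ≤ 1 - η * l i + (η * l i) ^ 2 := by nlinarith
    have h6 := mul_le_mul_of_nonneg_left h5 (Real.exp_pos (-(η * L i))).le
    linarith
  have h7 := Real.log_le_sub_one_of_pos (div_pos hZ' hZ)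
  rw [Real.log_div hZ'.ne' hZ.ne'] at h7
  have h8 : partition xhat η (fun i => L i + l i) / partition xhat η L - 1
      ≤ -(η * ∑ i, softmax xhat η L i * l i) + η ^ 2 * ∑ i, softmax xhat η L i * l i ^ 2 := by
    rw [sum_softmax_mul, sum_softmax_mul, sub_le_iff_le_add, div_le_iff₀ hZ]
    refine h1.trans (le_of_eq ?_)
    field_simp
    ring
  unfold freeEnergy
  rw [Real.log_div hZ.ne' hn.ne', Real.log_div hZ'.ne' hn.ne']
  have h9 := mul_le_mul_of_nonneg_left (h7.trans h8) (show 0 ≤ 1 / η by positivity)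
  have e1 : 1 / η * (-(η * ∑ i, softmax xhat η L i * l i)
      + η ^ 2 * ∑ i, softmax xhat η L i * l i ^ 2)
      = -∑ i, softmax xhat η L i * l i + η * ∑ i, softmax xhat η L i * l i ^ 2 := by
    field_simp
  rw [e1] at h9
  linarith

end
end GraphBandit
namespace GraphBandit
noncomputable section
variable {K : ℕ}

/-! ### EXP3 with update probabilities -/

/-- Memories of EXP3 that occur during a run. -/
structure Exp3State.Valid (s : Exp3State K) : Prop where
  sum_nonneg : 0 ≤ s.sumInvSqrt
  min_pos : 0 < s.minProb

lemma Exp3State.Valid.receive {s : Exp3State K} (hs : s.Valid) {q : ℝ} (hq : 0 < q) :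
    (s.receive q).Valid :=
  ⟨add_nonneg hs.sum_nonneg (by positivity), lt_min hs.min_pos hq⟩

/-! ### Learning rate and exploration rate of EXP3 -/

section rates

variable {P : Setup K} {c : ℝ}

lemma exp3Eta_pos (H : IsTuned P c) {s : Exp3State K} (hs : s.Valid) : 0 < exp3Eta P s := by
  have h1 := H.one_le_weakDomNumber
  have h2 := hs.min_pos
  have h3 := hs.sum_nonneg
  have h4 := H.log_pos
  unfold exp3Eta
  positivity

lemma exp3Eta_inv (H : IsTuned P c) {s : Exp3State K} (hs : s.Valid) :
    (exp3Eta P s)⁻¹ = (weakDomNumber P.G : ℝ) ^ (1 / 3 : ℝ) * s.sumInvSqrt ^ (2 / 3 : ℝ)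
      / (Real.log K ^ (1 / 3 : ℝ)) ^ 2 + 4 * weakDomNumber P.G / s.minProb := by
  have h1 := H.one_le_weakDomNumber
  have h3 := hs.sum_nonneg
  have h4 := H.log_pos
  unfold exp3Eta
  rw [inv_inv, Real.div_rpow (by positivity) h4.le, Real.mul_rpow (by positivity) h3,
    Real.sqrt_eq_rpow, ← Real.rpow_mul (by positivity), rpow_two_thirds_eq h4.le]
  norm_num

lemma exp3Eta_receive_le (H : IsTuned P c) {s : Exp3State K} (hs : s.Valid) {q : ℝ} (hq : 0 < q) :
    exp3Eta P (s.receive q) ≤ exp3Eta P s := by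
  have h1 := H.one_le_weakDomNumber
  have h2 := hs.min_pos
  have h3 := hs.sum_nonneg
  have h4 := H.log_pos
  have h5 : s.sumInvSqrt ≤ (s.receive q).sumInvSqrt := le_add_of_nonneg_right (by positivity)
  have h6 : (s.receive q).minProb ≤ s.minProb := min_le_left _ _
  have h7 := (hs.receive hq).min_pos
  unfold exp3Eta
  apply inv_anti₀ (by positivity)
  gcongr

lemma exp3Gamma_sq (H : IsTuned P c) {s : Exp3State K} (hs : s.Valid) {q : ℝ} (hq : 0 < q) :
    exp3Gamma P s q ^ 2 = exp3Eta P (s.receive q) * weakDomNumber P.G / q := by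
  have h1 := H.one_le_weakDomNumber
  have h2 := exp3Eta_pos H (hs.receive hq)
  unfold exp3Gamma
  rw [Real.sq_sqrt (by positivity)]

lemma exp3Gamma_pos (H : IsTuned P c) {s : Exp3State K} (hs : s.Valid) {q : ℝ} (hq : 0 < q) :
    0 < exp3Gamma P s q := by
  have h1 := H.one_le_weakDomNumber
  have h2 := exp3Eta_pos H (hs.receive hq)
  unfold exp3Gamma
  positivity

/-- The term 4δ / min q in the inverse learning rate is there to make γ² = ηδ/q at most 1/4. -/
lemma exp3Gamma_le (H : IsTuned P c) {s : Exp3State K} (hs : s.Valid) {q : ℝ} (hq : 0 < q) :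
    exp3Gamma P s q ≤ 1 / 2 := by
  have h1 := H.one_le_weakDomNumber
  have h2 := exp3Eta_pos H (hs.receive hq)
  have h3 := exp3Eta_inv H (hs.receive hq)
  have h4 := (hs.receive hq).sum_nonneg
  have h5 := H.log_pos
  have h6 : 4 * weakDomNumber P.G / q ≤ (exp3Eta P (s.receive q))⁻¹ := by
    rw [h3]
    have h7 : 4 * (weakDomNumber P.G : ℝ) / q ≤ 4 * weakDomNumber P.G / (s.receive q).minProb :=
      div_le_div_of_nonneg_left (by positivity) (hs.receive hq).min_pos (min_le_right _ _)
    have h8 : 0 ≤ (weakDomNumber P.G : ℝ) ^ (1 / 3 : ℝ) * (s.receive q).sumInvSqrt ^ (2 / 3 : ℝ)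
      / (Real.log K ^ (1 / 3 : ℝ)) ^ 2 := by positivity
    linarith
  have h9 : exp3Eta P (s.receive q) * weakDomNumber P.G / q ≤ 1 / 4 := by
    have h10 := mul_le_mul_of_nonneg_left h6 h2.le
    rw [mul_inv_cancel₀ h2.ne'] at h10
    have : exp3Eta P (s.receive q) * (4 * weakDomNumber P.G / q)
      = 4 * (exp3Eta P (s.receive q) * weakDomNumber P.G / q) := by ring
    linarith
  rw [← exp3Gamma_sq H hs hq] at h9
  nlinarith

/-- The exploration of EXP3 is paid for by the growth of `(∑ q⁻¹ᐟ²)^{2/3}`. -/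
lemma exp3Gamma_le_sub (H : IsTuned P c) {s : Exp3State K} (hs : s.Valid) {q : ℝ} (hq : 0 < q) :
    3 * exp3Gamma P s q ≤ 9 / 2 * ((weakDomNumber P.G : ℝ) ^ (1 / 3 : ℝ) * Real.log K ^ (1 / 3 : ℝ))
      * ((s.receive q).sumInvSqrt ^ (2 / 3 : ℝ) - s.sumInvSqrt ^ (2 / 3 : ℝ)) := by
  have h1 := H.one_le_weakDomNumber
  have h2 := exp3Eta_pos H (hs.receive hq)
  have h3 := exp3Eta_inv H (hs.receive hq)
  have h4 : 0 < (s.receive q).sumInvSqrt := add_pos_of_nonneg_of_pos hs.sum_nonneg (by positivity)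
  have h5 := H.log_pos
  have h6 := rpow_two_thirds_sub_ge hs.sum_nonneg h4
  have h7 : (s.receive q).sumInvSqrt - s.sumInvSqrt = 1 / √q := add_sub_cancel_left _ _
  rw [h7] at h6
  have hsq := exp3Gamma_sq H hs hq
  have hγ := exp3Gamma_pos H hs hq
  have hm := (hs.receive hq).min_pos
  have hD := rpow_third_pow (show (0 : ℝ) ≤ weakDomNumber P.G by linarith)
  have hD0 : 0 < (weakDomNumber P.G : ℝ) ^ (1 / 3 : ℝ) := by positivity
  have hL0 : 0 < Real.log K ^ (1 / 3 : ℝ) := by positivity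
  have hY0 : 0 < (s.receive q).sumInvSqrt ^ (1 / 3 : ℝ) := by positivity
  rw [rpow_two_thirds_eq h4.le] at h3 
  set γ := exp3Gamma P s q
  set η := exp3Eta P (s.receive q)
  set Dr := (weakDomNumber P.G : ℝ) ^ (1 / 3 : ℝ)
  set Lr := Real.log K ^ (1 / 3 : ℝ)
  set Y := (s.receive q).sumInvSqrt ^ (1 / 3 : ℝ)
  have h8 : γ ≤ Dr * Lr * (1 / √q / Y) := by
    have h9 : Dr * Y ^ 2 / Lr ^ 2 ≤ η⁻¹ := by
      rw [h3]
      have : 0 ≤ 4 * (weakDomNumber P.G : ℝ) / (s.receive q).minProb := by positivity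
      linarith
    have h10 : η ≤ Lr ^ 2 / (Dr * Y ^ 2) := by
      rw [← inv_inv η]
      refine (inv_anti₀ (by positivity) h9).trans (le_of_eq ?_)
      rw [inv_div]
    have h11 : γ ^ 2 ≤ (Dr * Lr * (1 / √q / Y)) ^ 2 := by
      rw [hsq, ← hD]
      have h12 : (Dr * Lr * (1 / √q / Y)) ^ 2 = Lr ^ 2 / (Dr * Y ^ 2) * Dr ^ 3 / q := by
        have hqs : √q ^ 2 = q := Real.sq_sqrt hq.le
        rw [← hqs]
        field_simp
        rw [Real.sqrt_sq (Real.sqrt_nonneg q)]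
      rw [h12]
      gcongr
    exact le_of_sq_le_sq h11 (by positivity)
  have h13 := mul_le_mul_of_nonneg_left h6 (show 0 ≤ 9 / 2 * (Dr * Lr) by positivity)
  refine le_trans ?_ h13
  linarith

end rates

/-! ### Sampling distribution and loss estimates -/

section sampling

variable {P : Setup K} {c : ℝ}

lemma exp3Leader_eq (H : IsTuned P c) (xhat : Fin K) {s : Exp3State K} (hs : s.Valid) {q : ℝ}
    (hq : 0 < q) :
    exp3Leader P xhat s q = softmax xhat (exp3Eta P (s.receive q)) s.cumLoss :=
  argminOn_entropy_eq H.two_le xhat (exp3Eta_pos H (hs.receive hq)) s.cumLoss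

lemma sum_exp3Prob_mul (xhat : Fin K) (s : Exp3State K) (q : ℝ) (f : Fin K → ℝ) :
    ∑ a, exp3Prob P xhat s q a * f a = (1 - exp3Gamma P s q) * ∑ a, exp3Leader P xhat s q a * f a
      + exp3Gamma P s q * ((∑ a ∈ P.D, f a) / P.D.card) := by
  classical
  have : (∑ a ∈ P.D, f a) / P.D.card = ∑ a, (if a ∈ P.D then 1 / (P.D.card : ℝ) else 0) * f a := by
    simp only [ite_mul, zero_mul, Finset.sum_ite_mem, Finset.univ_inter, Finset.sum_div]
    exact Finset.sum_congr rfl fun _ _ => by ring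
  rw [this, Finset.mul_sum, Finset.mul_sum, ← Finset.sum_add_distrib]
  refine Finset.sum_congr rfl fun a _ => ?_
  unfold exp3Prob
  ring_nf

lemma exp3Prob_nonneg (H : IsTuned P c) (xhat : Fin K) {s : Exp3State K} (hs : s.Valid) {q : ℝ}
    (hq : 0 < q) (a : Fin K) : 0 ≤ exp3Prob P xhat s q a := by
  classical
  have h1 := exp3Gamma_pos H hs hq
  have h2 := exp3Gamma_le H hs hq
  have h3 := softmax_nonneg H.two_le xhat (exp3Eta P (s.receive q)) s.cumLoss a
  unfold exp3Prob
  rw [exp3Leader_eq H xhat hs hq]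
  refine add_nonneg (mul_nonneg (by linarith) h3) (mul_nonneg h1.le ?_)
  split_ifs <;> positivity

lemma sum_exp3Prob (H : IsTuned P c) (xhat : Fin K) {s : Exp3State K} (hs : s.Valid) {q : ℝ}
    (hq : 0 < q) : ∑ a, exp3Prob P xhat s q a = 1 := by
  have h := sum_exp3Prob_mul (P := P) xhat s q (fun _ => 1)
  simp only [mul_one] at h
  have h1 := H.one_le_weakDomNumber
  rw [h, exp3Leader_eq H xhat hs hq, sum_softmax H.two_le, Finset.sum_const, H.card, nsmul_eq_mul]
  have : (weakDomNumber P.G : ℝ) ≠ 0 := by linarith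
  field_simp
  ring

open scoped Classical in
/-- The probability that EXP3 samples an arm that reveals the loss of `i`. -/
def revealProb (P : Setup K) (xhat : Fin K) (s : Exp3State K) (q : ℝ) (i : Fin K) : ℝ :=
  ∑ j with P.G.Adj j i, exp3Prob P xhat s q j

/-- A single dominating arm in D already contributes its share γ/δ of the forced exploration. -/
lemma revealProb_ge (H : IsTuned P c) (xhat : Fin K) {s : Exp3State K} (hs : s.Valid) {q : ℝ}
    (hq : 0 < q) (i : Fin K) : exp3Gamma P s q / weakDomNumber P.G ≤ revealProb P xhat s q i := by
  classical
  obtain ⟨a, ha, hai⟩ := H.dom i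
  have h1 := exp3Gamma_pos H hs hq
  have h2 := exp3Gamma_le H hs hq
  have h3 := softmax_nonneg H.two_le xhat (exp3Eta P (s.receive q)) s.cumLoss a
  have h4 : exp3Gamma P s q / weakDomNumber P.G ≤ exp3Prob P xhat s q a := by
    unfold exp3Prob
    rw [exp3Leader_eq H xhat hs hq, if_pos ha, H.card]
    have := mul_nonneg (show 0 ≤ 1 - exp3Gamma P s q by linarith) h3
    rw [mul_one_div]
    linarith
  refine h4.trans (Finset.single_le_sum (f := exp3Prob P xhat s q)
    (fun j _ => exp3Prob_nonneg H xhat hs hq j) ?_)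
  simp [hai]

open scoped Classical in
/-- The loss estimate of EXP3 when the feedback of the arm `a` is received. -/
def iwEstimate (P : Setup K) (xhat : Fin K) (s : Exp3State K) (q : ℝ) (ℓ : Fin K → ℝ)
    (a i : Fin K) : ℝ :=
  if P.G.Adj a i then ℓ i / (revealProb P xhat s q i * q) else 0

lemma exp3Estimate_of_upd (xhat : Fin K) (s : Exp3State K) (q : ℝ) (ℓ : Fin K → ℝ) (a : Fin K)
    {upd : Prop} (h : upd) (i : Fin K) :
    exp3Estimate P xhat s q a upd (feedback P.G a ℓ) i = iwEstimate P xhat s q ℓ a i := by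
  classical
  unfold exp3Estimate iwEstimate feedback revealProb
  by_cases hai : P.G.Adj a i
  · simp [hai, h]
  · simp [hai]

lemma exp3Estimate_of_not_upd (xhat : Fin K) (s : Exp3State K) (q : ℝ) (obs : Fin K → ℝ)
    (a : Fin K) {upd : Prop} (h : ¬ upd) (i : Fin K) :
    exp3Estimate P xhat s q a upd obs i = 0 := by
  classical
  simp [exp3Estimate, h]

lemma sum_iwEstimate (H : IsTuned P c) (xhat : Fin K) {s : Exp3State K} (hs : s.Valid) {q : ℝ}
    (hq : 0 < q) (ℓ : Fin K → ℝ) (i : Fin K) :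
    ∑ a, exp3Prob P xhat s q a * (q * iwEstimate P xhat s q ℓ a i) = ℓ i := by
  classical
  have h1 := exp3Gamma_pos H hs hq
  have h2 := H.one_le_weakDomNumber
  have hR : 0 < revealProb P xhat s q i := lt_of_lt_of_le (by positivity) (revealProb_ge H xhat hs hq i)
  have : ∀ a, exp3Prob P xhat s q a * (q * iwEstimate P xhat s q ℓ a i)
      = (if P.G.Adj a i then exp3Prob P xhat s q a else 0) * (ℓ i / revealProb P xhat s q i) := by
    intro a
    unfold iwEstimate
    split_ifs
    · field_simp
    · simp
  simp only [this, ← Finset.sum_mul, ← Finset.sum_filter]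
  change revealProb P xhat s q i * _ = _
  field_simp

/-- One factor of the squared inverse probability cancels against the probability of observing the
loss; the remaining one is bounded by forced exploration. -/
lemma sum_iwEstimate_sq (H : IsTuned P c) (xhat : Fin K) {s : Exp3State K} (hs : s.Valid) {q : ℝ}
    (hq : 0 < q) (ℓ : Fin K → ℝ) (hℓ : ∀ i, ℓ i ∈ Set.Icc (-1 : ℝ) 1) (i : Fin K) :
    ∑ a, exp3Prob P xhat s q a * (q * iwEstimate P xhat s q ℓ a i ^ 2)
      ≤ weakDomNumber P.G / (exp3Gamma P s q * q) := by
  classical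
  have h1 := exp3Gamma_pos H hs hq
  have h2 := H.one_le_weakDomNumber
  have hRge := revealProb_ge H xhat hs hq i
  have hR : 0 < revealProb P xhat s q i := lt_of_lt_of_le (by positivity) hRge
  have : ∀ a, exp3Prob P xhat s q a * (q * iwEstimate P xhat s q ℓ a i ^ 2)
      = (if P.G.Adj a i then exp3Prob P xhat s q a else 0)
        * (ℓ i ^ 2 / (revealProb P xhat s q i ^ 2 * q)) := by
    intro a
    unfold iwEstimate
    split_ifs
    · field_simp
    · simp
  simp only [this, ← Finset.sum_mul, ← Finset.sum_filter]
  change revealProb P xhat s q i * _ ≤ _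
  have h3 : revealProb P xhat s q i * (ℓ i ^ 2 / (revealProb P xhat s q i ^ 2 * q))
      = ℓ i ^ 2 / (revealProb P xhat s q i * q) := by field_simp
  rw [h3]
  have h4 : ℓ i ^ 2 ≤ 1 := by nlinarith [(hℓ i).1, (hℓ i).2]
  calc ℓ i ^ 2 / (revealProb P xhat s q i * q)
      ≤ 1 / (exp3Gamma P s q / weakDomNumber P.G * q) := by gcongr
    _ = _ := by field_simp

/-- The estimate is at most δ/(γq), and ηδ/q = γ², so the product is at most γ. This gives the range
condition of `freeEnergy_add_le`. -/
lemma abs_eta_mul_iwEstimate_le (H : IsTuned P c) (xhat : Fin K) {s : Exp3State K} (hs : s.Valid)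
    {q : ℝ} (hq : 0 < q) {ℓ : Fin K → ℝ} (hℓ : ∀ i, ℓ i ∈ Set.Icc (-1 : ℝ) 1) (a i : Fin K) :
    |exp3Eta P (s.receive q) * iwEstimate P xhat s q ℓ a i| ≤ 1 := by
  have h1 := exp3Gamma_pos H hs hq
  have h2 := H.one_le_weakDomNumber
  have hRge := revealProb_ge H xhat hs hq i
  have hR : 0 < revealProb P xhat s q i := lt_of_lt_of_le (by positivity) hRge
  have hη := exp3Eta_pos H (hs.receive hq)
  have hγ := exp3Gamma_le H hs hq
  unfold iwEstimate
  split_ifs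
  · have h3 : |ℓ i| ≤ 1 := abs_le.2 (hℓ i)
    rw [abs_mul, abs_div, abs_of_pos hη, abs_of_pos (show 0 < revealProb P xhat s q i * q by positivity)]
    calc exp3Eta P (s.receive q) * (|ℓ i| / (revealProb P xhat s q i * q))
        ≤ exp3Eta P (s.receive q) * (1 / (exp3Gamma P s q / weakDomNumber P.G * q)) := by gcongr
      _ = (exp3Eta P (s.receive q) * weakDomNumber P.G / q) / exp3Gamma P s q := by field_simp
      _ = exp3Gamma P s q := by
          rw [← exp3Gamma_sq H hs hq, pow_two, mul_div_assoc, div_self h1.ne', mul_one]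
      _ ≤ 1 := by linarith
  · simp

end sampling

/-! ### The regret of EXP3 in one round -/

/-- The potential of EXP3 against the arm `u`. -/
def exp3Potential (P : Setup K) (xhat u : Fin K) (s : Exp3State K) : ℝ :=
  freeEnergy xhat (exp3Eta P s) s.cumLoss + s.cumLoss u
    - 9 / 2 * ((weakDomNumber P.G : ℝ) ^ (1 / 3 : ℝ) * Real.log K ^ (1 / 3 : ℝ))
      * s.sumInvSqrt ^ (2 / 3 : ℝ)

/-- EXP3's regret is at most half the bonus. The (∑ q^{-1/2})^{2/3} part has coefficient 1 from log
K / η and 9/2 from exploration, together below 6 = 12/2; the 1/min q part fits since 4 ≤ 1728/2. -/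
lemma neg_exp3Potential_le {P : Setup K} {c : ℝ} (H : IsTuned P c) {xhat u : Fin K} (hu : u ≠ xhat)
    {s : Exp3State K} (hs : s.Valid) :
    -exp3Potential P xhat u s
      ≤ 1 / 2 * (c ^ (1 / 3 : ℝ) * s.sumInvSqrt ^ (2 / 3 : ℝ) + c / s.minProb) := by
  have hη := exp3Eta_pos H hs
  have h1 := freeEnergy_ge H.two_le hu hη s.cumLoss
  have h2 := exp3Eta_inv H hs
  have h3 := H.log_pos
  have h4 := H.one_le_weakDomNumber
  have h5 := hs.min_pos
  have h6 := hs.sum_nonneg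
  have hL := rpow_third_pow h3.le
  have hL0 : 0 < Real.log K ^ (1 / 3 : ℝ) := by positivity
  have hD0 : 0 < (weakDomNumber P.G : ℝ) ^ (1 / 3 : ℝ) := by positivity
  rw [div_eq_mul_inv, h2] at h1
  rw [H.rpow_c]
  unfold exp3Potential
  set Lr := Real.log K ^ (1 / 3 : ℝ)
  set Dr := (weakDomNumber P.G : ℝ) ^ (1 / 3 : ℝ)
  have h7 : Real.log K * (Dr * s.sumInvSqrt ^ (2 / 3 : ℝ) / Lr ^ 2 + 4 * weakDomNumber P.G / s.minProb)
      = Dr * Lr * s.sumInvSqrt ^ (2 / 3 : ℝ) + 4 * (weakDomNumber P.G * Real.log K) / s.minProb := by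
    rw [mul_add]
    congr 1
    · rw [← hL]; field_simp
    · ring
  rw [h7] at h1
  have h8 : 4 * (weakDomNumber P.G * Real.log K) / s.minProb ≤ 1 / 2 * (c / s.minProb) := by
    rw [← mul_div_assoc]
    apply div_le_div_of_nonneg_right _ h5.le
    rw [H.c_eq]
    have : 0 ≤ (weakDomNumber P.G * Real.log K) := by positivity
    linarith
  have h9 : 0 ≤ Dr * Lr * s.sumInvSqrt ^ (2 / 3 : ℝ) := by positivity
  linarith

/-- `V₁` and `V₀` stand for the potential with and without feedback; feedback arrives with
probability q independently of the sampled arm. The round costs 3γ beyond the change of free energy,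
once for variance and twice for mixing, and the last term of the potential repays it. -/
lemma exp3_regret_step {P : Setup K} {c : ℝ} (H : IsTuned P c) (xhat u : Fin K)
    {s : Exp3State K} (hs : s.Valid) {q : ℝ} (hq : 0 < q) {ℓ : Fin K → ℝ}
    (hℓ : ∀ i, ℓ i ∈ Set.Icc (-1 : ℝ) 1) (V₁ : Fin K → ℝ) (V₀ : ℝ)
    (hV₁ : ∀ a, V₁ a = exp3Potential P xhat u
      { s.receive q with cumLoss := fun i => s.cumLoss i + iwEstimate P xhat s q ℓ a i })
    (hV₀ : V₀ = exp3Potential P xhat u (s.receive q)) :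
    (∑ a, exp3Prob P xhat s q a * ℓ a) - ℓ u
      ≤ exp3Potential P xhat u s
        - ∑ a, exp3Prob P xhat s q a * (q * V₁ a + (1 - q) * V₀) := by
  have hη := exp3Eta_pos H (hs.receive hq)
  have hmono := freeEnergy_mono H.two_le xhat hη (exp3Eta_receive_le H hs hq) s.cumLoss
  have hγ0 := exp3Gamma_pos H hs hq
  have hγ1 := exp3Gamma_le H hs hq
  have hγsub := exp3Gamma_le_sub H hs hq
  have hγsq := exp3Gamma_sq H hs hq
  have hlead := exp3Leader_eq H xhat hs hq
  have hP0 := softmax_nonneg H.two_le xhat (exp3Eta P (s.receive q)) s.cumLoss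
  have hP1 := sum_softmax H.two_le xhat (exp3Eta P (s.receive q)) s.cumLoss
  have hp0 := exp3Prob_nonneg H xhat hs hq
  have hp1 := sum_exp3Prob H xhat hs hq
  have hδ := H.one_le_weakDomNumber
  set γ := exp3Gamma P s q
  set η := exp3Eta P (s.receive q)
  set Pr := softmax xhat η s.cumLoss
  set p := exp3Prob P xhat s q
  set est := iwEstimate P xhat s q ℓ
  set κ := 9 / 2 * ((weakDomNumber P.G : ℝ) ^ (1 / 3 : ℝ) * Real.log K ^ (1 / 3 : ℝ))
  set U' := κ * (s.receive q).sumInvSqrt ^ (2 / 3 : ℝ)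
  have hV₁' : ∀ a, V₁ a ≤ V₀ - ∑ i, Pr i * est a i + η * ∑ i, Pr i * est a i ^ 2 + est a u := by
    intro a
    have h1 := freeEnergy_add_le H.two_le xhat hη s.cumLoss (est a)
      (fun i => abs_eta_mul_iwEstimate_le H xhat hs hq hℓ a i)
    have h2 : V₁ a = freeEnergy xhat η (fun i => s.cumLoss i + est a i) + (s.cumLoss u + est a u)
      - U' := hV₁ a
    have h3 : V₀ = freeEnergy xhat η s.cumLoss + s.cumLoss u - U' := hV₀
    rw [h2, h3]
    linarith
  have hsum : ∑ a, p a * (q * V₁ a + (1 - q) * V₀)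
      ≤ V₀ - ∑ i, Pr i * ℓ i + η * (weakDomNumber P.G / (γ * q)) + ℓ u := by
    have e1 : ∑ a, p a * (q * V₁ a + (1 - q) * V₀) ≤ ∑ a, (p a * V₀
        - ∑ i, Pr i * (p a * (q * est a i)) + η * ∑ i, Pr i * (p a * (q * est a i ^ 2))
        + p a * (q * est a u)) := by
      refine Finset.sum_le_sum fun a _ => ?_
      have h1 := mul_le_mul_of_nonneg_left (mul_le_mul_of_nonneg_left (hV₁' a) hq.le) (hp0 a)
      have h2 : ∑ i, Pr i * (p a * (q * est a i)) = p a * (q * ∑ i, Pr i * est a i) := by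
        rw [Finset.mul_sum, Finset.mul_sum]
        exact Finset.sum_congr rfl fun _ _ => by ring
      have h3 : ∑ i, Pr i * (p a * (q * est a i ^ 2)) = p a * (q * ∑ i, Pr i * est a i ^ 2) := by
        rw [Finset.mul_sum, Finset.mul_sum]
        exact Finset.sum_congr rfl fun _ _ => by ring
      rw [h2, h3]
      linarith
    refine e1.trans ?_
    rw [Finset.sum_add_distrib, Finset.sum_add_distrib, Finset.sum_sub_distrib, ← Finset.sum_mul, hp1,
      ← Finset.mul_sum, Finset.sum_comm, Finset.sum_comm (γ := Fin K) (f := fun a i => Pr i * (p a * (q * est a i ^ 2)))]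
    simp only [← Finset.mul_sum]
    rw [sum_iwEstimate H xhat hs hq ℓ u]
    have e2 : ∑ i, Pr i * ∑ a, p a * (q * est a i) = ∑ i, Pr i * ℓ i :=
      Finset.sum_congr rfl fun i _ => by rw [sum_iwEstimate H xhat hs hq ℓ i]
    have e3 : ∑ i, Pr i * ∑ a, p a * (q * est a i ^ 2)
        ≤ ∑ i, Pr i * (weakDomNumber P.G / (γ * q)) :=
      Finset.sum_le_sum fun i _ =>
        mul_le_mul_of_nonneg_left (sum_iwEstimate_sq H xhat hs hq ℓ hℓ i) (hP0 i)
    rw [← Finset.sum_mul, hP1, one_mul] at e3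
    rw [e2, one_mul]
    have := mul_le_mul_of_nonneg_left e3 hη.le
    linarith
  have hηγ : η * (weakDomNumber P.G / (γ * q)) = γ := by
    have : η * (weakDomNumber P.G / (γ * q)) = (η * weakDomNumber P.G / q) / γ := by field_simp
    rw [this, ← hγsq]; field_simp
  -- Replacing the leader by the uniform law on D with probability γ changes losses in [-1, 1] by at
  -- most 2γ.
  have hplay : ∑ a, p a * ℓ a ≤ ∑ a, Pr a * ℓ a + 2 * γ := by
    rw [sum_exp3Prob_mul, hlead]
    have h1 : (∑ a ∈ P.D, ℓ a) / P.D.card ≤ 1 := by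
      rw [H.card, div_le_one (by linarith), ← H.card]
      calc ∑ a ∈ P.D, ℓ a ≤ ∑ a ∈ P.D, (1 : ℝ) := Finset.sum_le_sum fun a _ => (hℓ a).2
        _ = _ := by simp
    have h2 : -1 ≤ ∑ a, Pr a * ℓ a := by
      calc (-1 : ℝ) = ∑ a, Pr a * (-1) := by rw [← Finset.sum_mul, hP1]; ring
        _ ≤ _ := Finset.sum_le_sum fun a _ => mul_le_mul_of_nonneg_left (hℓ a).1 (hP0 a)
    nlinarith
  have hV₀' : V₀ ≤ exp3Potential P xhat u s - 3 * γ := by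
    have h3 : V₀ = freeEnergy xhat η s.cumLoss + s.cumLoss u - U' := hV₀
    have h4 : exp3Potential P xhat u s = freeEnergy xhat (exp3Eta P s) s.cumLoss + s.cumLoss u
      - κ * s.sumInvSqrt ^ (2 / 3 : ℝ) := rfl
    rw [h3, h4]
    rw [mul_sub] at hγsub
    linarith
  rw [hηγ] at hsum
  linarith

end
end GraphBandit
namespace GraphBandit
noncomputable section
variable {K : ℕ}

/-! ### The leader and the exploration probability of Corral -/

/-- The inverse learning rate of Corral in round `n`. -/
def invRate (P : Setup K) (n : ℕ) : ℝ := (n : ℝ) ^ (2 / 3 : ℝ) + 8 * P.c₁ ^ (1 / 3 : ℝ)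

/-- The difference of the cumulative losses of the two indices of Corral. -/
def corralGap (P : Setup K) (s : CorralState K) : ℝ := s.cumZ 1 - s.cumZ 0 - bonus P s

/-- The weight that the leader of Corral gives to the base algorithm. -/
def corralLead (P : Setup K) (s : CorralState K) : ℝ :=
  lead (invRate P (s.rounds + 1)) P.c₂ (corralGap P s)

/-- Memories of Corral that occur during a run. -/
structure CorralState.Valid (s : CorralState K) : Prop where
  rounds_le : (s.rounds : ℝ) ≤ s.sumInvSqrt
  sum_le : s.sumInvSqrt ≤ s.rounds / s.minProb
  min_pos : 0 < s.minProb
  min_le : s.minProb ≤ 1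
  base_sum : s.base.sumInvSqrt = s.sumInvSqrt
  base_min : s.base.minProb = s.minProb
  eq_start : s.rounds = 0 → s = CorralState.start s.xhat

lemma CorralState.valid_start (xhat : Fin K) : (CorralState.start xhat).Valid := by
  constructor <;> simp [CorralState.start, Exp3State.start]

lemma CorralState.Valid.base {s : CorralState K} (hs : s.Valid) : s.base.Valid :=
  ⟨by rw [hs.base_sum]; exact (Nat.cast_nonneg _).trans hs.rounds_le,
    by rw [hs.base_min]; exact hs.min_pos⟩

section basic

variable {P : Setup K} {c : ℝ}

lemma invRate_ge (H : IsTuned P c) (n : ℕ) : 80 ≤ invRate P n := by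
  have := H.rpow_c_ge
  have h2 : 0 ≤ (n : ℝ) ^ (2 / 3 : ℝ) := by positivity
  unfold invRate
  rw [H.c₁_eq]
  linarith

lemma invRate_le_succ (P : Setup K) (n : ℕ) : invRate P n ≤ invRate P (n + 1) := by
  unfold invRate
  push_cast
  gcongr
  linarith

lemma corralEta_eq (P : Setup K) (s : CorralState K) :
    corralEta P s = 1 / invRate P (s.rounds + 1) := rfl

lemma corralLead_mem (H : IsTuned P c) (s : CorralState K) : corralLead P s ∈ Set.Ioo (0 : ℝ) 1 :=
  (lead_spec (by linarith [invRate_ge H (s.rounds + 1)])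
    (by rw [H.c₂_eq]; linarith [H.c_ge]) _).1

lemma corralLeader_eq (H : IsTuned P c) (s : CorralState K) :
    corralLeader P s = ![1 - corralLead P s, corralLead P s] := by
  have hx := corralLead_mem H s
  have hA : 0 ≤ invRate P (s.rounds + 1) := by linarith [invRate_ge H (s.rounds + 1)]
  have hc : 0 < P.c₂ := by rw [H.c₂_eq]; linarith [H.c_ge]
  -- On the simplex q₀ = 1 - q₁, so the problem is one-dimensional in q₁ up to an additive constant.
  have hval : ∀ q : Fin 2 → ℝ, (∀ i, 0 < q i) → ∑ i, q i = 1 →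
      ∑ i, q i * (s.cumZ i - ![0, bonus P s] i) + corralPotential P s q
        = corralGap P s * q 1 + hybridReg (invRate P (s.rounds + 1)) P.c₂ (q 1)
          + (s.cumZ 0 - 3 * invRate P (s.rounds + 1)) := by
    intro q hq hq1
    rw [Fin.sum_univ_two] at hq1
    have h0 : 1 - q 1 = q 0 := by linarith
    unfold corralPotential hybridReg corralBeta
    rw [corralEta_eq, h0]
    simp only [Fin.sum_univ_two, Matrix.cons_val_zero, Matrix.cons_val_one, one_div, Real.log_inv,
      div_inv_eq_mul, corralGap]
    rw [← h0]
    ring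
  refine argminOn_eq ⟨?_, ?_⟩ ?_
  · intro i
    fin_cases i
    · simpa using hx.2
    · simpa using hx.1
  · simp [Fin.sum_univ_two]
  · rintro q ⟨hq, hq1⟩ hne
    have h01 : q 0 + q 1 = 1 := by rw [← hq1, Fin.sum_univ_two]
    have hq2 : q 1 ∈ Set.Ioo (0 : ℝ) 1 := ⟨hq 1, by linarith [hq 0]⟩
    have hne1 : q 1 ≠ corralLead P s := by
      intro h
      apply hne
      ext i
      fin_cases i
      · simp; linarith
      · simpa using h
    have hmin := lead_isMin hA hc (corralGap P s) hq2
    have hpos := coordDiv_pos hA hc hq2.1 hx.1 hne1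
    rw [hval q hq hq1, hval]
    · simp only [Matrix.cons_val_one, Matrix.cons_val_fin_one]
      change _ + _ + coordDiv _ _ _ (corralLead P s) ≤ _ at hmin
      unfold corralLead at hpos ⊢
      unfold corralLead at hmin
      linarith
    · intro i
      fin_cases i
      · simpa using hx.2
      · simpa using hx.1
    · simp [Fin.sum_univ_two]

lemma corralGamma_eq (H : IsTuned P c) (s : CorralState K) :
    corralGamma P s = exploreProb (corralEta P s) (corralLead P s) := by
  unfold corralGamma exploreProb exploreMap
  rw [corralLeader_eq H]
  rfl

lemma baseProb_eq (H : IsTuned P c) (s : CorralState K) :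
    baseProb P s = (1 - corralGamma P s) * corralLead P s := by
  unfold baseProb
  rw [corralLeader_eq H]
  rfl

lemma corralEta_pos (H : IsTuned P c) (s : CorralState K) : 0 < corralEta P s := by
  rw [corralEta_eq]
  have := invRate_ge H (s.rounds + 1)
  positivity

lemma corralGamma_spec (H : IsTuned P c) (s : CorralState K) :
    0 < corralGamma P s ∧ corralGamma P s < 1 ∧ corralGamma P s
      = max (√(corralEta P s) * baseProb P s ^ (2 / 3 : ℝ))
          (corralEta P s * baseProb P s ^ (1 / 3 : ℝ)) := by
  rw [baseProb_eq H, corralGamma_eq H]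
  exact exploreProb_spec (corralEta_pos H s) (corralLead_mem H s).1

lemma baseProb_pos (H : IsTuned P c) (s : CorralState K) : 0 < baseProb P s := by
  rw [baseProb_eq H]
  exact mul_pos (by linarith [(corralGamma_spec H s).2.1]) (corralLead_mem H s).1

lemma baseProb_le_lead (H : IsTuned P c) (s : CorralState K) : baseProb P s ≤ corralLead P s := by
  rw [baseProb_eq H]
  nlinarith [(corralGamma_spec H s).1, (corralLead_mem H s).1]

lemma baseProb_le_one (H : IsTuned P c) (s : CorralState K) : baseProb P s ≤ 1 :=
  (baseProb_le_lead H s).trans (corralLead_mem H s).2.le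

/-- Since the inverse rate is at least 80 > 64, √η ≤ 1/8. This is what makes leader and update
probability comparable within 8/7. -/
lemma corralGamma_le (H : IsTuned P c) (s : CorralState K) : corralGamma P s ≤ 1 / 8 := by
  have hη := corralEta_pos H s
  have hη2 : corralEta P s ≤ 1 / 80 := by
    rw [corralEta_eq]
    exact one_div_le_one_div_of_le (by norm_num) (invRate_ge H _)
  have hq := baseProb_pos H s
  have h1 := Real.rpow_le_one hq.le (baseProb_le_one H s) (show (0 : ℝ) ≤ 2 / 3 by norm_num)
  have h2 := Real.rpow_le_one hq.le (baseProb_le_one H s) (show (0 : ℝ) ≤ 1 / 3 by norm_num)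
  have h3 : √(corralEta P s) ≤ 1 / 8 := by
    rw [Real.sqrt_le_left (by norm_num)]
    linarith
  rw [(corralGamma_spec H s).2.2]
  apply max_le
  · nlinarith [Real.sqrt_nonneg (corralEta P s)]
  · nlinarith

lemma corralLead_le (H : IsTuned P c) (s : CorralState K) :
    corralLead P s ≤ 8 / 7 * baseProb P s := by
  rw [baseProb_eq H]
  nlinarith [corralGamma_le H s, (corralLead_mem H s).1]

end basic

/-! ### Sums over draws -/

/-- Draws as triples. -/
def drawEquiv (K : ℕ) : Fin K × Bool × Fin 2 ≃ Draw K where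
  toFun x := ⟨x.1, x.2.1, x.2.2⟩
  invFun d := (d.proposal, d.explore, d.index)
  left_inv _ := rfl
  right_inv _ := rfl

instance : Fintype (Draw K) := Fintype.ofEquiv _ (drawEquiv K)

section draws

variable {P : Setup K} {c : ℝ}

lemma sum_drawProb_mul (H : IsTuned P c) (s : CorralState K) (f : Draw K → ℝ) :
    ∑ d, drawProb P s d * f d = ∑ a, exp3Prob P s.xhat s.base (baseProb P s) a *
      (corralGamma P s / 2 * (f ⟨a, true, 0⟩ + f ⟨a, true, 1⟩)
        + (1 - corralGamma P s) * ((1 - corralLead P s) * f ⟨a, false, 0⟩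
          + corralLead P s * f ⟨a, false, 1⟩)) := by
  rw [← (drawEquiv K).sum_comp, Fintype.sum_prod_type]
  refine Finset.sum_congr rfl fun a _ => ?_
  rw [Fintype.sum_prod_type, Fintype.sum_bool, Fin.sum_univ_two, Fin.sum_univ_two]
  simp only [drawEquiv, Equiv.coe_fn_mk, drawProb, corralLeader_eq H, if_true, Bool.false_eq_true,
    if_false, Matrix.cons_val_zero, Matrix.cons_val_one]
  ring

lemma drawProb_nonneg (H : IsTuned P c) {s : CorralState K} (hs : s.Valid) (d : Draw K) :
    0 ≤ drawProb P s d := by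
  have h1 := exp3Prob_nonneg H s.xhat hs.base (baseProb_pos H s) d.proposal
  obtain ⟨h2, h3, -⟩ := corralGamma_spec H s
  have h4 := corralLead_mem H s
  unfold drawProb
  refine mul_nonneg h1 ?_
  split_ifs
  · positivity
  · refine mul_nonneg (by linarith) ?_
    rw [corralLeader_eq H]
    obtain ⟨a, e, i⟩ := d
    fin_cases i
    · simpa using h4.2.le
    · simpa using h4.1.le

lemma sum_drawProb (H : IsTuned P c) {s : CorralState K} (hs : s.Valid) :
    ∑ d, drawProb P s d = 1 := by
  have h := sum_drawProb_mul H s (fun _ => 1)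
  simp only [mul_one] at h
  rw [h, ← Finset.sum_mul, sum_exp3Prob H s.xhat hs.base (baseProb_pos H s)]
  ring

end draws

/-! ### One step of Corral -/

section step

variable {P : Setup K} {c : ℝ}

/-- The next memory of Corral after the draw `d` and the losses `ℓ`. -/
def corralNext (P : Setup K) (s : CorralState K) (ℓ : Fin K → ℝ) (d : Draw K) : CorralState K :=
  corralStep P s d (feedback P.G (action P s d) ℓ)

/-- The bonus of the next round. -/
def nextBonus (P : Setup K) (s : CorralState K) : ℝ :=
  P.c₁ ^ (1 / 3 : ℝ) * (s.sumInvSqrt + 1 / √(baseProb P s)) ^ (2 / 3 : ℝ)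
    + P.c₂ / min s.minProb (baseProb P s)

/-- The difference of the loss estimates of the two indices. -/
def estGap (P : Setup K) (s : CorralState K) (ℓ : Fin K → ℝ) (d : Draw K) : ℝ :=
  if d.explore = true then
    (if d.index = 1 then 2 * ℓ d.proposal / corralGamma P s else -(2 * ℓ s.xhat / corralGamma P s))
  else 0

/-- An exploration round plays the revealing arm of its target, so the masked feedback shows the
true loss there. -/
lemma lossEstimate_eq (H : IsTuned P c) (s : CorralState K) (ℓ : Fin K → ℝ) (d : Draw K) (i : Fin 2) :
    lossEstimate P s d (feedback P.G (action P s d) ℓ) i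
      = if d.explore = true ∧ d.index = i then 2 * ℓ (target s d) / corralGamma P s else 0 := by
  unfold lossEstimate
  split_ifs with h
  · unfold feedback action
    rw [if_pos h.1, if_pos (H.rev _)]
  · rfl

lemma lossEstimate_sub (H : IsTuned P c) (s : CorralState K) (ℓ : Fin K → ℝ) (d : Draw K) :
    lossEstimate P s d (feedback P.G (action P s d) ℓ) 1
      - lossEstimate P s d (feedback P.G (action P s d) ℓ) 0 = estGap P s ℓ d := by
  rw [lossEstimate_eq H, lossEstimate_eq H]
  obtain ⟨a, e, i⟩ := d
  unfold estGap target
  cases e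
  · simp
  · fin_cases i <;> simp

lemma bonus_corralNext (s : CorralState K) (ℓ : Fin K → ℝ) (d : Draw K) :
    bonus P (corralNext P s ℓ d) = nextBonus P s := by
  unfold bonus corralNext corralStep nextBonus
  simp

lemma corralGap_corralNext (H : IsTuned P c) (s : CorralState K) (ℓ : Fin K → ℝ) (d : Draw K) :
    corralGap P (corralNext P s ℓ d)
      = corralGap P s + (estGap P s ℓ d - (nextBonus P s - bonus P s)) := by
  rw [corralGap, bonus_corralNext, ← lossEstimate_sub H]
  simp only [corralNext, corralStep, corralGap]
  ring

lemma CorralState.Valid.next (H : IsTuned P c) {s : CorralState K} (hs : s.Valid) (d : Draw K)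
    (obs : Fin K → ℝ) : (corralStep P s d obs).Valid := by
  have hq := baseProb_pos H s
  have hq1 := baseProb_le_one H s
  have hm := hs.min_pos
  have hsq : √(baseProb P s) ≤ 1 := by
    rw [Real.sqrt_le_left one_pos.le]; simpa using hq1
  have hsq0 : 0 < √(baseProb P s) := by positivity
  refine ⟨?_, ?_, lt_min hm hq, (min_le_left _ _).trans hs.min_le, ?_, ?_, ?_⟩
  · change ((s.rounds + 1 : ℕ) : ℝ) ≤ s.sumInvSqrt + 1 / √(baseProb P s)
    push_cast
    have : 1 ≤ 1 / √(baseProb P s) := by rwa [one_le_div hsq0]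
    linarith [hs.rounds_le]
  · change s.sumInvSqrt + 1 / √(baseProb P s)
      ≤ ((s.rounds + 1 : ℕ) : ℝ) / min s.minProb (baseProb P s)
    have hmin : 0 < min s.minProb (baseProb P s) := lt_min hm hq
    push_cast
    rw [add_div]
    refine add_le_add (hs.sum_le.trans ?_) ?_
    · exact div_le_div_of_nonneg_left (Nat.cast_nonneg _) hmin (min_le_left _ _)
    · refine one_div_le_one_div_of_le hmin ((min_le_right _ _).trans ?_)
      rw [Real.le_sqrt' hq]
      nlinarith
  · simp [corralStep, exp3Step, Exp3State.receive, hs.base_sum]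
  · simp [corralStep, exp3Step, Exp3State.receive, hs.base_min]
  · intro h
    simp [corralStep] at h

/-- The potential of Corral against the arm `u`; `ε` is the weight that the comparator keeps away from
the boundary. -/
def corralRegretPotential (P : Setup K) (u : Fin K) (ε : ℝ) (s : CorralState K) : ℝ :=
  leadVal (invRate P s.rounds) P.c₂ (corralGap P s)
    - (if u = s.xhat then ε else 1 - ε) * (s.cumZ 1 - s.cumZ 0)
    - (if u = s.xhat then 0 else exp3Potential P s.xhat u s.base)

lemma bonus_nonneg (H : IsTuned P c) {s : CorralState K} (hs : s.Valid) : 0 ≤ bonus P s := by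
  have h1 : 0 ≤ s.sumInvSqrt := (Nat.cast_nonneg _).trans hs.rounds_le
  have h2 := hs.min_pos
  have h3 := H.c_ge
  unfold bonus
  rw [H.c₁_eq, H.c₂_eq]
  split_ifs <;> positivity

/-- The leader's value is at most the value at the comparator. There the cumulative losses cancel
and what remains is the regularizer minus the comparator's share of the bonus; for u other than the
candidate this share is at least half, which covers EXP3. -/
lemma corralRegretPotential_le (H : IsTuned P c) (u : Fin K) {ε : ℝ} (hε : 0 < ε) (hε2 : ε ≤ 1 / 2)
    {s : CorralState K} (hs : s.Valid) :
    corralRegretPotential P u ε s ≤ 8 * c * Real.log (1 / (ε * (1 - ε))) := by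
  have hA : 0 ≤ invRate P s.rounds := by linarith [invRate_ge H s.rounds]
  have hc : 0 < P.c₂ := by rw [H.c₂_eq]; linarith [H.c_ge]
  have hB := bonus_nonneg H hs
  unfold corralRegretPotential
  by_cases hu : u = s.xhat
  · rw [if_pos hu, if_pos hu]
    have h1 := leadVal_le hA hc (corralGap P s) (x := ε) ⟨hε, by linarith⟩
    have h2 := hybridReg_le (c := P.c₂) hA (x := ε) ⟨hε, by linarith⟩
    rw [H.c₂_eq] at h1 h2 ⊢
    unfold corralGap at h1 ⊢
    nlinarith
  · rw [if_neg hu, if_neg hu]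
    have h1 := leadVal_le hA hc (corralGap P s) (x := 1 - ε) ⟨by linarith, by linarith⟩
    have h2 := hybridReg_le (c := P.c₂) hA (x := 1 - ε) ⟨by linarith, by linarith⟩
    have h3 : -exp3Potential P s.xhat u s.base ≤ 1 / 2 * bonus P s := by
      -- At the start the bonus is 0 by convention rather than c, so the general bound is useless;
      -- but EXP3's potential then vanishes.
      by_cases h0 : s.rounds = 0
      · rw [hs.eq_start h0]
        have hη : 0 < exp3Eta P (Exp3State.start K) :=
          exp3Eta_pos H ⟨le_refl _, one_pos⟩
        simp only [CorralState.start, exp3Potential, bonus, if_true]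
        have : freeEnergy s.xhat (exp3Eta P (Exp3State.start K)) (Exp3State.start K).cumLoss = 0 :=
          freeEnergy_zero H.two_le _ hη
        rw [this]
        simp [Exp3State.start]
      · have := neg_exp3Potential_le H hu hs.base
        unfold bonus
        rwa [if_neg h0, H.c₁_eq, H.c₂_eq, ← hs.base_sum, ← hs.base_min]
    rw [H.c₂_eq] at h1 h2 ⊢
    rw [sub_sub_cancel, mul_comm (1 - ε) ε] at h2
    unfold corralGap at h1 ⊢
    nlinarith

/-- With zero losses only the Tsallis part can be negative. It is at least -3 times the initial
inverse rate 8c^{1/3}, and the log-barrier is nonnegative. -/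
lemma corralRegretPotential_start (H : IsTuned P c) (u xhat : Fin K) (ε : ℝ) :
    -(24 * c ^ (1 / 3 : ℝ)) ≤ corralRegretPotential P u ε (CorralState.start xhat) := by
  have hA : 0 ≤ invRate P 0 := by linarith [invRate_ge H 0]
  have hc : 0 < P.c₂ := by rw [H.c₂_eq]; linarith [H.c_ge]
  have h1 := leadVal_ge hA hc 0
  have hη : 0 < exp3Eta P (Exp3State.start K) := exp3Eta_pos H ⟨le_refl _, one_pos⟩
  have h2 : exp3Potential P xhat u (Exp3State.start K) = 0 := by
    have : freeEnergy xhat (exp3Eta P (Exp3State.start K)) (Exp3State.start K).cumLoss = 0 :=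
      freeEnergy_zero H.two_le _ hη
    rw [exp3Potential, this]
    simp [Exp3State.start]
  have h3 : corralGap P (CorralState.start xhat) = 0 := by
    simp [corralGap, CorralState.start, bonus]
  have h4 : invRate P 0 = 8 * c ^ (1 / 3 : ℝ) := by
    simp [invRate, H.c₁_eq]
  unfold corralRegretPotential
  rw [h3]
  simp only [CorralState.start, Pi.zero_apply, sub_self, mul_zero, sub_zero, h2, ite_self]
  rw [h4] at h1 ⊢
  simp only [abs_zero, neg_zero, zero_sub] at h1
  linarith

end step
end
end GraphBandit
namespace GraphBandit
noncomputable section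
variable {K : ℕ}
variable {P : Setup K} {c : ℝ}

/-! ### The regret of Corral in one round -/

/-- The part of the regret of a round that the potential does not pay for. -/
def corralCost (P : Setup K) (s : CorralState K) : ℝ :=
  8 * (corralLead P s * (nextBonus P s - bonus P s))
    + 19 * (corralLead P s ^ (2 / 3 : ℝ) / ((s.rounds + 1 : ℕ) : ℝ) ^ (1 / 3 : ℝ))
    + 2 * (corralLead P s ^ (1 / 3 : ℝ) / ((s.rounds + 1 : ℕ) : ℝ) ^ (2 / 3 : ℝ))

lemma CorralState.Valid.eq_zero {s : CorralState K} (hs : s.Valid) (h : s.rounds = 0) :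
    s.sumInvSqrt = 0 ∧ s.minProb = 1 := by
  rw [hs.eq_start h]
  exact ⟨rfl, rfl⟩

/-- The increment of the bonus. -/
lemma nextBonus_sub_le (H : IsTuned P c) {s : CorralState K} (hs : s.Valid) :
    nextBonus P s - bonus P s
      ≤ c ^ (1 / 3 : ℝ) * (1 / √(baseProb P s)
          / (s.sumInvSqrt + 1 / √(baseProb P s)) ^ (1 / 3 : ℝ))
        + (c / min s.minProb (baseProb P s) - c / s.minProb) + (if s.rounds = 0 then c else 0) := by
  have hq := baseProb_pos H s
  have hS : 0 ≤ s.sumInvSqrt := (Nat.cast_nonneg _).trans hs.rounds_le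
  have h1 : 0 < 1 / √(baseProb P s) := by positivity
  have h2 := rpow_two_thirds_sub_le hS (le_add_of_nonneg_right h1.le) (add_pos_of_nonneg_of_pos hS h1)
  rw [add_sub_cancel_left] at h2
  have h3 := mul_le_mul_of_nonneg_left h2 (show 0 ≤ c ^ (1 / 3 : ℝ) by linarith [H.rpow_c_ge])
  unfold nextBonus bonus
  rw [H.c₁_eq, H.c₂_eq]
  split_ifs with h
  -- In the first round the bonus rises from 0, not from the value c/1 that the formula would give;
  -- hence the extra c.
  · obtain ⟨e1, e2⟩ := hs.eq_zero h
    rw [e1] at h3 ⊢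
    rw [e2]
    rw [Real.zero_rpow (by norm_num)] at h3
    linarith
  · linarith

lemma nextBonus_sub_nonneg (H : IsTuned P c) {s : CorralState K} (hs : s.Valid) :
    0 ≤ nextBonus P s - bonus P s := by
  have hq := baseProb_pos H s
  have hS : 0 ≤ s.sumInvSqrt := (Nat.cast_nonneg _).trans hs.rounds_le
  have h1 : 0 < 1 / √(baseProb P s) := by positivity
  have hc := H.c_ge
  have hm : 0 < min s.minProb (baseProb P s) := lt_min hs.min_pos hq
  unfold nextBonus bonus
  rw [H.c₁_eq, H.c₂_eq]
  have hc0 : 0 < c := by linarith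
  split_ifs with h
  · rw [sub_zero]; positivity
  · have e1 : c / s.minProb ≤ c / min s.minProb (baseProb P s) :=
      div_le_div_of_nonneg_left (by linarith) hm (min_le_left _ _)
    have e2 : c ^ (1 / 3 : ℝ) * s.sumInvSqrt ^ (2 / 3 : ℝ)
        ≤ c ^ (1 / 3 : ℝ) * (s.sumInvSqrt + 1 / √(baseProb P s)) ^ (2 / 3 : ℝ) := by
      gcongr
      linarith
    linarith

/-- This is the bonus hypothesis of `leadVal_step`. The 1/min q part rises by at most c/q, and x ≤
8q/7. The other part rises by at most c^{1/3} q^{-1/3}, which the summand 8c^{1/3} of the inverse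
learning rate dominates. -/
lemma corralLead_mul_bonus_le (H : IsTuned P c) {s : CorralState K} (hs : s.Valid) :
    corralLead P s * (nextBonus P s - bonus P s)
      ≤ 8 / 7 * c + 1 / 7 * (invRate P (s.rounds + 1) * corralLead P s ^ (2 / 3 : ℝ)) := by
  have hq := baseProb_pos H s
  have hq1 := baseProb_le_one H s
  have hqx := baseProb_le_lead H s
  have hxq := corralLead_le H s
  have hx := corralLead_mem H s
  have hS : 0 ≤ s.sumInvSqrt := (Nat.cast_nonneg _).trans hs.rounds_le
  have hc := H.c_ge
  have hm : 0 < min s.minProb (baseProb P s) := lt_min hs.min_pos hq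
  have hb := nextBonus_sub_le H hs
  set q := baseProb P s
  set x := corralLead P s
  have hsq0 : 0 < √q := by positivity
  have h1 : c / min s.minProb q - c / s.minProb + (if s.rounds = 0 then c else 0) ≤ c / q := by
    have hpos : 0 < c / s.minProb := by have := hs.min_pos; positivity
    split_ifs with h
    · rw [(hs.eq_zero h).2, min_eq_right hq1]; linarith
    · rcases le_total s.minProb q with h | h
      · rw [min_eq_left h]
        have : 0 ≤ c / q := by positivity
        linarith
      · rw [min_eq_right h]; linarith
  have hQ := rpow_third_pow hq.le
  have hX := rpow_third_pow hx.1.le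
  have hQ0 : 0 < q ^ (1 / 3 : ℝ) := by positivity
  have h2 : 1 / √q / (s.sumInvSqrt + 1 / √q) ^ (1 / 3 : ℝ) ≤ 1 / q ^ (1 / 3 : ℝ) := by
    have h3 : 1 / √q / (s.sumInvSqrt + 1 / √q) ^ (1 / 3 : ℝ)
        ≤ 1 / √q / (1 / √q) ^ (1 / 3 : ℝ) := by
      gcongr
      linarith
    refine h3.trans (le_of_eq ?_)
    have e : 1 / √q = q ^ (-(1 / 2) : ℝ) := by
      rw [Real.sqrt_eq_rpow, one_div, ← Real.rpow_neg hq.le]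
    rw [e, ← Real.rpow_mul hq.le, ← Real.rpow_sub hq, one_div (q ^ (1 / 3 : ℝ)),
      ← Real.rpow_neg hq.le]
    norm_num
  have h4 : x * (c ^ (1 / 3 : ℝ) * (1 / √q / (s.sumInvSqrt + 1 / √q) ^ (1 / 3 : ℝ)))
      ≤ 1 / 7 * (invRate P (s.rounds + 1) * x ^ (2 / 3 : ℝ)) := by
    have hA : 8 * c ^ (1 / 3 : ℝ) ≤ invRate P (s.rounds + 1) := by
      unfold invRate
      rw [H.c₁_eq]
      have : 0 ≤ ((s.rounds + 1 : ℕ) : ℝ) ^ (2 / 3 : ℝ) := by positivity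
      linarith
    have h5 : x * (1 / q ^ (1 / 3 : ℝ)) ≤ 8 / 7 * x ^ (2 / 3 : ℝ) := by
      rw [mul_one_div, div_le_iff₀ hQ0]
      have h6 : q ^ (2 / 3 : ℝ) ≤ x ^ (2 / 3 : ℝ) := by gcongr
      rw [rpow_two_thirds_eq hq.le] at h6
      nlinarith
    have hc3 : 0 ≤ c ^ (1 / 3 : ℝ) := by positivity
    have hx3 : 0 ≤ x ^ (2 / 3 : ℝ) := by have := hx.1; positivity
    calc x * (c ^ (1 / 3 : ℝ) * (1 / √q / (s.sumInvSqrt + 1 / √q) ^ (1 / 3 : ℝ)))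
        ≤ x * (c ^ (1 / 3 : ℝ) * (1 / q ^ (1 / 3 : ℝ))) := by
          have := hx.1
          gcongr
      _ = c ^ (1 / 3 : ℝ) * (x * (1 / q ^ (1 / 3 : ℝ))) := by ring
      _ ≤ c ^ (1 / 3 : ℝ) * (8 / 7 * x ^ (2 / 3 : ℝ)) := by gcongr
      _ = 1 / 7 * (8 * c ^ (1 / 3 : ℝ) * x ^ (2 / 3 : ℝ)) := by ring
      _ ≤ _ := by gcongr
  have h7 : x * (c / q) ≤ 8 / 7 * c := by
    rw [← mul_div_assoc, div_le_iff₀ hq]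
    nlinarith
  have h8 := mul_le_mul_of_nonneg_left hb hx.1.le
  have h9 := mul_le_mul_of_nonneg_left h1 hx.1.le
  rw [mul_add, mul_add] at h8
  rw [mul_add] at h9
  linarith

/-- The exploration probability compared with the leader. -/
lemma corralLead_rpow_le (H : IsTuned P c) (s : CorralState K) :
    corralLead P s ^ (2 / 3 : ℝ)
      ≤ 64 / 49 * (√(invRate P (s.rounds + 1)) * corralGamma P s) := by
  have hA : 0 < invRate P (s.rounds + 1) := by linarith [invRate_ge H (s.rounds + 1)]
  have hq := baseProb_pos H s
  have hx := corralLead_mem H s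
  have hγ : √(corralEta P s) * baseProb P s ^ (2 / 3 : ℝ) ≤ corralGamma P s :=
    (le_max_left _ _).trans (corralGamma_spec H s).2.2.ge
  have h1 : (baseProb P s) ^ (2 / 3 : ℝ) ≤ √(invRate P (s.rounds + 1)) * corralGamma P s := by
    have h2 := mul_le_mul_of_nonneg_left hγ (Real.sqrt_nonneg (invRate P (s.rounds + 1)))
    rw [← mul_assoc, ← Real.sqrt_mul hA.le, corralEta_eq, mul_one_div_cancel hA.ne', Real.sqrt_one,
      one_mul] at h2
    exact h2
  have h3 : corralLead P s ^ (2 / 3 : ℝ) ≤ 64 / 49 * baseProb P s ^ (2 / 3 : ℝ) := by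
    have h4 : corralLead P s ^ (1 / 3 : ℝ) ≤ 8 / 7 * baseProb P s ^ (1 / 3 : ℝ) := by
      have h5 := Real.rpow_le_rpow hx.1.le (corralLead_le H s) (show (0 : ℝ) ≤ 1 / 3 by norm_num)
      rw [Real.mul_rpow (by norm_num) hq.le] at h5
      have h6 : (8 / 7 : ℝ) ^ (1 / 3 : ℝ) ≤ 8 / 7 := by
        have := Real.rpow_le_rpow_of_exponent_le (show (1 : ℝ) ≤ 8 / 7 by norm_num)
          (show (1 / 3 : ℝ) ≤ 1 by norm_num)
        rwa [Real.rpow_one] at this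
      exact h5.trans (by gcongr)
    rw [rpow_two_thirds_eq hx.1.le, rpow_two_thirds_eq hq.le]
    have h7 : 0 ≤ corralLead P s ^ (1 / 3 : ℝ) := by have := hx.1; positivity
    nlinarith
  linarith

lemma rounds_rpow_le_invRate (H : IsTuned P c) (n : ℕ) :
    ((n : ℝ) ^ (1 / 3 : ℝ)) ≤ √(invRate P n) := by
  apply Real.le_sqrt_of_sq_le
  rw [← rpow_two_thirds_eq (Nat.cast_nonneg n)]
  unfold invRate
  rw [H.c₁_eq]
  linarith [H.rpow_c_ge]

lemma corralGamma_le_lead (H : IsTuned P c) (s : CorralState K) :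
    corralGamma P s ≤ corralLead P s ^ (2 / 3 : ℝ) / ((s.rounds + 1 : ℕ) : ℝ) ^ (1 / 3 : ℝ)
      + corralLead P s ^ (1 / 3 : ℝ) / ((s.rounds + 1 : ℕ) : ℝ) ^ (2 / 3 : ℝ) := by
  have hq := baseProb_pos H s
  have hqx := baseProb_le_lead H s
  have hA : 0 < invRate P (s.rounds + 1) := by linarith [invRate_ge H (s.rounds + 1)]
  have hx := (corralLead_mem H s).1
  have hn : (0 : ℝ) < ((s.rounds + 1 : ℕ) : ℝ) := by positivity
  have h1 := rounds_rpow_le_invRate H (s.rounds + 1)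
  have h2 : ((s.rounds + 1 : ℕ) : ℝ) ^ (2 / 3 : ℝ) ≤ invRate P (s.rounds + 1) := by
    unfold invRate
    rw [H.c₁_eq]
    linarith [H.rpow_c_ge]
  rw [(corralGamma_spec H s).2.2, corralEta_eq, Real.sqrt_div zero_le_one, Real.sqrt_one]
  refine max_le ?_ ?_
  · have h3 : 1 / √(invRate P (s.rounds + 1)) * baseProb P s ^ (2 / 3 : ℝ)
        ≤ 1 / ((s.rounds + 1 : ℕ) : ℝ) ^ (1 / 3 : ℝ) * corralLead P s ^ (2 / 3 : ℝ) := by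
      gcongr
    rw [one_div_mul_eq_div _ (corralLead P s ^ (2 / 3 : ℝ))] at h3
    exact h3.trans (le_add_of_nonneg_right (by positivity))
  · have h3 : 1 / invRate P (s.rounds + 1) * baseProb P s ^ (1 / 3 : ℝ)
        ≤ 1 / ((s.rounds + 1 : ℕ) : ℝ) ^ (2 / 3 : ℝ) * corralLead P s ^ (1 / 3 : ℝ) := by
      gcongr
    rw [one_div_mul_eq_div _ (corralLead P s ^ (1 / 3 : ℝ))] at h3
    exact h3.trans (le_add_of_nonneg_left (by positivity))

lemma abs_estGap_le (H : IsTuned P c) (s : CorralState K) {ℓ : Fin K → ℝ}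
    (hℓ : ∀ i, ℓ i ∈ Set.Icc (-1 : ℝ) 1) (d : Draw K) :
    |estGap P s ℓ d| ≤ 2 / corralGamma P s := by
  have hγ := (corralGamma_spec H s).1
  have h : ∀ i, |2 * ℓ i / corralGamma P s| ≤ 2 / corralGamma P s := fun i => by
    rw [abs_div, abs_of_pos hγ, abs_mul, abs_two]
    have := abs_le.2 (hℓ i)
    gcongr
    linarith
  unfold estGap
  split_ifs
  · exact h _
  · rw [abs_neg]; exact h _
  · rw [abs_zero]; positivity

/-- Pathwise progress of the follow-the-regularized-leader value. -/
lemma leadVal_corralNext_ge (H : IsTuned P c) {s : CorralState K} (hs : s.Valid) {ℓ : Fin K → ℝ}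
    (hℓ : ∀ i, ℓ i ∈ Set.Icc (-1 : ℝ) 1) (d : Draw K) :
    leadVal (invRate P s.rounds) P.c₂ (corralGap P s)
        - 3 * (corralLead P s ^ (2 / 3 : ℝ) / ((s.rounds + 1 : ℕ) : ℝ) ^ (1 / 3 : ℝ))
        - 8 * (corralLead P s * (nextBonus P s - bonus P s))
        + corralLead P s * estGap P s ℓ d
        - 5 / 2 * (corralLead P s ^ (4 / 3 : ℝ) / invRate P (s.rounds + 1)) * estGap P s ℓ d ^ 2
      ≤ leadVal (invRate P (corralNext P s ℓ d).rounds) P.c₂ (corralGap P (corralNext P s ℓ d)) := by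
  have hA0 : 0 < invRate P s.rounds := by linarith [invRate_ge H s.rounds]
  have hA : 0 < invRate P (s.rounds + 1) := by linarith [invRate_ge H (s.rounds + 1)]
  have hc : 0 < P.c₂ := by rw [H.c₂_eq]; linarith [H.c_ge]
  have hx := corralLead_mem H s
  have h1 := leadVal_rate hA0.le (invRate_le_succ P s.rounds) hc (corralGap P s)
  have hγ := (corralGamma_spec H s).1
  have hw : (corralLead P s * estGap P s ℓ d) ^ 2
      -- Estimates are at most 2/γ and x^{2/3} ≤ (64/49) √A γ, so the square is at most 4 (64/49)² A
      -- x^{2/3}, and 4 (64/49)² < 9.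
      ≤ 9 * (invRate P (s.rounds + 1) * corralLead P s ^ (2 / 3 : ℝ)) := by
    have h2 := abs_estGap_le H s hℓ d
    have h3 : estGap P s ℓ d ^ 2 ≤ (2 / corralGamma P s) ^ 2 := by
      rw [← sq_abs]; exact pow_le_pow_left₀ (abs_nonneg _) h2 2
    have h4 := corralLead_rpow_le H s
    have h5 : corralLead P s ^ 2 = corralLead P s ^ (2 / 3 : ℝ)
        * (corralLead P s ^ (2 / 3 : ℝ)) ^ 2 := by
      rw [← Real.rpow_natCast, ← Real.rpow_natCast, ← Real.rpow_mul hx.1.le, ← Real.rpow_add hx.1]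
      norm_num
    have h6 : (corralLead P s ^ (2 / 3 : ℝ)) ^ 2
        ≤ (64 / 49 * (√(invRate P (s.rounds + 1)) * corralGamma P s)) ^ 2 :=
      pow_le_pow_left₀ (by have := hx.1; positivity) h4 2
    have h7 : (64 / 49 * (√(invRate P (s.rounds + 1)) * corralGamma P s)) ^ 2
        = (64 / 49) ^ 2 * (invRate P (s.rounds + 1) * corralGamma P s ^ 2) := by
      rw [mul_pow, mul_pow, Real.sq_sqrt hA.le]
    have hx3 : 0 ≤ corralLead P s ^ (2 / 3 : ℝ) := by have := hx.1; positivity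
    calc (corralLead P s * estGap P s ℓ d) ^ 2
        = corralLead P s ^ (2 / 3 : ℝ) * (corralLead P s ^ (2 / 3 : ℝ)) ^ 2 * estGap P s ℓ d ^ 2 := by
          rw [mul_pow, h5]
      _ ≤ corralLead P s ^ (2 / 3 : ℝ) * ((64 / 49) ^ 2 * (invRate P (s.rounds + 1)
            * corralGamma P s ^ 2)) * (2 / corralGamma P s) ^ 2 := by
          rw [← h7]
          gcongr
      _ = 4 * (64 / 49) ^ 2 * (invRate P (s.rounds + 1) * corralLead P s ^ (2 / 3 : ℝ)) := by
          field_simp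
          ring
      _ ≤ _ := by
          gcongr
          norm_num
  have h8 := leadVal_step hA (by rw [H.c₂_eq]; exact H.c_ge) (corralGap P s) (estGap P s ℓ d)
    (nextBonus P s - bonus P s) (nextBonus_sub_nonneg H hs)
    (by have := corralLead_mul_bonus_le H hs; rw [H.c₂_eq]; rw [corralLead, H.c₂_eq] at this; exact this)
    hw
  change _ ≤ leadVal (invRate P (s.rounds + 1)) P.c₂ _
  rw [corralGap_corralNext H]
  have hxd : lead (invRate P (s.rounds + 1)) P.c₂ (corralGap P s) = corralLead P s := rfl
  rw [hxd] at h1 h8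
  have h9 : 3 * (invRate P (s.rounds + 1) - invRate P s.rounds) * corralLead P s ^ (2 / 3 : ℝ)
      ≤ 3 * (corralLead P s ^ (2 / 3 : ℝ) / ((s.rounds + 1 : ℕ) : ℝ) ^ (1 / 3 : ℝ)) := by
    have h10 := rpow_two_thirds_sub_le (S := (s.rounds : ℝ)) (S' := ((s.rounds + 1 : ℕ) : ℝ))
      (Nat.cast_nonneg _) (by push_cast; linarith) (by positivity)
    have h11 : ((s.rounds + 1 : ℕ) : ℝ) - s.rounds = 1 := by push_cast; ring
    rw [h11] at h10
    have h12 : invRate P (s.rounds + 1) - invRate P s.rounds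
        = ((s.rounds + 1 : ℕ) : ℝ) ^ (2 / 3 : ℝ) - (s.rounds : ℝ) ^ (2 / 3 : ℝ) := by
      unfold invRate; ring
    rw [h12]
    have hx3 : 0 ≤ corralLead P s ^ (2 / 3 : ℝ) := by have := hx.1; positivity
    have := mul_le_mul_of_nonneg_right h10 hx3
    rw [one_div_mul_eq_div] at this
    linarith
  have e : 5 / 2 * corralLead P s ^ (4 / 3 : ℝ) * estGap P s ℓ d ^ 2 / invRate P (s.rounds + 1)
      = 5 / 2 * (corralLead P s ^ (4 / 3 : ℝ) / invRate P (s.rounds + 1)) * estGap P s ℓ d ^ 2 := by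
    ring
  rw [e] at h8
  linarith

end
end GraphBandit
namespace GraphBandit
noncomputable section
variable {K : ℕ}
variable {P : Setup K} {c : ℝ}

/-- The expected loss of the proposal of the base algorithm. -/
def proposalLoss (P : Setup K) (s : CorralState K) (ℓ : Fin K → ℝ) : ℝ :=
  ∑ a, exp3Prob P s.xhat s.base (baseProb P s) a * ℓ a

/-! ### Expectations over the draw of one round -/

section expectations

lemma proposalLoss_mem (H : IsTuned P c) {s : CorralState K} (hs : s.Valid) {ℓ : Fin K → ℝ}
    (hℓ : ∀ i, ℓ i ∈ Set.Icc (-1 : ℝ) 1) : proposalLoss P s ℓ ∈ Set.Icc (-1 : ℝ) 1 := by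
  have hp0 := exp3Prob_nonneg H s.xhat hs.base (baseProb_pos H s)
  have hp1 := sum_exp3Prob H s.xhat hs.base (baseProb_pos H s)
  unfold proposalLoss
  constructor
  · calc (-1 : ℝ) = ∑ a, exp3Prob P s.xhat s.base (baseProb P s) a * (-1) := by
          rw [← Finset.sum_mul, hp1]; ring
      _ ≤ _ := Finset.sum_le_sum fun a _ => mul_le_mul_of_nonneg_left (hℓ a).1 (hp0 a)
  · calc _ ≤ ∑ a, exp3Prob P s.xhat s.base (baseProb P s) a * 1 :=
          Finset.sum_le_sum fun a _ => mul_le_mul_of_nonneg_left (hℓ a).2 (hp0 a)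
      _ = 1 := by rw [← Finset.sum_mul, hp1]; ring

lemma sum_prob_affine (H : IsTuned P c) {s : CorralState K} (hs : s.Valid) (ℓ : Fin K → ℝ) (α β : ℝ) :
    ∑ a, exp3Prob P s.xhat s.base (baseProb P s) a * (α + β * ℓ a) = α + β * proposalLoss P s ℓ := by
  have hp1 := sum_exp3Prob H s.xhat hs.base (baseProb_pos H s)
  simp only [mul_add, Finset.sum_add_distrib, ← Finset.sum_mul, hp1]
  unfold proposalLoss
  rw [Finset.mul_sum, one_mul]
  congr 1
  exact Finset.sum_congr rfl fun _ _ => by ring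

/-- Without exploration the mean loss is the mixture given by the leader; exploration has
probability γ and changes a loss by at most 2. -/
lemma sum_drawProb_action_le (H : IsTuned P c) {s : CorralState K} (hs : s.Valid) {ℓ : Fin K → ℝ}
    (hℓ : ∀ i, ℓ i ∈ Set.Icc (-1 : ℝ) 1) :
    ∑ d, drawProb P s d * ℓ (action P s d)
      ≤ ℓ s.xhat + corralLead P s * (proposalLoss P s ℓ - ℓ s.xhat) + 2 * corralGamma P s := by
  have hp0 := exp3Prob_nonneg H s.xhat hs.base (baseProb_pos H s)
  obtain ⟨hγ, hγ1, -⟩ := corralGamma_spec H s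
  have hx := corralLead_mem H s
  have hg := proposalLoss_mem H hs hℓ
  rw [sum_drawProb_mul H]
  have h1 : ∀ a, exp3Prob P s.xhat s.base (baseProb P s) a *
      (corralGamma P s / 2 * (ℓ (action P s ⟨a, true, 0⟩) + ℓ (action P s ⟨a, true, 1⟩))
        + (1 - corralGamma P s) * ((1 - corralLead P s) * ℓ (action P s ⟨a, false, 0⟩)
          + corralLead P s * ℓ (action P s ⟨a, false, 1⟩)))
      ≤ exp3Prob P s.xhat s.base (baseProb P s) a * ((corralGamma P s
          + (1 - corralGamma P s) * (1 - corralLead P s) * ℓ s.xhat)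
        + (1 - corralGamma P s) * corralLead P s * ℓ a) := by
    intro a
    refine mul_le_mul_of_nonneg_left ?_ (hp0 a)
    have e1 : ℓ (action P s ⟨a, false, 0⟩) = ℓ s.xhat := by simp [action, target]
    have e2 : ℓ (action P s ⟨a, false, 1⟩) = ℓ a := by simp [action, target]
    rw [e1, e2]
    have e3 := (hℓ (action P s ⟨a, true, 0⟩)).2
    have e4 := (hℓ (action P s ⟨a, true, 1⟩)).2
    nlinarith
  refine (Finset.sum_le_sum fun a _ => h1 a).trans ?_
  rw [sum_prob_affine H hs]
  have h2 : -1 ≤ ℓ s.xhat + corralLead P s * (proposalLoss P s ℓ - ℓ s.xhat) := by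
    have := (hℓ s.xhat).1
    nlinarith [hg.1, hx.1, hx.2]
  nlinarith

lemma sum_drawProb_estGap (H : IsTuned P c) {s : CorralState K} (hs : s.Valid) (ℓ : Fin K → ℝ) :
    ∑ d, drawProb P s d * estGap P s ℓ d = proposalLoss P s ℓ - ℓ s.xhat := by
  obtain ⟨hγ, -, -⟩ := corralGamma_spec H s
  rw [sum_drawProb_mul H]
  have h1 : ∀ a, corralGamma P s / 2 * (estGap P s ℓ ⟨a, true, 0⟩ + estGap P s ℓ ⟨a, true, 1⟩)
        + (1 - corralGamma P s) * ((1 - corralLead P s) * estGap P s ℓ ⟨a, false, 0⟩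
          + corralLead P s * estGap P s ℓ ⟨a, false, 1⟩) = -ℓ s.xhat + 1 * ℓ a := by
    intro a
    simp [estGap]
    field_simp
  simp only [h1]
  rw [sum_prob_affine H hs]
  ring

lemma sum_drawProb_estGap_sq (H : IsTuned P c) {s : CorralState K} (hs : s.Valid) {ℓ : Fin K → ℝ}
    (hℓ : ∀ i, ℓ i ∈ Set.Icc (-1 : ℝ) 1) :
    ∑ d, drawProb P s d * estGap P s ℓ d ^ 2 ≤ 4 / corralGamma P s := by
  have hp0 := exp3Prob_nonneg H s.xhat hs.base (baseProb_pos H s)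
  have hp1 := sum_exp3Prob H s.xhat hs.base (baseProb_pos H s)
  obtain ⟨hγ, -, -⟩ := corralGamma_spec H s
  rw [sum_drawProb_mul H]
  have h1 : ∀ a, corralGamma P s / 2 * (estGap P s ℓ ⟨a, true, 0⟩ ^ 2 + estGap P s ℓ ⟨a, true, 1⟩ ^ 2)
        + (1 - corralGamma P s) * ((1 - corralLead P s) * estGap P s ℓ ⟨a, false, 0⟩ ^ 2
          + corralLead P s * estGap P s ℓ ⟨a, false, 1⟩ ^ 2) ≤ 4 / corralGamma P s := by
    intro a
    have e : corralGamma P s / 2 * (estGap P s ℓ ⟨a, true, 0⟩ ^ 2 + estGap P s ℓ ⟨a, true, 1⟩ ^ 2)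
        + (1 - corralGamma P s) * ((1 - corralLead P s) * estGap P s ℓ ⟨a, false, 0⟩ ^ 2
          + corralLead P s * estGap P s ℓ ⟨a, false, 1⟩ ^ 2)
        = 2 * (ℓ s.xhat ^ 2 + ℓ a ^ 2) / corralGamma P s := by
      simp [estGap]
      field_simp
    rw [e]
    have e1 : ℓ s.xhat ^ 2 ≤ 1 := by nlinarith [(hℓ s.xhat).1, (hℓ s.xhat).2]
    have e2 : ℓ a ^ 2 ≤ 1 := by nlinarith [(hℓ a).1, (hℓ a).2]
    gcongr
    linarith
  calc _ ≤ ∑ a, exp3Prob P s.xhat s.base (baseProb P s) a * (4 / corralGamma P s) :=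
        Finset.sum_le_sum fun a _ => mul_le_mul_of_nonneg_left (h1 a) (hp0 a)
    _ = _ := by rw [← Finset.sum_mul, hp1, one_mul]

/-- The base receives feedback exactly when the round does not explore and follows index 1. This has
probability (1 - γ)x = q, independently of the proposal, as `exp3_regret_step` requires. -/
lemma sum_drawProb_exp3Potential (H : IsTuned P c) {s : CorralState K} (hs : s.Valid) {ℓ : Fin K → ℝ}
    (hℓ : ∀ i, ℓ i ∈ Set.Icc (-1 : ℝ) 1) (u : Fin K) :
    proposalLoss P s ℓ - ℓ u ≤ exp3Potential P s.xhat u s.base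
      - ∑ d, drawProb P s d * exp3Potential P s.xhat u (corralNext P s ℓ d).base := by
  have hq := baseProb_pos H s
  set V₁ : Fin K → ℝ := fun a => exp3Potential P s.xhat u
    { s.base.receive (baseProb P s) with
      cumLoss := fun i => s.base.cumLoss i + iwEstimate P s.xhat s.base (baseProb P s) ℓ a i }
  set V₀ := exp3Potential P s.xhat u (s.base.receive (baseProb P s)) with hV₀
  have h1 := exp3_regret_step H s.xhat u hs.base hq hℓ V₁ V₀ (fun _ => rfl) rfl
  have hno : ∀ d : Draw K, ¬ (d.explore = false ∧ d.index = 1) →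
      exp3Potential P s.xhat u (corralNext P s ℓ d).base = V₀ := by
    intro d hd
    rw [hV₀]
    congr 1
    simp only [corralNext, corralStep, exp3Step, exp3Estimate_of_not_upd _ _ _ _ _ hd, add_zero]
    rfl
  have hyes : ∀ a, exp3Potential P s.xhat u (corralNext P s ℓ ⟨a, false, 1⟩).base = V₁ a := by
    intro a
    have hact : action P s ⟨a, false, 1⟩ = a := by simp [action, target]
    change exp3Potential P s.xhat u _ = exp3Potential P s.xhat u _
    congr 1
    simp only [corralNext, corralStep, exp3Step, hact]
    congr 1
    ext i
    rw [exp3Estimate_of_upd _ _ _ _ _ (by simp)]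
  rw [sum_drawProb_mul H]
  refine h1.trans (le_of_eq ?_)
  congr 1
  refine Finset.sum_congr rfl fun a _ => ?_
  rw [hyes, hno ⟨a, true, 0⟩ (by simp), hno ⟨a, true, 1⟩ (by simp), hno ⟨a, false, 0⟩ (by simp),
    baseProb_eq H]
  ring

/-- The regret of one round is bounded by the expected growth of the potential and the cost. -/
lemma corral_regret_step (H : IsTuned P c) {s : CorralState K} (hs : s.Valid) {ℓ : Fin K → ℝ}
    (hℓ : ∀ i, ℓ i ∈ Set.Icc (-1 : ℝ) 1) (u : Fin K) {ε : ℝ} (hε : 0 < ε) :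
    ∑ d, drawProb P s d * (ℓ (action P s d) - ℓ u)
      ≤ ∑ d, drawProb P s d * corralRegretPotential P u ε (corralNext P s ℓ d)
        - corralRegretPotential P u ε s + corralCost P s + 2 * ε := by
  have hd0 := drawProb_nonneg H hs
  have hd1 := sum_drawProb H hs
  have hact := sum_drawProb_action_le H hs hℓ
  have hw := sum_drawProb_estGap H hs ℓ
  have hw2 := sum_drawProb_estGap_sq H hs hℓ
  have hV := sum_drawProb_exp3Potential H hs hℓ u
  have hγ := (corralGamma_spec H s).1
  have hγle := corralGamma_le_lead H s
  have hx := corralLead_mem H s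
  have hA : 0 < invRate P (s.rounds + 1) := by linarith [invRate_ge H (s.rounds + 1)]
  have hpl := proposalLoss_mem H hs hℓ
  have hlx := hℓ s.xhat
  set θ : ℝ := if u = s.xhat then ε else 1 - ε with hθ
  set E' : ℝ := ∑ d, drawProb P s d * (if u = s.xhat then 0
    else exp3Potential P s.xhat u (corralNext P s ℓ d).base) with hS'
  set L := leadVal (invRate P s.rounds) P.c₂ (corralGap P s) with hL
  set k := 5 / 2 * (corralLead P s ^ (4 / 3 : ℝ) / invRate P (s.rounds + 1)) with hk
  set C₀ := L - 3 * (corralLead P s ^ (2 / 3 : ℝ) / ((s.rounds + 1 : ℕ) : ℝ) ^ (1 / 3 : ℝ))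
        - 8 * (corralLead P s * (nextBonus P s - bonus P s)) with hC₀
  have hk0 : 0 ≤ k := by have := hx.1; positivity
  -- The second moment of the estimated difference is at most 4/γ. The exploration rate is large
  -- enough to cancel one factor x^{2/3} and one √A; the constant is 640/49 ≤ 14.
  have hstab : k * (4 / corralGamma P s)
      ≤ 14 * (corralLead P s ^ (2 / 3 : ℝ) / ((s.rounds + 1 : ℕ) : ℝ) ^ (1 / 3 : ℝ)) := by
    have h1 := corralLead_rpow_le H s
    have h2 := rounds_rpow_le_invRate H (s.rounds + 1)
    have h3 : corralLead P s ^ (4 / 3 : ℝ) = corralLead P s ^ (2 / 3 : ℝ)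
        * corralLead P s ^ (2 / 3 : ℝ) := by
      rw [← Real.rpow_add hx.1]; norm_num
    have hx3 : 0 ≤ corralLead P s ^ (2 / 3 : ℝ) := by have := hx.1; positivity
    have hn : (0 : ℝ) < ((s.rounds + 1 : ℕ) : ℝ) := by positivity
    have hsA : 0 < √(invRate P (s.rounds + 1)) := by positivity
    calc k * (4 / corralGamma P s)
        = 10 * (corralLead P s ^ (2 / 3 : ℝ) * corralLead P s ^ (2 / 3 : ℝ)
            / (invRate P (s.rounds + 1) * corralGamma P s)) := by rw [hk, h3]; ring
      _ ≤ 10 * (corralLead P s ^ (2 / 3 : ℝ) * (64 / 49 * (√(invRate P (s.rounds + 1))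
            * corralGamma P s)) / (invRate P (s.rounds + 1) * corralGamma P s)) := by gcongr
      _ = 640 / 49 * (corralLead P s ^ (2 / 3 : ℝ) / √(invRate P (s.rounds + 1))) := by
          nth_rewrite 2 [← Real.sq_sqrt hA.le]
          field_simp
          ring
      _ ≤ 14 * (corralLead P s ^ (2 / 3 : ℝ) / ((s.rounds + 1 : ℕ) : ℝ) ^ (1 / 3 : ℝ)) := by
          gcongr
          norm_num
  have hpoint : ∀ d, C₀ + (corralLead P s - θ) * estGap P s ℓ d - k * estGap P s ℓ d ^ 2
      - θ * (s.cumZ 1 - s.cumZ 0)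
      - (if u = s.xhat then 0 else exp3Potential P s.xhat u (corralNext P s ℓ d).base)
      ≤ corralRegretPotential P u ε (corralNext P s ℓ d) := by
    intro d
    have h1 := leadVal_corralNext_ge H hs hℓ d
    have hz : (corralNext P s ℓ d).cumZ 1 - (corralNext P s ℓ d).cumZ 0
        = s.cumZ 1 - s.cumZ 0 + estGap P s ℓ d := by
      rw [← lossEstimate_sub H]
      simp only [corralNext, corralStep]
      ring
    have hxh : (corralNext P s ℓ d).xhat = s.xhat := rfl
    unfold corralRegretPotential
    rw [hz, hxh, ← hθ]
    change C₀ + corralLead P s * estGap P s ℓ d - k * estGap P s ℓ d ^ 2 ≤ _ at h1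
    linarith
  have hsum : C₀ + (corralLead P s - θ) * (proposalLoss P s ℓ - ℓ s.xhat)
      - k * (4 / corralGamma P s) - θ * (s.cumZ 1 - s.cumZ 0) - E'
      ≤ ∑ d, drawProb P s d * corralRegretPotential P u ε (corralNext P s ℓ d) := by
    refine le_trans ?_ (Finset.sum_le_sum fun d _ => mul_le_mul_of_nonneg_left (hpoint d) (hd0 d))
    have e : ∑ d, drawProb P s d * (C₀ + (corralLead P s - θ) * estGap P s ℓ d
        - k * estGap P s ℓ d ^ 2 - θ * (s.cumZ 1 - s.cumZ 0)
        - (if u = s.xhat then 0 else exp3Potential P s.xhat u (corralNext P s ℓ d).base))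
        = (∑ d, drawProb P s d) * (C₀ - θ * (s.cumZ 1 - s.cumZ 0))
          + (corralLead P s - θ) * (∑ d, drawProb P s d * estGap P s ℓ d)
          - k * (∑ d, drawProb P s d * estGap P s ℓ d ^ 2) - E' := by
      rw [hS', Finset.sum_mul, Finset.mul_sum, Finset.mul_sum, ← Finset.sum_add_distrib,
        ← Finset.sum_sub_distrib, ← Finset.sum_sub_distrib]
      exact Finset.sum_congr rfl fun _ _ => by ring
    rw [e, hd1, hw]
    have := mul_le_mul_of_nonneg_left hw2 hk0
    linarith
  have hlhs : ∑ d, drawProb P s d * (ℓ (action P s d) - ℓ u)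
      = ∑ d, drawProb P s d * ℓ (action P s d) - ℓ u := by
    simp only [mul_sub, Finset.sum_sub_distrib, ← Finset.sum_mul, hd1, one_mul]
  have hpot : corralRegretPotential P u ε s = L - θ * (s.cumZ 1 - s.cumZ 0)
      - (if u = s.xhat then 0 else exp3Potential P s.xhat u s.base) := rfl
  rw [hlhs, hpot]
  have hg1 : proposalLoss P s ℓ - ℓ s.xhat ≤ 2 := by linarith [hpl.2, hlx.1]
  have hg2 : -2 ≤ proposalLoss P s ℓ - ℓ s.xhat := by linarith [hpl.1, hlx.2]
  have hg3 := mul_le_mul_of_nonneg_left hg1 hε.le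
  have hg4 := mul_le_mul_of_nonneg_left hg2 hε.le
  -- The coefficient 8 is 7 from stability plus 1 from the linear bonus term. The coefficient 19 is
  -- 3 (change of rate) + 14 (stability) + 2 (exploration), the last also giving the term with
  -- coefficient 2. Moving the comparator off the vertex costs 2ε.
  unfold corralCost
  by_cases hu : u = s.xhat
  · rw [if_pos hu] at hθ ⊢
    have hS0 : E' = 0 := by simp [hS', hu]
    rw [hθ, hS0] at hsum
    rw [hθ, hu]
    rw [hu] at hsum
    linarith
  · rw [if_neg hu] at hθ ⊢
    have hS0 : E' = ∑ d, drawProb P s d * exp3Potential P s.xhat u (corralNext P s ℓ d).base := by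
      simp [hS', hu]
    rw [hθ, hS0] at hsum
    rw [hθ]
    linarith

end expectations
end
end GraphBandit
namespace GraphBandit
noncomputable section
variable {K : ℕ}
variable {P : Setup K} {c : ℝ}

/-! ### Summing the costs of an epoch -/

/-- A weighted Young inequality, proved by comparing b with λa. It converts every 2/3-power into a
linear term with free weight λ. -/
lemma sq_mul_le {a b lam : ℝ} (ha : 0 ≤ a) (hb : 0 ≤ b) (hl : 0 < lam) :
    a ^ 2 * b ≤ lam * a ^ 3 + b ^ 3 / lam ^ 2 := by
  rcases le_total b (lam * a) with h | h
  · have h1 : a ^ 2 * b ≤ a ^ 2 * (lam * a) := mul_le_mul_of_nonneg_left h (by positivity)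
    have h2 : 0 ≤ b ^ 3 / lam ^ 2 := by positivity
    nlinarith
  · have h1 : a ^ 2 * b ≤ b ^ 3 / lam ^ 2 := by
      rw [le_div_iff₀ (by positivity)]
      have : (lam * a) ^ 2 * b ≤ b ^ 2 * b :=
        mul_le_mul_of_nonneg_right (pow_le_pow_left₀ (by positivity) h 2) hb
      nlinarith
    have h2 : 0 ≤ lam * a ^ 3 := by positivity
    linarith

lemma mul_sq_le {a b lam : ℝ} (ha : 0 ≤ a) (hb : 0 ≤ b) (hl : 0 < lam) (hl2 : lam ≤ 2) :
    a * b ^ 2 ≤ lam * a ^ 3 + 4 * (b ^ 3 / lam ^ 2) := by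
  rcases le_total b (lam * a / 2) with h | h
  · have h1 : a * b ^ 2 ≤ a * (lam * a / 2) ^ 2 :=
      mul_le_mul_of_nonneg_left (pow_le_pow_left₀ hb h 2) ha
    have h2 : 0 ≤ b ^ 3 / lam ^ 2 := by positivity
    have h3 : lam * (lam * a ^ 3) ≤ 2 * (lam * a ^ 3) :=
      mul_le_mul_of_nonneg_right hl2 (by positivity)
    have h4 : 0 ≤ lam * a ^ 3 := by positivity
    nlinarith
  · have h1 : a * b ^ 2 ≤ 4 * (b ^ 3 / lam ^ 2) := by
      rw [← mul_div_assoc, le_div_iff₀ (by positivity)]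
      have h2 : lam * a * b ^ 2 ≤ 2 * b * b ^ 2 :=
        mul_le_mul_of_nonneg_right (by linarith) (by positivity)
      have h3 : lam * (lam * a * b ^ 2) ≤ 2 * (2 * b * b ^ 2) :=
        mul_le_mul hl2 h2 (by positivity) (by norm_num)
      nlinarith
    have h2 : 0 ≤ lam * a ^ 3 := by positivity
    linarith

/-- Bound on the cost of an epoch so far that depends on its length. -/
def spentByLength (c : ℝ) (s : CorralState K) : ℝ :=
  20 * c ^ (1 / 3 : ℝ) * (s.rounds : ℝ) ^ (2 / 3 : ℝ) + 10 * c * Real.log (1 / s.minProb)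
    + (if s.rounds = 0 then 0 else 8 * c)

/-- The logarithmic part of a bound on the cost of an epoch so far. -/
def spentByProb (c lam : ℝ) (s : CorralState K) : ℝ :=
  35 * c / lam ^ 2 * (if s.rounds = 0 then 0 else 2 + Real.log s.rounds + Real.log s.sumInvSqrt)
    + 10 * c * Real.log (1 / s.minProb) + (if s.rounds = 0 then 0 else 8 * c)

lemma corralCost_le (H : IsTuned P c) {s : CorralState K} (hs : s.Valid) :
    corralCost P s ≤ 10 * (c ^ (1 / 3 : ℝ) * (√(baseProb P s)
          / (s.sumInvSqrt + 1 / √(baseProb P s)) ^ (1 / 3 : ℝ)))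
      + 10 * c * (Real.log (1 / min s.minProb (baseProb P s)) - Real.log (1 / s.minProb))
      + (if s.rounds = 0 then 8 * c else 0)
      + 19 * (corralLead P s ^ (2 / 3 : ℝ) / ((s.rounds + 1 : ℕ) : ℝ) ^ (1 / 3 : ℝ))
      + 2 * (corralLead P s ^ (1 / 3 : ℝ) / ((s.rounds + 1 : ℕ) : ℝ) ^ (2 / 3 : ℝ)) := by
  have hq := baseProb_pos H s
  have hxq := corralLead_le H s
  have hx := corralLead_mem H s
  have hc := H.c_ge
  have hc0 : 0 < c := by linarith
  have hm := hs.min_pos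
  have hS : 0 ≤ s.sumInvSqrt := (Nat.cast_nonneg _).trans hs.rounds_le
  have hb := nextBonus_sub_le H hs
  set q := baseProb P s
  set x := corralLead P s
  have hsq0 : 0 < √q := by positivity
  have hmq : 0 < min s.minProb q := lt_min hm hq
  have h1 : x * (c ^ (1 / 3 : ℝ) * (1 / √q / (s.sumInvSqrt + 1 / √q) ^ (1 / 3 : ℝ)))
      ≤ 8 / 7 * (c ^ (1 / 3 : ℝ) * (√q / (s.sumInvSqrt + 1 / √q) ^ (1 / 3 : ℝ))) := by
    have h2 : q * (1 / √q) = √q := by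
      rw [mul_one_div, div_eq_iff hsq0.ne', Real.mul_self_sqrt hq.le]
    have h3 : x * (1 / √q) ≤ 8 / 7 * √q := by
      have h4 := mul_le_mul_of_nonneg_right hxq (one_div_pos.2 hsq0).le
      rwa [mul_assoc, h2] at h4
    calc x * (c ^ (1 / 3 : ℝ) * (1 / √q / (s.sumInvSqrt + 1 / √q) ^ (1 / 3 : ℝ)))
        = c ^ (1 / 3 : ℝ) * ((x * (1 / √q)) / (s.sumInvSqrt + 1 / √q) ^ (1 / 3 : ℝ)) := by ring
      _ ≤ c ^ (1 / 3 : ℝ) * ((8 / 7 * √q) / (s.sumInvSqrt + 1 / √q) ^ (1 / 3 : ℝ)) := by gcongr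
      _ = _ := by ring
  -- When q is a new minimum below m, q (1/q - 1/m) = 1 - q/m ≤ log(m/q), so these terms telescope
  -- to a logarithm.
  have h2 : q * (c / min s.minProb q - c / s.minProb)
      ≤ c * (Real.log (1 / min s.minProb q) - Real.log (1 / s.minProb)) := by
    rw [one_div, one_div, Real.log_inv, Real.log_inv]
    rcases le_total s.minProb q with h | h
    · rw [min_eq_left h]; simp
    · rw [min_eq_right h]
      have h3 := Real.log_le_sub_one_of_pos (div_pos hq hm)
      rw [Real.log_div hq.ne' hm.ne'] at h3
      have h4 : q * (c / q - c / s.minProb) = c * (1 - q / s.minProb) := by field_simp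
      rw [h4]
      exact mul_le_mul_of_nonneg_left (by linarith) hc0.le
  have h3 : 0 ≤ c / min s.minProb q - c / s.minProb :=
    sub_nonneg.2 (div_le_div_of_nonneg_left hc0.le hmq (min_le_left _ _))
  have h4 : x * (c / min s.minProb q - c / s.minProb)
      ≤ 8 / 7 * (q * (c / min s.minProb q - c / s.minProb)) := by
    rw [← mul_assoc]
    exact mul_le_mul_of_nonneg_right hxq h3
  have h5 : x * (if s.rounds = 0 then c else 0) ≤ (if s.rounds = 0 then c else 0) := by
    split_ifs
    · nlinarith [hx.2]
    · simp
  have h6 : (if s.rounds = 0 then 8 * c else 0) = 8 * (if s.rounds = 0 then c else 0) := by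
    split_ifs <;> simp
  have h7 := mul_le_mul_of_nonneg_left hb hx.1.le
  rw [mul_add, mul_add] at h7
  have h8 : 0 ≤ c ^ (1 / 3 : ℝ) * (√q / (s.sumInvSqrt + 1 / √q) ^ (1 / 3 : ℝ)) := by positivity
  have h9 : 0 ≤ q * (c / min s.minProb q - c / s.minProb) := mul_nonneg hq.le h3
  unfold corralCost
  rw [h6]
  change 8 * (x * (nextBonus P s - bonus P s)) + _ + _ ≤ _
  linarith

/-- Bounding all probabilities by 1, each power term is at most t^{-1/3}, which is paid for by the
increment of t^{2/3}. -/
lemma corralCost_le_length (H : IsTuned P c) {s : CorralState K} (hs : s.Valid) (d : Draw K)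
    (obs : Fin K → ℝ) :
    corralCost P s ≤ spentByLength c (corralStep P s d obs) - spentByLength c s := by
  have h0 := corralCost_le H hs
  have hq := baseProb_pos H s
  have hq1 := baseProb_le_one H s
  have hx := corralLead_mem H s
  have hn : (0 : ℝ) < ((s.rounds + 1 : ℕ) : ℝ) := by positivity
  have hτ : 1 ≤ ((s.rounds + 1 : ℕ) : ℝ) ^ (1 / 3 : ℝ) :=
    Real.one_le_rpow (by push_cast; linarith [Nat.cast_nonneg (α := ℝ) s.rounds]) (by norm_num)
  have hsq0 : 0 < √(baseProb P s) := by positivity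
  have hsq : √(baseProb P s) ≤ 1 := by
    rw [Real.sqrt_le_left one_pos.le]; simpa using hq1
  have hinv : 1 ≤ 1 / √(baseProb P s) := by rwa [one_le_div hsq0]
  have h1 : √(baseProb P s) / (s.sumInvSqrt + 1 / √(baseProb P s)) ^ (1 / 3 : ℝ)
      ≤ 1 / ((s.rounds + 1 : ℕ) : ℝ) ^ (1 / 3 : ℝ) := by
    apply div_le_div₀ zero_le_one hsq (by positivity)
    apply Real.rpow_le_rpow hn.le _ (by norm_num)
    push_cast
    linarith [hs.rounds_le]
  have h2 : corralLead P s ^ (2 / 3 : ℝ) / ((s.rounds + 1 : ℕ) : ℝ) ^ (1 / 3 : ℝ)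
      ≤ 1 / ((s.rounds + 1 : ℕ) : ℝ) ^ (1 / 3 : ℝ) := by
    gcongr
    exact Real.rpow_le_one hx.1.le hx.2.le (by norm_num)
  have h3 : corralLead P s ^ (1 / 3 : ℝ) / ((s.rounds + 1 : ℕ) : ℝ) ^ (2 / 3 : ℝ)
      ≤ 1 / ((s.rounds + 1 : ℕ) : ℝ) ^ (1 / 3 : ℝ) := by
    apply div_le_div₀ zero_le_one (Real.rpow_le_one hx.1.le hx.2.le (by norm_num)) (by positivity)
    rw [rpow_two_thirds_eq hn.le]
    nlinarith
  have h4 := rpow_two_thirds_sub_ge (S := (s.rounds : ℝ)) (S' := ((s.rounds + 1 : ℕ) : ℝ))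
      (Nat.cast_nonneg _) (by positivity)
  have h5 : ((s.rounds + 1 : ℕ) : ℝ) - s.rounds = 1 := by push_cast; ring
  rw [h5] at h4
  have hc3 := H.rpow_c_ge
  have hr : (corralStep P s d obs).rounds = s.rounds + 1 := rfl
  have hm : (corralStep P s d obs).minProb = min s.minProb (baseProb P s) := rfl
  unfold spentByLength
  rw [hr, hm, if_neg (Nat.succ_ne_zero _)]
  have h6 : (if s.rounds = 0 then 8 * c else 0) = 8 * c - (if s.rounds = 0 then 0 else 8 * c) := by
    split_ifs <;> ring
  rw [h6] at h0
  have hi : 0 ≤ 1 / ((s.rounds + 1 : ℕ) : ℝ) ^ (1 / 3 : ℝ) := by positivity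
  set D := ((s.rounds + 1 : ℕ) : ℝ) ^ (2 / 3 : ℝ) - (s.rounds : ℝ) ^ (2 / 3 : ℝ) with hD
  have h7 := mul_le_mul_of_nonneg_left h1 (show 0 ≤ c ^ (1 / 3 : ℝ) by linarith)
  have h8 := mul_le_mul_of_nonneg_right hc3 hi
  have h9 := mul_le_mul_of_nonneg_left h4 (show 0 ≤ c ^ (1 / 3 : ℝ) by linarith)
  have h10 : 0 ≤ c ^ (1 / 3 : ℝ) * D := le_trans (by positivity) h9
  have h11 : c ^ (1 / 3 : ℝ) * D = c ^ (1 / 3 : ℝ) * ((s.rounds + 1 : ℕ) : ℝ) ^ (2 / 3 : ℝ)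
    - c ^ (1 / 3 : ℝ) * (s.rounds : ℝ) ^ (2 / 3 : ℝ) := by rw [hD]; ring
  linarith

/-- Young's inequality splits each power term into λ times a probability and a relative increment,
of the round number or of ∑ q^{-1/2}, over λ². Relative increments sum to logarithms. -/
lemma corralCost_le_prob (H : IsTuned P c) {s : CorralState K} (hs : s.Valid) (d : Draw K)
    (obs : Fin K → ℝ) {lam : ℝ} (hl : 0 < lam) (hl2 : lam ≤ 2) :
    corralCost P s ≤ 35 * (lam * baseProb P s)
      + (spentByProb c lam (corralStep P s d obs) - spentByProb c lam s) := by
  have h0 := corralCost_le H hs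
  have hq := baseProb_pos H s
  have hq1 := baseProb_le_one H s
  have hx := corralLead_mem H s
  have hxq := corralLead_le H s
  have hc := H.c_ge
  have hc0 : 0 < c := by linarith
  have hn : (0 : ℝ) < ((s.rounds + 1 : ℕ) : ℝ) := by positivity
  have hsq0 : 0 < √(baseProb P s) := by positivity
  have hsq : √(baseProb P s) ≤ 1 := by
    rw [Real.sqrt_le_left one_pos.le]; simpa using hq1
  have hinv : 1 ≤ 1 / √(baseProb P s) := by rwa [one_le_div hsq0]
  have hS : 0 ≤ s.sumInvSqrt := (Nat.cast_nonneg _).trans hs.rounds_le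
  have hS' : 0 < s.sumInvSqrt + 1 / √(baseProb P s) := by positivity
  have hr : (corralStep P s d obs).rounds = s.rounds + 1 := rfl
  have hm : (corralStep P s d obs).minProb = min s.minProb (baseProb P s) := rfl
  have hSs : (corralStep P s d obs).sumInvSqrt = s.sumInvSqrt + 1 / √(baseProb P s) := rfl
  set q := baseProb P s
  set x := corralLead P s
  set S' := s.sumInvSqrt + 1 / √q with hS'def
  set n' := ((s.rounds + 1 : ℕ) : ℝ) with hn'
  set y := 1 / √q / S' with hy
  have hX := rpow_third_pow hx.1.le
  have hN := rpow_third_pow hn.le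
  have hX0 : 0 < x ^ (1 / 3 : ℝ) := by have := hx.1; positivity
  have hN0 : 0 < n' ^ (1 / 3 : ℝ) := by positivity
  have hy0 : 0 < y := by positivity
  have h1 : c ^ (1 / 3 : ℝ) * (√q / S' ^ (1 / 3 : ℝ)) ≤ lam * q + c * y / lam ^ 2 := by
    have h2 := sq_mul_le (a := q ^ (1 / 3 : ℝ)) (b := (c * y) ^ (1 / 3 : ℝ)) (by positivity)
      (by positivity) hl
    rw [rpow_third_pow hq.le, rpow_third_pow (by positivity)] at h2
    -- The left side is exactly q^{2/3} (c y)^{1/3}, where y is the relative increment of ∑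
    -- q^{-1/2}.
    refine le_trans (le_of_eq ?_) h2
    rw [Real.mul_rpow hc0.le hy0.le, hy, Real.div_rpow (by positivity) hS'.le]
    have h3 : √q = (q ^ (1 / 3 : ℝ)) ^ 2 * (1 / √q) ^ (1 / 3 : ℝ) := by
      have e : 1 / √q = q ^ (-(1 / 2) : ℝ) := by
        rw [Real.sqrt_eq_rpow, one_div, ← Real.rpow_neg hq.le]
      rw [e, ← rpow_two_thirds_eq hq.le, ← Real.rpow_mul hq.le, ← Real.rpow_add hq, Real.sqrt_eq_rpow]
      norm_num
    nth_rewrite 1 [h3]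
    ring
  have h2 : x ^ (2 / 3 : ℝ) / n' ^ (1 / 3 : ℝ) ≤ lam * x + 1 / n' / lam ^ 2 := by
    have h3 := sq_mul_le (a := x ^ (1 / 3 : ℝ)) (b := 1 / n' ^ (1 / 3 : ℝ)) hX0.le (by positivity) hl
    rw [div_pow, hX, hN, one_pow] at h3
    rw [rpow_two_thirds_eq hx.1.le]
    refine le_trans (le_of_eq ?_) h3
    ring
  have h3 : x ^ (1 / 3 : ℝ) / n' ^ (2 / 3 : ℝ) ≤ lam * x + 4 * (1 / n' / lam ^ 2) := by
    have h3 := mul_sq_le (a := x ^ (1 / 3 : ℝ)) (b := 1 / n' ^ (1 / 3 : ℝ)) hX0.le (by positivity) hl hl2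
    simp only [div_pow, one_pow] at h3
    rw [hX, hN] at h3
    rw [rpow_two_thirds_eq hn.le]
    refine le_trans (le_of_eq ?_) h3
    ring
  have h4 : y + 1 / n' ≤ (2 + Real.log n' + Real.log S')
      - (if s.rounds = 0 then 0 else 2 + Real.log s.rounds + Real.log s.sumInvSqrt) := by
    -- In the first round both relative increments equal 1 and the logarithms need not grow; the
    -- summand 2 pays for them. Later, 1 - r ≤ -log r applies to each.
    split_ifs with h
    · have e1 := (hs.eq_zero h).1
      have e2 : n' = 1 := by rw [hn', h]; simp
      have e3 : S' = 1 / √q := by rw [hS'def, e1, zero_add]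
      have e4 : y = 1 := by rw [hy, e3]; field_simp
      have e5 : 0 ≤ Real.log S' := Real.log_nonneg (by rw [e3]; exact hinv)
      rw [e4, e2, Real.log_one]
      linarith
    · have hr0 : (0 : ℝ) < s.rounds := by exact_mod_cast Nat.pos_of_ne_zero h
      have hS0 : 0 < s.sumInvSqrt := hr0.trans_le hs.rounds_le
      have e1 := Real.log_le_sub_one_of_pos (div_pos hr0 hn)
      have e2 := Real.log_le_sub_one_of_pos (div_pos hS0 hS')
      rw [Real.log_div hr0.ne' hn.ne'] at e1
      rw [Real.log_div hS0.ne' hS'.ne'] at e2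
      have e3 : 1 / n' = 1 - s.rounds / n' := by
        rw [eq_sub_iff_add_eq, ← add_div, div_eq_one_iff_eq hn.ne', hn']
        push_cast; ring
      have e4 : y = 1 - s.sumInvSqrt / S' := by
        rw [hy, eq_sub_iff_add_eq, ← add_div, div_eq_one_iff_eq hS'.ne', hS'def]
        ring
      linarith
  unfold spentByProb
  rw [hr, hm, hSs, if_neg (Nat.succ_ne_zero _), if_neg (Nat.succ_ne_zero _)]
  change _ ≤ 35 * (lam * q) + ((35 * c / lam ^ 2 * (2 + Real.log n' + Real.log S') + _ + _) - _)
  have h6 : (if s.rounds = 0 then 8 * c else 0) = 8 * c - (if s.rounds = 0 then 0 else 8 * c) := by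
    split_ifs <;> ring
  rw [h6] at h0
  have h7 := mul_le_mul_of_nonneg_left h4 (show 0 ≤ 35 * c / lam ^ 2 by positivity)
  rw [mul_sub] at h7
  have h8 : 27 * (1 / n' / lam ^ 2) + 10 * (c * y / lam ^ 2) ≤ 35 * c / lam ^ 2 * (y + 1 / n') := by
    have e : 35 * c / lam ^ 2 * (y + 1 / n') = 35 * (c * y / lam ^ 2) + 35 * c * (1 / n' / lam ^ 2) := by
      ring
    rw [e]
    have e1 : 0 ≤ c * y / lam ^ 2 := by positivity
    have e2 : 0 ≤ 1 / n' / lam ^ 2 := by positivity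
    nlinarith
  have h9 : lam * x ≤ lam * (8 / 7 * q) := mul_le_mul_of_nonneg_left hxq hl.le
  have h10 : 0 < lam * q := by positivity
  linarith

end
end GraphBandit
namespace GraphBandit
noncomputable section
variable {K : ℕ}
variable {P : Setup K} {c : ℝ}

/-! ### Trajectories -/

/-- The next memory of the learner after the draw `d` and the losses `ℓ`. -/
def State.next (P : Setup K) (s : State K) (ℓ : Fin K → ℝ) (d : Draw K) : State K :=
  s.step P d (feedback P.G (action P s.corral d) ℓ)

/-- It hides how the new candidate is chosen: only that it was played often enough, or that no other
arm was once the epoch was long enough, is used along trajectories. -/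
lemma State.next_cases (P : Setup K) (s : State K) (ℓ : Fin K → ℝ) (d : Draw K) :
    (∃ x, x ≠ s.corral.xhat ∧ 2 * s.prevLength ≤ (s.corral.rounds : ℝ) + 1 ∧
      ((s.corral.rounds : ℝ) + 1) / 2 ≤ s.count x + (if action P s.corral d = x then 1 else 0) ∧
      s.next P ℓ d = ⟨CorralState.start x, 0, (s.corral.rounds : ℝ) + 1⟩) ∨
    ((2 * s.prevLength ≤ (s.corral.rounds : ℝ) + 1 → ∀ x, x ≠ s.corral.xhat →
        s.count x + (if action P s.corral d = x then 1 else 0) < ((s.corral.rounds : ℝ) + 1) / 2) ∧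
      s.next P ℓ d = ⟨corralNext P s.corral ℓ d,
        fun x => s.count x + if action P s.corral d = x then 1 else 0, s.prevLength⟩) := by
  classical
  have hr : (((corralNext P s.corral ℓ d).rounds : ℕ) : ℝ) = (s.corral.rounds : ℝ) + 1 := by
    change ((s.corral.rounds + 1 : ℕ) : ℝ) = _
    push_cast; rfl
  have hc : ∀ x, ((s.count x + (if action P s.corral d = x then 1 else 0) : ℕ) : ℝ)
      = s.count x + (if action P s.corral d = x then 1 else 0) := fun x => by push_cast; rfl
  by_cases h : 2 * s.prevLength ≤ (((corralNext P s.corral ℓ d).rounds : ℕ) : ℝ) ∧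
      ∃ x, x ≠ s.corral.xhat ∧ (((corralNext P s.corral ℓ d).rounds : ℕ) : ℝ) / 2
        ≤ ((s.count x + (if action P s.corral d = x then 1 else 0) : ℕ) : ℝ)
  · left
    have hx := h.2.choose_spec
    refine ⟨h.2.choose, hx.1, by rw [← hr]; exact h.1, ?_, ?_⟩
    · rw [← hr, ← hc]; exact hx.2
    · rw [← hr]
      exact dif_pos h
  · right
    refine ⟨?_, ?_⟩
    · intro h1 x hx
      by_contra hlt
      push Not at hlt
      exact h ⟨by rw [hr]; exact h1, x, hx, by rw [hr, hc]; exact hlt⟩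
    · exact dif_neg h

/-- A trajectory of the learner. -/
structure IsPath (P : Setup K) (ℓ : ℕ → Fin K → ℝ) (d : ℕ → Draw K) (s : ℕ → State K) : Prop where
  zero : ∃ x, s 0 = State.start P x
  succ : ∀ t < P.T, s (t + 1) = (s t).next P (ℓ t) (d t)

/-- The sum of the absolute values of the loss estimates of a round. -/
def absEstimate (P : Setup K) (s : CorralState K) (ℓ : Fin K → ℝ) (d : Draw K) : ℝ :=
  ∑ i, |lossEstimate P s d (feedback P.G (action P s d) ℓ) i|

/-- The sum of the absolute values of the loss estimates so far. -/
def totalAbs (P : Setup K) (ℓ : ℕ → Fin K → ℝ) (d : ℕ → Draw K) (s : ℕ → State K) (t : ℕ) : ℝ :=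
  ∑ τ ∈ Finset.range t, absEstimate P (s τ).corral (ℓ τ) (d τ)

/-- The number of restarts so far. -/
def restarts (s : ℕ → State K) (t : ℕ) : ℕ :=
  ∑ τ ∈ Finset.range t, if (s (τ + 1)).corral.rounds = 0 then 1 else 0

/-- The number of plays of arms other than `x` so far. -/
def missCount (P : Setup K) (x : Fin K) (d : ℕ → Draw K) (s : ℕ → State K) (t : ℕ) : ℝ :=
  ∑ τ ∈ Finset.range t, if action P (s τ).corral (d τ) = x then 0 else 1

/-- The sum of the update probabilities over the rounds so far with candidate `x`. -/
def baseMass (P : Setup K) (x : Fin K) (s : ℕ → State K) (t : ℕ) : ℝ :=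
  ∑ τ ∈ Finset.range t, if (s τ).corral.xhat = x then baseProb P (s τ).corral else 0

/-- The first threshold of the outer algorithm. -/
def initLength (P : Setup K) : ℝ := P.c₃ * Real.log P.T

lemma absEstimate_nonneg (s : CorralState K) (ℓ : Fin K → ℝ) (d : Draw K) :
    0 ≤ absEstimate P s ℓ d := Finset.sum_nonneg fun _ _ => abs_nonneg _

lemma totalAbs_mono (P : Setup K) (ℓ : ℕ → Fin K → ℝ) (d : ℕ → Draw K) (s : ℕ → State K) :
    Monotone (totalAbs P ℓ d s) :=
  monotone_nat_of_le_succ fun t => by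
    unfold totalAbs
    rw [Finset.sum_range_succ]
    exact le_add_of_nonneg_right (absEstimate_nonneg _ _ _)

lemma totalAbs_nonneg (P : Setup K) (ℓ : ℕ → Fin K → ℝ) (d : ℕ → Draw K) (s : ℕ → State K) (t : ℕ) :
    0 ≤ totalAbs P ℓ d s t := Finset.sum_nonneg fun _ _ => absEstimate_nonneg _ _ _

lemma IsTuned.initLength_nonneg (H : IsTuned P c) : 0 ≤ initLength P := by
  unfold initLength
  rw [H.c₃_eq]
  have h1 := H.rpow_c_ge
  have h2 := H.c_ge
  have h3 := Real.log_natCast_nonneg P.T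
  positivity

/-! ### Invariants along a trajectory -/

section path

variable {ℓ : ℕ → Fin K → ℝ} {d : ℕ → Draw K} {s : ℕ → State K}

lemma IsPath.valid (H : IsTuned P c) (hp : IsPath P ℓ d s) :
    ∀ t ≤ P.T, (s t).corral.Valid := by
  intro t
  induction t with
  | zero =>
    intro _
    obtain ⟨x, hx⟩ := hp.zero
    rw [hx]
    exact CorralState.valid_start x
  | succ t ih =>
    intro ht
    rw [hp.succ t ht]
    rcases State.next_cases P (s t) (ℓ t) (d t) with ⟨x, -, -, -, h⟩ | ⟨-, h⟩
    · rw [h]; exact CorralState.valid_start x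
    · rw [h]; exact (ih (by omega)).next H _ _

/-- The loss estimates control the probability of the base algorithm. -/
lemma one_div_baseProb_le (H : IsTuned P c) {s : CorralState K} (hs : s.Valid) {W : ℝ}
    (hW : |s.cumZ 0| + |s.cumZ 1| ≤ W) : 1 / baseProb P s ≤ 4 + W / (4 * c) := by
  have hA : 0 ≤ invRate P (s.rounds + 1) := by linarith [invRate_ge H (s.rounds + 1)]
  have hc0 : 0 < c := by linarith [H.c_ge]
  have hW0 : 0 ≤ W := le_trans (by positivity) hW
  -- The bonus only lowers the gap, so it can be dropped.
  have hG : corralGap P s ≤ W := by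
    unfold corralGap
    have := bonus_nonneg H hs
    have h1 := le_abs_self (s.cumZ 1)
    have h2 := neg_abs_le (s.cumZ 0)
    linarith
  have hc2 : 0 < P.c₂ := by rw [H.c₂_eq]; exact hc0
  have h1 := one_div_lead_le hA hc2 (corralGap P s) hW0 hG
  change 1 / corralLead P s ≤ _ at h1
  rw [H.c₂_eq] at h1
  have hq := baseProb_pos H s
  have hx := (corralLead_mem H s).1
  have h2 : 1 / baseProb P s ≤ 8 / 7 * (1 / corralLead P s) := by
    rw [mul_one_div, div_le_div_iff₀ hq hx, one_mul]
    exact corralLead_le H s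
  have h3 : W / (4 * c) = 2 * (W / (8 * c)) := by ring
  have h4 : 0 ≤ W / (8 * c) := by positivity
  linarith

lemma corralNext_estimates (H : IsTuned P c) {s : CorralState K} (hs : s.Valid) {W : ℝ}
    (hW : |s.cumZ 0| + |s.cumZ 1| ≤ W) (hm : 1 / s.minProb ≤ 4 + W / (4 * c)) (ℓ : Fin K → ℝ)
    (d : Draw K) :
    |(corralNext P s ℓ d).cumZ 0| + |(corralNext P s ℓ d).cumZ 1| ≤ W + absEstimate P s ℓ d ∧
      1 / (corralNext P s ℓ d).minProb ≤ 4 + (W + absEstimate P s ℓ d) / (4 * c) := by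
  have h1 := one_div_baseProb_le H hs hW
  have hc0 : 0 < c := by linarith [H.c_ge]
  constructor
  · unfold absEstimate
    rw [Fin.sum_univ_two]
    have h2 := abs_add_le (s.cumZ 0) (lossEstimate P s d (feedback P.G (action P s d) ℓ) 0)
    have h3 := abs_add_le (s.cumZ 1) (lossEstimate P s d (feedback P.G (action P s d) ℓ) 1)
    change |s.cumZ 0 + _| + |s.cumZ 1 + _| ≤ _
    linarith
  · have h2 : W / (4 * c) ≤ (W + absEstimate P s ℓ d) / (4 * c) := by
      have := absEstimate_nonneg (P := P) s ℓ d
      gcongr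
      linarith
    change 1 / min s.minProb (baseProb P s) ≤ _
    rcases min_choice s.minProb (baseProb P s) with h | h <;> rw [h] <;> linarith

/-- Estimates are accumulated over the whole run rather than the epoch. Restarts only reset the left
sides, so a single quantity controls all epochs. -/
lemma IsPath.estimates (H : IsTuned P c) (hp : IsPath P ℓ d s) :
    ∀ t ≤ P.T, |(s t).corral.cumZ 0| + |(s t).corral.cumZ 1| ≤ totalAbs P ℓ d s t ∧
      1 / (s t).corral.minProb ≤ 4 + totalAbs P ℓ d s t / (4 * c) := by
  have hc0 : 0 < c := by linarith [H.c_ge]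
  have hstart : ∀ x : Fin K, ∀ W : ℝ, 0 ≤ W →
      |(CorralState.start x).cumZ 0| + |(CorralState.start x).cumZ 1| ≤ W ∧
        1 / (CorralState.start x).minProb ≤ 4 + W / (4 * c) := by
    intro x W hW
    have : 0 ≤ W / (4 * c) := by positivity
    constructor
    · simpa [CorralState.start] using hW
    · simp only [CorralState.start, div_one]; linarith
  intro t
  induction t with
  | zero =>
    intro _
    obtain ⟨x, hx⟩ := hp.zero
    rw [hx]
    exact hstart x _ (totalAbs_nonneg _ _ _ _ _)
  | succ t ih =>
    intro ht
    obtain ⟨ih1, ih2⟩ := ih (by omega)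
    have h1 := corralNext_estimates H (hp.valid H t (by omega)) ih1 ih2 (ℓ t) (d t)
    have h2 : totalAbs P ℓ d s (t + 1)
        = totalAbs P ℓ d s t + absEstimate P (s t).corral (ℓ t) (d t) := Finset.sum_range_succ _ _
    rw [hp.succ t ht]
    rcases State.next_cases P (s t) (ℓ t) (d t) with ⟨x, -, -, -, h⟩ | ⟨-, h⟩
    · rw [h]
      exact hstart x _ (totalAbs_nonneg _ _ _ _ _)
    · rw [h, h2]
      exact h1

/-- Each restart at least doubles the stored length, and the stored length is an initial threshold
or the length of an actual epoch. This bounds the number of restarts. -/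
lemma IsPath.lengths (hp : IsPath P ℓ d s) :
    ∀ t ≤ P.T, ((s t).corral.rounds : ℝ) ≤ t ∧ 2 ^ restarts s t * initLength P ≤ (s t).prevLength ∧
      (s t).prevLength ≤ max (t : ℝ) (initLength P) := by
  intro t
  induction t with
  | zero =>
    intro _
    obtain ⟨x, hx⟩ := hp.zero
    rw [hx]
    refine ⟨by simp [State.start, CorralState.start], ?_, ?_⟩
    · simp [restarts, State.start, initLength]
    · exact le_max_right _ _
  | succ t ih =>
    intro ht
    obtain ⟨ih1, ih2, ih3⟩ := ih (by omega)
    have hR : restarts s (t + 1) = restarts s t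
        + if (s (t + 1)).corral.rounds = 0 then 1 else 0 := Finset.sum_range_succ _ _
    rw [hR, hp.succ t ht]
    rcases State.next_cases P (s t) (ℓ t) (d t) with ⟨x, -, h1, -, h⟩ | ⟨-, h⟩
    · rw [h]
      have e : (CorralState.start x).rounds = 0 := rfl
      simp only [e, if_true]
      refine ⟨by rw [Nat.cast_zero]; exact Nat.cast_nonneg _, ?_, ?_⟩
      · rw [pow_succ]; linarith
      · refine le_max_of_le_left ?_
        push_cast; linarith
    · rw [h]
      have e : (corralNext P (s t).corral (ℓ t) (d t)).rounds = (s t).corral.rounds + 1 := rfl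
      simp only [e, Nat.succ_ne_zero, if_false, add_zero]
      refine ⟨by push_cast; linarith, ih2, ih3.trans ?_⟩
      push_cast
      exact max_le_max (by linarith) le_rfl

lemma missCount_succ (x : Fin K) (t : ℕ) : missCount P x d s (t + 1) = missCount P x d s t
    + if action P (s t).corral (d t) = x then 0 else 1 := Finset.sum_range_succ _ _

lemma missCount_nonneg (x : Fin K) (t : ℕ) : 0 ≤ missCount P x d s t :=
  Finset.sum_nonneg fun _ _ => by split_ifs <;> norm_num

/-- Epochs with a candidate other than `x` are paid for by plays of arms other than `x`. -/
lemma IsPath.counts (H : IsTuned P c) (hp : IsPath P ℓ d s) (x : Fin K) :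
    ∀ t ≤ P.T, ((s t).corral.rounds : ℝ) ≤ (s t).count x + missCount P x d s t ∧
      (∀ y, y ≠ x → ((s t).count y : ℝ) ≤ missCount P x d s t) ∧
      ((s t).corral.xhat ≠ x → (s t).prevLength ≤ 2 * missCount P x d s t + initLength P) ∧
      ((s t).corral.xhat ≠ x →
        ((s t).corral.rounds : ℝ) ≤ 4 * missCount P x d s t + 2 * initLength P) ∧
      (s t).prevLength ≤ 4 * missCount P x d s t + 2 * initLength P + 1 := by
  have hI := H.initLength_nonneg
  intro t
  induction t with
  | zero =>
    intro _
    obtain ⟨y, hy⟩ := hp.zero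
    rw [hy]
    have e : (State.start P y).prevLength = initLength P := rfl
    have e2 : (State.start P y).corral.rounds = 0 := rfl
    have e3 : ∀ z, (State.start P y).count z = 0 := fun z => rfl
    have e4 : missCount P x d s 0 = 0 := rfl
    rw [e, e2, e4]
    refine ⟨by rw [e3]; simp, fun z _ => by rw [e3]; simp, fun _ => by linarith,
      fun _ => by push_cast; linarith, by linarith⟩
  | succ t ih =>
    intro ht
    obtain ⟨ih1, ih2, ih3, ih4, ih5⟩ := ih (by omega)
    have hN := missCount_succ (P := P) (d := d) (s := s) x t
    have hN0 := missCount_nonneg (P := P) (d := d) (s := s) x t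
    have hN1 : missCount P x d s t ≤ missCount P x d s (t + 1) := by
      rw [hN]; split_ifs <;> linarith
    have hcount : ∀ y, y ≠ x → ((s t).count y : ℝ)
        + (if action P (s t).corral (d t) = y then 1 else 0) ≤ missCount P x d s (t + 1) := by
      intro y hy
      have := ih2 y hy
      rw [hN]
      by_cases h1 : action P (s t).corral (d t) = y
      · rw [if_pos h1, if_neg (by rw [h1]; exact hy)]; linarith
      · rw [if_neg h1]; split_ifs <;> linarith
    rw [hp.succ t ht]
    rcases State.next_cases P (s t) (ℓ t) (d t) with ⟨y, hy, h1, h2, h⟩ | ⟨h1, h⟩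
    · rw [h]
      have e2 : (CorralState.start y).rounds = 0 := rfl
      have e3 : ∀ z, (0 : Fin K → ℕ) z = 0 := fun z => rfl
      have e4 : (CorralState.start y).xhat = y := rfl
      simp only [e2, e3, e4, Nat.cast_zero]
      refine ⟨by linarith, fun z _ => by linarith, fun hyx => ?_, fun _ => by linarith, ?_⟩
      -- The new candidate y is not x and was played in at least half of the epoch, so the epoch is
      -- at most twice the number of misses.
      · have := hcount y hyx
        linarith
      -- If x was the candidate, its successor differs from x and accounts for half of the epoch.
      -- Otherwise the length bound for epochs with another candidate applies, plus one for the last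
      -- round.
      · by_cases hxx : (s t).corral.xhat = x
        · have := hcount y (by rw [← hxx]; exact hy)
          linarith
        · have := ih4 hxx
          linarith
    · rw [h]
      have e : (corralNext P (s t).corral (ℓ t) (d t)).rounds = (s t).corral.rounds + 1 := rfl
      have e4 : (corralNext P (s t).corral (ℓ t) (d t)).xhat = (s t).corral.xhat := rfl
      simp only [e, e4]
      push_cast
      have g1 : ((s t).corral.rounds : ℝ) + 1 ≤ (s t).count x
          + (if action P (s t).corral (d t) = x then 1 else 0) + missCount P x d s (t + 1) := by
        rw [hN]
        split_ifs <;> linarith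
      refine ⟨g1, hcount, fun hx => by linarith [ih3 hx], fun hx => ?_, by linarith⟩
      -- With another candidate the epoch goes on either because x has fewer than half of the plays,
      -- or because the epoch is still shorter than twice the previous one.
      by_cases h2 : 2 * (s t).prevLength ≤ ((s t).corral.rounds : ℝ) + 1
      · have := h1 h2 x (Ne.symm hx)
        linarith
      · have := ih3 hx
        linarith

end path
end
end GraphBandit
namespace GraphBandit
noncomputable section
variable {K : ℕ}
variable {P : Setup K} {c : ℝ}

/-! ### The total cost of a trajectory -/

/-- The sum of the costs of the rounds so far. -/
def totalCost (P : Setup K) (s : ℕ → State K) (t : ℕ) : ℝ :=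
  ∑ τ ∈ Finset.range t, corralCost P (s τ).corral

/-- The part of the cost of an epoch that does not depend on its length, when the loss estimates
sum to `W`. -/
def epochPrice (c W : ℝ) : ℝ := 10 * c * Real.log (4 + W / (4 * c)) + 8 * c

lemma epochPrice_mono (hc : 0 < c) {W W' : ℝ} (hW : 0 ≤ W) (h : W ≤ W') :
    epochPrice c W ≤ epochPrice c W' := by
  unfold epochPrice
  have h1 : 0 ≤ W / (4 * c) := by positivity
  have h2 : W / (4 * c) ≤ W' / (4 * c) := by gcongr
  have := Real.log_le_log (show 0 < 4 + W / (4 * c) by linarith) (add_le_add_right h2 4)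
  nlinarith

lemma epochPrice_nonneg (hc : 0 < c) {W : ℝ} (hW : 0 ≤ W) : 0 ≤ epochPrice c W := by
  unfold epochPrice
  have h1 : 0 ≤ W / (4 * c) := by positivity
  have := Real.log_nonneg (show 1 ≤ 4 + W / (4 * c) by linarith)
  positivity

lemma spentByLength_le (hc : 0 < c) {s : CorralState K} (hs : s.Valid) {W : ℝ}
    (hm : 1 / s.minProb ≤ 4 + W / (4 * c)) :
    spentByLength c s ≤ 20 * c ^ (1 / 3 : ℝ) * (s.rounds : ℝ) ^ (2 / 3 : ℝ) + epochPrice c W := by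
  unfold spentByLength epochPrice
  have h1 := Real.log_le_log (one_div_pos.2 hs.min_pos) hm
  have h2 : (if s.rounds = 0 then 0 else 8 * c) ≤ 8 * c := by split_ifs <;> linarith
  nlinarith

lemma spentByProb_le (hc : 0 < c) {s : CorralState K} (hs : s.Valid) {W lam : ℝ} (hW : 0 ≤ W)
    (hl : 0 < lam) (hm : 1 / s.minProb ≤ 4 + W / (4 * c)) {T : ℕ} (hT : (s.rounds : ℝ) ≤ T) :
    spentByProb c lam s ≤ 35 * c / lam ^ 2 * (2 + 2 * Real.log T + Real.log (4 + W / (4 * c)))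
      + epochPrice c W := by
  unfold spentByProb epochPrice
  have h1 := Real.log_le_log (one_div_pos.2 hs.min_pos) hm
  have h2 : (if s.rounds = 0 then 0 else 8 * c) ≤ 8 * c := by split_ifs <;> linarith
  have h3 : 0 ≤ W / (4 * c) := by positivity
  have h4 := Real.log_nonneg (show 1 ≤ 4 + W / (4 * c) by linarith)
  have h5 := Real.log_natCast_nonneg T
  have h6 : (if s.rounds = 0 then 0 else 2 + Real.log s.rounds + Real.log s.sumInvSqrt)
      ≤ 2 + 2 * Real.log T + Real.log (4 + W / (4 * c)) := by
    split_ifs with h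
    · linarith
    · have hr : (0 : ℝ) < s.rounds := by exact_mod_cast Nat.pos_of_ne_zero h
      have e1 := Real.log_le_log hr hT
      have e2 := Real.log_le_log (hr.trans_le hs.rounds_le) hs.sum_le
      rw [div_eq_mul_one_div, Real.log_mul hr.ne' (one_div_pos.2 hs.min_pos).ne'] at e2
      linarith
  have h7 := mul_le_mul_of_nonneg_left h6 (show 0 ≤ 35 * c / lam ^ 2 by positivity)
  nlinarith

/-- Because 2^{-2/3} < 2/3; cubing, this is 1/4 < 8/27. It lets the 2/3-powers of doubling lengths
telescope. -/
lemma rpow_two_thirds_le_of_two_mul_le {p L : ℝ} (hp : 0 ≤ p) (h : 2 * p ≤ L) :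
    p ^ (2 / 3 : ℝ) ≤ 2 / 3 * L ^ (2 / 3 : ℝ) := by
  have hL : 0 ≤ L := by linarith
  have e1 := rpow_third_pow hp
  have e2 := rpow_third_pow hL
  rw [rpow_two_thirds_eq hp, rpow_two_thirds_eq hL]
  have ha : 0 ≤ p ^ (1 / 3 : ℝ) := by positivity
  have hb : 0 ≤ L ^ (1 / 3 : ℝ) := by positivity
  set a := p ^ (1 / 3 : ℝ)
  set b := L ^ (1 / 3 : ℝ)
  by_contra hlt
  push Not at hlt
  have h1 : (2 / 3 * b ^ 2) ^ 3 < (a ^ 2) ^ 3 := pow_lt_pow_left₀ hlt (by positivity) (by norm_num)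
  have h2 : (2 * a ^ 3) ^ 2 ≤ (b ^ 3) ^ 2 :=
    pow_le_pow_left₀ (by positivity) (by rw [e1, e2]; exact h) 2
  nlinarith [pow_nonneg hb 6]

section path

variable {ℓ : ℕ → Fin K → ℝ} {d : ℕ → Draw K} {s : ℕ → State K}

lemma spentByLength_start (c : ℝ) (x : Fin K) : spentByLength c (CorralState.start x) = 0 := by
  simp [spentByLength, CorralState.start]

lemma spentByProb_start (c lam : ℝ) (x : Fin K) : spentByProb c lam (CorralState.start x) = 0 := by
  simp [spentByProb, CorralState.start]

/-- The cost is split into completed epochs (`comp`) and the current one (`cur`). Completed epochs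
are charged by length at once. The current one keeps both bounds, for all λ simultaneously; its `q`
is the sum of update probabilities in this epoch. -/
lemma IsPath.costs (H : IsTuned P c) (hp : IsPath P ℓ d s) (x : Fin K) :
    ∀ t ≤ P.T, ∃ comp cur q : ℝ, comp + cur = totalCost P s t ∧
      comp ≤ 60 * c ^ (1 / 3 : ℝ) * ((s t).prevLength ^ (2 / 3 : ℝ) - initLength P ^ (2 / 3 : ℝ))
        + restarts s t * epochPrice c (totalAbs P ℓ d s t) ∧
      cur ≤ spentByLength c (s t).corral ∧
      (∀ lam, 0 < lam → lam ≤ 2 → cur ≤ 35 * (lam * q) + spentByProb c lam (s t).corral) ∧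
      ((s t).corral.xhat = x → q ≤ baseMass P x s t) := by
  have hc0 : 0 < c := by linarith [H.c_ge]
  have hc3 : 0 ≤ c ^ (1 / 3 : ℝ) := by positivity
  intro t
  induction t with
  | zero =>
    intro _
    obtain ⟨y, hy⟩ := hp.zero
    have e1 : (State.start P y).corral = CorralState.start y := rfl
    have e2 : (State.start P y).prevLength = initLength P := rfl
    refine ⟨0, 0, 0, ?_, ?_, ?_, ?_, ?_⟩
    · simp [totalCost]
    · rw [hy, e2]; simp [restarts]
    · rw [hy, e1, spentByLength_start]
    · intro lam _ _
      rw [hy, e1, spentByProb_start]; simp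
    · intro _; simp [baseMass]
  | succ t ih =>
    intro ht
    obtain ⟨comp, cur, q, h1, h2, h3, h4, h5⟩ := ih (by omega)
    have hv := hp.valid H t (by omega)
    have hR : restarts s (t + 1) = restarts s t
        + if (s (t + 1)).corral.rounds = 0 then 1 else 0 := Finset.sum_range_succ _ _
    have hcost : totalCost P s (t + 1) = totalCost P s t + corralCost P (s t).corral :=
      Finset.sum_range_succ _ _
    have hmass : baseMass P x s (t + 1) = baseMass P x s t
        + if (s t).corral.xhat = x then baseProb P (s t).corral else 0 := Finset.sum_range_succ _ _
    have hW := epochPrice_mono hc0 (totalAbs_nonneg P ℓ d s t)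
      (totalAbs_mono P ℓ d s (Nat.le_succ t))
    have hW0 := epochPrice_nonneg hc0 (totalAbs_nonneg P ℓ d s (t + 1))
    have hRW := mul_le_mul_of_nonneg_left hW (Nat.cast_nonneg (α := ℝ) (restarts s t))
    have hlen := corralCost_le_length H hv (d t)
      (feedback P.G (action P (s t).corral (d t)) (ℓ t))
    have hprob := fun lam hl hl2 => corralCost_le_prob H hv (d t)
      (feedback P.G (action P (s t).corral (d t)) (ℓ t)) (lam := lam) hl hl2
    change _ ≤ spentByLength c (corralNext P (s t).corral (ℓ t) (d t)) - _ at hlen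
    change ∀ lam, _ → _ → _ ≤ _ + (spentByProb c lam (corralNext P (s t).corral (ℓ t) (d t)) - _)
      at hprob
    rw [hR, hcost, hp.succ t ht]
    rcases State.next_cases P (s t) (ℓ t) (d t) with ⟨y, -, hy1, -, h⟩ | ⟨-, h⟩
    · rw [h]
      have e : (CorralState.start y).rounds = 0 := rfl
      simp only [e, if_true]
      refine ⟨comp + cur + corralCost P (s t).corral, 0, 0, by linarith, ?_, ?_, ?_, ?_⟩
      · obtain ⟨g1, g2⟩ := hp.estimates H t (by omega)
        have g3 := (corralNext_estimates H hv g1 g2 (ℓ t) (d t)).2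
        have g4 : totalAbs P ℓ d s t + absEstimate P (s t).corral (ℓ t) (d t)
          = totalAbs P ℓ d s (t + 1) := (Finset.sum_range_succ _ _).symm
        rw [g4] at g3
        have g5 := spentByLength_le hc0 (hv.next H _ _) g3
        change _ ≤ _ * (((s t).corral.rounds + 1 : ℕ) : ℝ) ^ _ + _ at g5
        have g6 : 0 ≤ (s t).prevLength :=
          le_trans (mul_nonneg (by positivity) H.initLength_nonneg) (hp.lengths t (by omega)).2.1
        -- The finished length L is at least twice the previous p, so L^{2/3} ≤ 3 (L^{2/3} -
        -- p^{2/3}); this turns 20 into 60.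
        have g7 := mul_le_mul_of_nonneg_left (rpow_two_thirds_le_of_two_mul_le g6 hy1) hc3
        push_cast at g5 ⊢
        change spentByLength c (corralNext P (s t).corral (ℓ t) (d t)) ≤ _ at g5
        linarith
      · rw [spentByLength_start]
      · intro lam _ _
        rw [spentByProb_start]; simp
      · intro _
        refine Finset.sum_nonneg fun τ _ => ?_
        split_ifs
        · exact (baseProb_pos H _).le
        · exact le_rfl
    · rw [h]
      have e : (corralNext P (s t).corral (ℓ t) (d t)).rounds = (s t).corral.rounds + 1 := rfl
      simp only [e, Nat.succ_ne_zero, if_false, add_zero]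
      refine ⟨comp, cur + corralCost P (s t).corral, q + baseProb P (s t).corral, by linarith,
        by linarith, by linarith, ?_, ?_⟩
      · intro lam hl hl2
        have g1 := h4 lam hl hl2
        have g2 := hprob lam hl hl2
        linarith
      · intro hx
        have hx' : (s t).corral.xhat = x := hx
        rw [hmass, if_pos hx']
        linarith [h5 hx']

lemma IsPath.totalCost_le_length (H : IsTuned P c) (hp : IsPath P ℓ d s) :
    totalCost P s P.T ≤ 80 * (c ^ (1 / 3 : ℝ) * (P.T : ℝ) ^ (2 / 3 : ℝ))
      + (restarts s P.T + 1) * epochPrice c (totalAbs P ℓ d s P.T) := by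
  have hc0 : 0 < c := by linarith [H.c_ge]
  have hc3 : 0 ≤ c ^ (1 / 3 : ℝ) := by positivity
  obtain ⟨comp, cur, q, h1, h2, h3, -, -⟩ := hp.costs H ⟨0, by have := H.two_le; omega⟩ P.T le_rfl
  obtain ⟨g1, g2, g3⟩ := hp.lengths P.T le_rfl
  have hI := H.initLength_nonneg
  have hprev : 0 ≤ (s P.T).prevLength := le_trans (mul_nonneg (by positivity) hI) g2
  have h4 := spentByLength_le hc0 (hp.valid H P.T le_rfl) (hp.estimates H P.T le_rfl).2
  have h5 : ((s P.T).corral.rounds : ℝ) ^ (2 / 3 : ℝ) ≤ (P.T : ℝ) ^ (2 / 3 : ℝ) := by gcongr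
  have h6 : (s P.T).prevLength ^ (2 / 3 : ℝ) - initLength P ^ (2 / 3 : ℝ)
      ≤ (P.T : ℝ) ^ (2 / 3 : ℝ) := by
    have e1 : 0 ≤ initLength P ^ (2 / 3 : ℝ) := by positivity
    have e2 : 0 ≤ (P.T : ℝ) ^ (2 / 3 : ℝ) := by positivity
    rcases le_max_iff.1 g3 with h | h
    · have : (s P.T).prevLength ^ (2 / 3 : ℝ) ≤ (P.T : ℝ) ^ (2 / 3 : ℝ) := by gcongr
      linarith
    · have : (s P.T).prevLength ^ (2 / 3 : ℝ) ≤ initLength P ^ (2 / 3 : ℝ) := by gcongr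
      linarith
  have h7 := mul_le_mul_of_nonneg_left h5 hc3
  have h8 := mul_le_mul_of_nonneg_left h6 hc3
  linarith

lemma IsPath.totalCost_le_prob (H : IsTuned P c) (hp : IsPath P ℓ d s) (x : Fin K) {lam : ℝ}
    (hl : 0 < lam) (hl2 : lam ≤ 2) :
    totalCost P s P.T ≤ lam * (320 * missCount P x d s P.T + 35 * baseMass P x s P.T)
      + 160 * (lam * initLength P) + 60 * lam + 80 * (c / lam ^ 2)
      + 35 * c / lam ^ 2 * (2 + 2 * Real.log P.T
          + Real.log (4 + totalAbs P ℓ d s P.T / (4 * c)))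
      + (restarts s P.T + 1) * epochPrice c (totalAbs P ℓ d s P.T) := by
  have hc0 : 0 < c := by linarith [H.c_ge]
  have hc3 : 0 ≤ c ^ (1 / 3 : ℝ) := by positivity
  obtain ⟨comp, cur, q, h1, h2, h3, h4, h5⟩ := hp.costs H x P.T le_rfl
  obtain ⟨g1, g2, g3⟩ := hp.lengths P.T le_rfl
  obtain ⟨k1, k2, k3, k4, k5⟩ := hp.counts H x P.T le_rfl
  have hI := H.initLength_nonneg
  have hprev : 0 ≤ (s P.T).prevLength := le_trans (mul_nonneg (by positivity) hI) g2
  have hv := hp.valid H P.T le_rfl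
  have hm := (hp.estimates H P.T le_rfl).2
  have hW := totalAbs_nonneg P ℓ d s P.T
  have hN := missCount_nonneg (P := P) (d := d) (s := s) x P.T
  have hQ : 0 ≤ baseMass P x s P.T := by
    refine Finset.sum_nonneg fun τ _ => ?_
    split_ifs
    · exact (baseProb_pos H _).le
    · exact le_rfl
  have hpow : ∀ L : ℝ, 0 ≤ L → c ^ (1 / 3 : ℝ) * L ^ (2 / 3 : ℝ) ≤ lam * L + c / lam ^ 2 := by
    intro L hL
    have := sq_mul_le (a := L ^ (1 / 3 : ℝ)) (b := c ^ (1 / 3 : ℝ)) (by positivity) hc3 hl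
    rw [rpow_third_pow hL, rpow_third_pow hc0.le, ← rpow_two_thirds_eq hL] at this
    linarith
  have h6 := hpow _ hprev
  have h7 : 0 ≤ c ^ (1 / 3 : ℝ) * initLength P ^ (2 / 3 : ℝ) := by positivity
  have h8 : lam * (s P.T).prevLength ≤ lam * (4 * missCount P x d s P.T + 2 * initLength P + 1) :=
    mul_le_mul_of_nonneg_left k5 hl.le
  have h10 : 0 ≤ c / lam ^ 2 := by positivity
  have h11 := Real.log_natCast_nonneg P.T
  have h12 : 0 ≤ Real.log (4 + totalAbs P ℓ d s P.T / (4 * c)) := by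
    have : 0 ≤ totalAbs P ℓ d s P.T / (4 * c) := by positivity
    exact Real.log_nonneg (by linarith)
  have h13 : 0 ≤ 35 * c / lam ^ 2 * (2 + 2 * Real.log P.T
          + Real.log (4 + totalAbs P ℓ d s P.T / (4 * c))) := by positivity
  have h14 : 0 ≤ lam * missCount P x d s P.T := by positivity
  have h15 : 0 ≤ lam * baseMass P x s P.T := by positivity
  have h16 : 0 ≤ lam * initLength P := by positivity
  -- Only the last epoch can be long with few misses, and only if x is its candidate. That case uses
  -- the bound by update probabilities; in the other case the length itself is at most 4N + 2I.
  by_cases hx : (s P.T).corral.xhat = x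
  · have e1 := h4 lam hl hl2
    have e2 := spentByProb_le hc0 hv hW hl hm g1
    have e3 : lam * q ≤ lam * baseMass P x s P.T := mul_le_mul_of_nonneg_left (h5 hx) hl.le
    linarith
  · have e1 := spentByLength_le hc0 hv hm
    have e2 := hpow _ (Nat.cast_nonneg (s P.T).corral.rounds)
    have e3 := mul_le_mul_of_nonneg_left (k4 hx) hl.le
    linarith

end path
end
end GraphBandit
namespace GraphBandit
noncomputable section
variable {K : ℕ}
variable {P : Setup K} {c : ℝ}

/-! ### Bounds on the total cost in terms of the horizon -/

/-- The inverse of the distance of the comparator from the boundary of the simplex. -/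
def barrierScale (c : ℝ) (T : ℕ) : ℝ := 4 + T / (2 * c)

lemma four_le_barrierScale (hc : 0 < c) (T : ℕ) : 4 ≤ barrierScale c T := by
  unfold barrierScale
  have : (0 : ℝ) ≤ T / (2 * c) := by positivity
  linarith

lemma one_le_log_barrierScale (hc : 0 < c) (T : ℕ) : 1 ≤ Real.log (barrierScale c T) := by
  have h1 := Real.log_le_log (by norm_num) (four_le_barrierScale hc T)
  have h2 : Real.log 4 = 2 * Real.log 2 := by
    rw [show (4 : ℝ) = 2 ^ 2 by norm_num, Real.log_pow]; norm_num
  have := Real.log_two_gt_d9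
  linarith

/-- A tangent line in place of Jensen's inequality: it is linear in the random W, so expectations
can be taken after all pathwise products with numbers of restarts. -/
lemma log_add_div_le (hc : 0 < c) (T : ℕ) {W : ℝ} (hW : 0 ≤ W) :
    Real.log (4 + W / (4 * c))
      ≤ Real.log (barrierScale c T) + W / (4 * c * barrierScale c T) := by
  have h4 := four_le_barrierScale hc T
  have h0 : 0 ≤ W / (4 * c) := by positivity
  have h1 := Real.log_le_sub_one_of_pos
    (show 0 < (4 + W / (4 * c)) / barrierScale c T by positivity)
  rw [Real.log_div (by positivity) (by positivity), add_div, div_div] at h1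
  have h2 : 4 / barrierScale c T ≤ 1 := by rw [div_le_one (by linarith)]; exact h4
  linarith

lemma epochPrice_le (hc : 0 < c) (T : ℕ) {W : ℝ} (hW : 0 ≤ W) :
    epochPrice c W ≤ 18 * (c * Real.log (barrierScale c T)) + 5 / 2 * (W / barrierScale c T) := by
  have h1 := log_add_div_le hc T hW
  have h2 := one_le_log_barrierScale hc T
  have h3 := four_le_barrierScale hc T
  unfold epochPrice
  have h4 := mul_le_mul_of_nonneg_left h1 (show 0 ≤ 10 * c by linarith)
  have h5 : 10 * c * (W / (4 * c * barrierScale c T)) = 5 / 2 * (W / barrierScale c T) := by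
    have : barrierScale c T ≠ 0 := by linarith
    field_simp
    ring
  rw [mul_add, h5] at h4
  nlinarith

lemma succ_cube_le (R : ℕ) : ((R : ℝ) + 1) ^ 3 ≤ 16 * 2 ^ R := by
  have h : (R + 1) ^ 3 ≤ 16 * 2 ^ R := by
    induction R with
    | zero => norm_num
    | succ n ih =>
      rcases Nat.lt_or_ge n 3 with h | h
      · interval_cases n <;> norm_num
      · have : (n + 1 + 1) ^ 3 ≤ 2 * (n + 1) ^ 3 := by
          obtain ⟨m, rfl⟩ := Nat.exists_eq_add_of_le h
          nlinarith [Nat.zero_le (m ^ 3), Nat.zero_le (m ^ 2)]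
        rw [pow_succ 2]
        omega
  exact_mod_cast h

lemma IsTuned.initLength_ge (H : IsTuned P c) : c * Real.log P.T ≤ initLength P := by
  unfold initLength
  rw [H.c₃_eq]
  have h1 := Real.log_natCast_nonneg P.T
  have h2 := H.rpow_c_ge
  nlinarith

lemma IsTuned.initLength_le (H : IsTuned P c) : initLength P ≤ 2 * (c * Real.log P.T) := by
  unfold initLength
  rw [H.c₃_eq]
  have h1 := Real.log_natCast_nonneg P.T
  have h2 := H.rpow_c_le
  nlinarith

lemma log_natCast_ge {T : ℕ} (hT : 2 ≤ T) : (0.69 : ℝ) ≤ Real.log T := by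
  have h1 : Real.log 2 ≤ Real.log T := Real.log_le_log (by norm_num) (by exact_mod_cast hT)
  linarith [Real.log_two_gt_d9]

/-! ### Restarts and the two pathwise cost bounds -/

section path

variable {ℓ : ℕ → Fin K → ℝ} {d : ℕ → Draw K} {s : ℕ → State K}

lemma IsPath.restarts_le_rpow (H : IsTuned P c) (hp : IsPath P ℓ d s) (hT : c ≤ P.T) :
    (restarts s P.T : ℝ) + 1 ≤ 3 * ((P.T : ℝ) / c) ^ (1 / 3 : ℝ) := by
  have hc := H.c_ge
  have hc0 : 0 < c := by linarith
  have hT2 : 2 ≤ P.T := by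
    have : (2 : ℝ) ≤ P.T := by linarith
    exact_mod_cast this
  obtain ⟨-, g2, g3⟩ := hp.lengths P.T le_rfl
  have h1 := succ_cube_le (restarts s P.T)
  have h2 := H.initLength_ge
  have h3 := log_natCast_ge hT2
  have hI : 0.69 * c ≤ initLength P := by nlinarith
  have hI0 : 0 < initLength P := by linarith
  -- The constant 27/16 is what `succ_cube_le` needs for the final factor 3; it exceeds 1/0.69, the
  -- loss from log T ≥ 0.69.
  have h4 : (2 : ℝ) ^ restarts s P.T ≤ 27 / 16 * ((P.T : ℝ) / c) := by
    have h5 := g2.trans g3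
    rw [← mul_div_assoc, le_div_iff₀ hc0]
    rcases le_max_iff.1 h5 with h | h
    · have : (2 : ℝ) ^ restarts s P.T * (0.69 * c) ≤ P.T :=
        le_trans (mul_le_mul_of_nonneg_left hI (by positivity)) h
      linarith
    · have : (2 : ℝ) ^ restarts s P.T ≤ 1 := by
        by_contra hlt
        push Not at hlt
        nlinarith
      nlinarith
  have h6 : ((restarts s P.T : ℝ) + 1) ^ 3 ≤ (3 * ((P.T : ℝ) / c) ^ (1 / 3 : ℝ)) ^ 3 := by
    rw [mul_pow, rpow_third_pow (by positivity)]
    linarith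
  exact le_of_pow_le_pow_left₀ (by norm_num) (by positivity) h6

lemma IsPath.restarts_le_log (H : IsTuned P c) (hp : IsPath P ℓ d s) (hT : 2 ≤ P.T) :
    (restarts s P.T : ℝ) + 1 ≤ 3 * Real.log P.T := by
  have hc := H.c_ge
  obtain ⟨-, g2, g3⟩ := hp.lengths P.T le_rfl
  have h2 := H.initLength_ge
  have h3 := log_natCast_ge hT
  have hT0 : (2 : ℝ) ≤ P.T := by exact_mod_cast hT
  have hI : 1 ≤ initLength P := by nlinarith
  have h4 : (2 : ℝ) ^ restarts s P.T ≤ P.T := by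
    have h5 := g2.trans g3
    have hpos : (0 : ℝ) < 2 ^ restarts s P.T := by positivity
    rcases le_max_iff.1 h5 with h | h
    · nlinarith
    · have : (2 : ℝ) ^ restarts s P.T ≤ 1 := by
        by_contra hlt
        push Not at hlt
        nlinarith
      linarith
  have h6 := Real.log_le_log (by positivity) h4
  rw [Real.log_pow] at h6
  have h7 := Real.log_two_gt_d9
  have h8 : (restarts s P.T : ℝ) * 0.69 ≤ Real.log P.T :=
    le_trans (mul_le_mul_of_nonneg_left (by linarith) (Nat.cast_nonneg _)) h6
  linarith

/-- The total cost and the price of restarts, for the adversarial regime. -/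
lemma IsPath.cost_adversarial (H : IsTuned P c) (hp : IsPath P ℓ d s) (hT : c ≤ P.T) :
    totalCost P s P.T + 40 * (c * Real.log (barrierScale c P.T)) * (restarts s P.T + 1)
      ≤ 80 * (c ^ (1 / 3 : ℝ) * (P.T : ℝ) ^ (2 / 3 : ℝ))
        + 3 * ((P.T : ℝ) / c) ^ (1 / 3 : ℝ) * (58 * (c * Real.log (barrierScale c P.T))
          + 5 / 2 * (totalAbs P ℓ d s P.T / barrierScale c P.T)) := by
  have hc0 : 0 < c := by linarith [H.c_ge]
  have hW := totalAbs_nonneg P ℓ d s P.T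
  have h1 := hp.totalCost_le_length H
  have h2 := hp.restarts_le_rpow H hT
  have h3 := epochPrice_le hc0 P.T hW
  have h4 := one_le_log_barrierScale hc0 P.T
  have h5 := four_le_barrierScale hc0 P.T
  have h6 : 0 ≤ 58 * (c * Real.log (barrierScale c P.T))
          + 5 / 2 * (totalAbs P ℓ d s P.T / barrierScale c P.T) := by
    have : 0 ≤ Real.log (barrierScale c P.T) := by linarith
    positivity
  have h7 := mul_le_mul_of_nonneg_right h2 h6
  have h8 := mul_le_mul_of_nonneg_left h3 (show 0 ≤ (restarts s P.T : ℝ) + 1 by positivity)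
  linarith

/-- The total cost and the price of restarts, for the stochastic regime. -/
lemma IsPath.cost_stochastic (H : IsTuned P c) (hp : IsPath P ℓ d s) (hT : 2 ≤ P.T) (x : Fin K)
    {lam : ℝ} (hl : 0 < lam) (hl2 : lam ≤ 2) :
    totalCost P s P.T + 40 * (c * Real.log (barrierScale c P.T)) * (restarts s P.T + 1)
      ≤ 4032 * (lam * missCount P x d s P.T) + 35 * (lam * baseMass P x s P.T)
        + 42000 * (c * Real.log P.T / lam ^ 2)
        + (15 / 2 * Real.log P.T + 9 / lam ^ 2) * (totalAbs P ℓ d s P.T / barrierScale c P.T) := by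
  have hc := H.c_ge
  have hc0 : 0 < c := by linarith
  have hW := totalAbs_nonneg P ℓ d s P.T
  have h1 := hp.totalCost_le_prob H x hl hl2
  have h2 := hp.restarts_le_log H hT
  have h3 := epochPrice_le hc0 P.T hW
  have h4 := one_le_log_barrierScale hc0 P.T
  have h5 := four_le_barrierScale hc0 P.T
  have h6 := log_natCast_ge hT
  have hI1 := H.initLength_ge
  have hI2 := H.initLength_le
  have hlogρ : Real.log (barrierScale c P.T) ≤ 4 * Real.log P.T := by
    have hT0 : (2 : ℝ) ≤ P.T := by exact_mod_cast hT
    have e1 : barrierScale c P.T ≤ (P.T : ℝ) ^ 4 := by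
      unfold barrierScale
      have : (P.T : ℝ) / (2 * c) ≤ P.T := by
        rw [div_le_iff₀ (by linarith)]
        nlinarith
      nlinarith [pow_le_pow_left₀ (by norm_num) hT0 3]
    have e2 := Real.log_le_log (by linarith) e1
    rw [Real.log_pow] at e2
    exact_mod_cast e2
  have hlogW := log_add_div_le hc0 P.T hW
  obtain ⟨-, g2, -⟩ := hp.lengths P.T le_rfl
  obtain ⟨-, -, -, -, k5⟩ := hp.counts H x P.T le_rfl
  set ρ := barrierScale c P.T
  set W := totalAbs P ℓ d s P.T
  set N := missCount P x d s P.T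
  set Q := baseMass P x s P.T
  set R : ℝ := (restarts s P.T : ℝ) with hR
  set lg := Real.log P.T
  set I := initLength P
  have hlam3 : lam ^ 3 ≤ 8 := by
    have := pow_le_pow_left₀ hl.le hl2 3
    linarith
  set B := c * lg / lam ^ 2 with hB
  have hclg : 0 < c * lg := by nlinarith
  have hlB : lam * (c * lg) ≤ 8 * B := by
    rw [hB, ← mul_div_assoc, le_div_iff₀ (by positivity)]
    nlinarith
  have hl1 : lam ≤ 8 * B := by
    have e1 : 1 ≤ c * lg := by nlinarith
    have e2 := mul_le_mul_of_nonneg_left e1 hl.le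
    linarith
  have hcB : c / lam ^ 2 ≤ 2 * B := by
    rw [hB, ← mul_div_assoc]
    gcongr
    nlinarith
  have hlI : lam * I ≤ 16 * B := by nlinarith
  -- the price of the restarts
  have hR1 : R + 1 ≤ lam * (4 * 2 ^ restarts s P.T) + 1 / lam ^ 2 := by
    have e1 := sq_mul_le (a := (4 * 2 ^ restarts s P.T : ℝ) ^ (1 / 3 : ℝ)) (b := 1) (by positivity)
      zero_le_one hl
    rw [rpow_third_pow (by positivity), mul_one, one_pow] at e1
    refine le_trans ?_ e1
    have e2 := succ_cube_le (restarts s P.T)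
    -- Cubed, the claim is (R + 1)³ ≤ (4 · 2^R)², which `succ_cube_le` implies.
    refine le_of_pow_le_pow_left₀ (n := 3) (by norm_num) (by positivity) ?_
    rw [← pow_mul, mul_comm 2 3, pow_mul, rpow_third_pow (by positivity)]
    have e4 : (1 : ℝ) ≤ 2 ^ restarts s P.T := one_le_pow₀ (by norm_num)
    nlinarith
  have hR2 : (R + 1) * (c * lg) ≤ 4 * (lam * (s P.T).prevLength) + B := by
    have e1 := mul_le_mul_of_nonneg_right hR1 hclg.le
    have e2 : (2 : ℝ) ^ restarts s P.T * (c * lg) ≤ (s P.T).prevLength :=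
      le_trans (mul_le_mul_of_nonneg_left hI1 (by positivity)) g2
    -- Since the stored length is at least 2^R c log T, the exponential in R is paid for by this
    -- length and thus by misses.
    have e3 := mul_le_mul_of_nonneg_left e2 (show 0 ≤ 4 * lam by linarith)
    have e4 : (lam * (4 * 2 ^ restarts s P.T) + 1 / lam ^ 2) * (c * lg)
        = 4 * lam * (2 ^ restarts s P.T * (c * lg)) + B := by rw [hB]; ring
    rw [e4] at e1
    linarith
  have hR3 : lam * (s P.T).prevLength ≤ lam * (4 * N + 2 * I + 1) :=
    mul_le_mul_of_nonneg_left k5 hl.le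
  have hR4 : (R + 1) * (c * Real.log ρ) ≤ 4 * ((R + 1) * (c * lg)) := by
    have e1 : c * Real.log ρ ≤ 4 * (c * lg) := by nlinarith
    have := mul_le_mul_of_nonneg_left e1 (show 0 ≤ R + 1 by positivity)
    linarith
  have hR5 : (R + 1) * (W / ρ) ≤ 3 * lg * (W / ρ) :=
    mul_le_mul_of_nonneg_right h2 (by positivity)
  have hR6 := mul_le_mul_of_nonneg_left h3 (show 0 ≤ R + 1 by positivity)
  have hlogsum : 35 * c / lam ^ 2 * (2 + 2 * lg + Real.log (4 + W / (4 * c)))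
      ≤ 350 * B + 9 / lam ^ 2 * (W / ρ) := by
    have e1 : 2 + 2 * lg + Real.log (4 + W / (4 * c)) ≤ 10 * lg + W / (4 * c * ρ) := by linarith
    have e2 := mul_le_mul_of_nonneg_left e1 (show 0 ≤ 35 * c / lam ^ 2 by positivity)
    refine e2.trans ?_
    have e3 : 35 * c / lam ^ 2 * (10 * lg + W / (4 * c * ρ))
      = 350 * B + 35 / 4 / lam ^ 2 * (W / ρ) := by
      rw [hB]
      have : ρ ≠ 0 := by linarith
      field_simp
      ring
    rw [e3]
    have e4 : 0 ≤ W / ρ := by positivity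
    gcongr
    norm_num
  have hB0 : 0 < B := by positivity
  linarith

end path
end
end GraphBandit
namespace GraphBandit
noncomputable section
variable {K : ℕ}
variable {P : Setup K} {c : ℝ}

/-! ### Measurability -/

/-- Used whenever a random index (round number, candidate, draw) selects one of countably many
measurable functions. -/
lemma measurable_comp_countable {ι α β : Type*} [MeasurableSpace ι] [Countable ι]
    [MeasurableSingletonClass ι] {_ : MeasurableSpace α} [MeasurableSpace β] {F : ι → α → β}
    (hF : ∀ i, Measurable (F i)) {X : α → ι} (hX : Measurable X) :
    Measurable fun a => F (X a) a := by
  have h : Measurable fun p : α × ι => F p.2 p.1 := measurable_from_prod_countable_left hF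
  exact h.comp (measurable_id.prodMk hX)

instance : MeasurableSpace (Draw K) := ⊤

instance : DiscreteMeasurableSpace (Draw K) := ⟨fun _ => trivial⟩

/-- Pulling the product σ-algebra back along the tuple of fields reduces measurability to the
fields; likewise for the other memories. -/
instance : MeasurableSpace (Exp3State K) :=
  MeasurableSpace.comap (fun s => (s.cumLoss, s.sumInvSqrt, s.minProb)) inferInstance

instance : MeasurableSpace (CorralState K) :=
  MeasurableSpace.comap (fun s => (s.xhat, s.rounds, s.cumZ, s.sumInvSqrt, s.minProb, s.base))
    inferInstance

instance : MeasurableSpace (State K) :=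
  MeasurableSpace.comap (fun s => (s.corral, s.count, s.prevLength)) inferInstance

/-! ### Fields and constructors of the memories -/

section projections

lemma Exp3State.measurable_tuple :
    Measurable fun s : Exp3State K => (s.cumLoss, s.sumInvSqrt, s.minProb) := comap_measurable _

lemma Exp3State.measurable_cumLoss : Measurable fun s : Exp3State K => s.cumLoss :=
  measurable_tuple.fst

lemma Exp3State.measurable_sumInvSqrt : Measurable fun s : Exp3State K => s.sumInvSqrt :=
  measurable_tuple.snd.fst

lemma Exp3State.measurable_minProb : Measurable fun s : Exp3State K => s.minProb :=
  measurable_tuple.snd.snd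

lemma CorralState.measurable_tuple : Measurable fun s : CorralState K =>
    (s.xhat, s.rounds, s.cumZ, s.sumInvSqrt, s.minProb, s.base) := comap_measurable _

lemma CorralState.measurable_xhat : Measurable fun s : CorralState K => s.xhat :=
  measurable_tuple.fst

lemma CorralState.measurable_rounds : Measurable fun s : CorralState K => s.rounds :=
  measurable_tuple.snd.fst

lemma CorralState.measurable_cumZ (i : Fin 2) : Measurable fun s : CorralState K => s.cumZ i :=
  (measurable_pi_apply i).comp measurable_tuple.snd.snd.fst

lemma CorralState.measurable_sumInvSqrt : Measurable fun s : CorralState K => s.sumInvSqrt :=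
  measurable_tuple.snd.snd.snd.fst

lemma CorralState.measurable_minProb : Measurable fun s : CorralState K => s.minProb :=
  measurable_tuple.snd.snd.snd.snd.fst

lemma CorralState.measurable_base : Measurable fun s : CorralState K => s.base :=
  measurable_tuple.snd.snd.snd.snd.snd

lemma State.measurable_tuple : Measurable fun s : State K => (s.corral, s.count, s.prevLength) :=
  comap_measurable _

lemma State.measurable_corral : Measurable fun s : State K => s.corral := measurable_tuple.fst

lemma State.measurable_count : Measurable fun s : State K => s.count := measurable_tuple.snd.fst

lemma State.measurable_prevLength : Measurable fun s : State K => s.prevLength :=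
  measurable_tuple.snd.snd

variable {α : Type*} {mα : MeasurableSpace α}

lemma Exp3State.measurable_mk {L : α → Fin K → ℝ} {S m : α → ℝ} (hL : Measurable L)
    (hS : Measurable S) (hm : Measurable m) :
    Measurable fun a => (⟨L a, S a, m a⟩ : Exp3State K) :=
  measurable_comap_iff.2 (hL.prodMk (hS.prodMk hm))

lemma CorralState.measurable_mk {x : α → Fin K} {n : α → ℕ} {Z : α → Fin 2 → ℝ} {S m : α → ℝ}
    {b : α → Exp3State K} (hx : Measurable x) (hn : Measurable n) (hZ : Measurable Z)
    (hS : Measurable S) (hm : Measurable m) (hb : Measurable b) :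
    Measurable fun a => (⟨x a, n a, Z a, S a, m a, b a⟩ : CorralState K) :=
  measurable_comap_iff.2 (hx.prodMk (hn.prodMk (hZ.prodMk (hS.prodMk (hm.prodMk hb)))))

lemma State.measurable_mk {s : α → CorralState K} {N : α → Fin K → ℕ} {p : α → ℝ}
    (hs : Measurable s) (hN : Measurable N) (hp : Measurable p) :
    Measurable fun a => (⟨s a, N a, p a⟩ : State K) :=
  measurable_comap_iff.2 (hs.prodMk (hN.prodMk hp))

end projections

/-! ### Maps of the algorithm -/

section functions

open Exp3State CorralState

lemma measurable_exp3Eta (P : Setup K) : Measurable (exp3Eta P) := by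
  have h1 := Exp3State.measurable_sumInvSqrt (K := K)
  have h2 := Exp3State.measurable_minProb (K := K)
  unfold exp3Eta
  fun_prop

lemma measurable_partition (xhat : Fin K) :
    Measurable fun x : ℝ × (Fin K → ℝ) => partition xhat x.1 x.2 := by
  unfold partition
  fun_prop

lemma measurable_softmax (xhat i : Fin K) :
    Measurable fun x : ℝ × (Fin K → ℝ) => softmax xhat x.1 x.2 i := by
  have := measurable_partition xhat
  unfold softmax
  split_ifs
  · exact measurable_const
  · fun_prop

lemma measurable_exp3Potential (P : Setup K) (xhat u : Fin K) :
    Measurable (exp3Potential P xhat u) := by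
  have h1 := Exp3State.measurable_sumInvSqrt (K := K)
  have h2 := Exp3State.measurable_cumLoss (K := K)
  have h3 := measurable_exp3Eta P
  have h4 : Measurable fun s : Exp3State K => partition xhat (exp3Eta P s) s.cumLoss :=
    (measurable_partition xhat).comp (h3.prodMk h2)
  have h5 : Measurable fun s : Exp3State K => s.cumLoss u := (measurable_pi_apply u).comp h2
  unfold exp3Potential freeEnergy
  fun_prop

lemma measurable_bonus (P : Setup K) : Measurable (bonus P) := by
  have h1 := CorralState.measurable_sumInvSqrt (K := K)
  have h2 := CorralState.measurable_minProb (K := K)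
  unfold bonus
  refine Measurable.ite (measurable_rounds (MeasurableSet.of_discrete (s := {0}))) ?_ ?_ <;> fun_prop

lemma measurable_corralGap (P : Setup K) : Measurable (corralGap P) := by
  have h1 := measurable_cumZ (K := K)
  have h2 := measurable_bonus P
  unfold corralGap
  fun_prop

/-- For each fixed round number the leader is an antitone function of the gap, and the round number
is countable. -/
lemma measurable_corralLead (H : IsTuned P c) : Measurable (corralLead P) := by
  have hc : 0 < P.c₂ := by rw [H.c₂_eq]; linarith [H.c_ge]
  refine measurable_comp_countable
    (F := fun n s => lead (invRate P (n + 1)) P.c₂ (corralGap P s)) (fun n => ?_) measurable_rounds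
  exact (lead_antitone (by linarith [invRate_ge H (n + 1)]) hc).measurable.comp
    (measurable_corralGap P)

lemma measurable_corralGamma (H : IsTuned P c) : Measurable (corralGamma P) := by
  have hc : 0 < P.c₂ := by rw [H.c₂_eq]; linarith [H.c_ge]
  have h : corralGamma P = fun s => exploreProb (1 / invRate P (s.rounds + 1))
      (lead (invRate P (s.rounds + 1)) P.c₂ (corralGap P s)) := by
    ext s
    exact corralGamma_eq H s
  rw [h]
  refine measurable_comp_countable (F := fun n s => exploreProb (1 / invRate P (n + 1))
      (lead (invRate P (n + 1)) P.c₂ (corralGap P s))) (fun n => ?_) measurable_rounds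
  have hA := invRate_ge H (n + 1)
  have hanti : Antitone fun G => exploreProb (1 / invRate P (n + 1))
      (lead (invRate P (n + 1)) P.c₂ G) := fun G G' hG =>
    exploreProb_monotoneOn (by positivity) (lead_spec (by linarith) hc G').1.1
      (lead_spec (by linarith) hc G).1.1 (lead_antitone (by linarith) hc hG)
  exact hanti.measurable.comp (measurable_corralGap P)

lemma measurable_baseProb (H : IsTuned P c) : Measurable (baseProb P) := by
  have h1 := measurable_corralGamma H
  have h2 := measurable_corralLead H
  have h : baseProb P = fun s => (1 - corralGamma P s) * corralLead P s := by
    ext s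
    exact baseProb_eq H s
  rw [h]
  fun_prop

lemma measurable_nextBonus (H : IsTuned P c) : Measurable (nextBonus P) := by
  have h1 := measurable_baseProb H
  have h2 := CorralState.measurable_minProb (K := K)
  have h3 := CorralState.measurable_sumInvSqrt (K := K)
  unfold nextBonus
  fun_prop

lemma measurable_corralCost (H : IsTuned P c) : Measurable (corralCost P) := by
  have h1 := measurable_corralLead H
  have h2 := measurable_nextBonus H
  have h3 := measurable_bonus P
  have h4 : Measurable fun s : CorralState K => ((s.rounds + 1 : ℕ) : ℝ) :=
    (Measurable.of_discrete (f := fun n : ℕ => ((n + 1 : ℕ) : ℝ))).comp measurable_rounds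
  unfold corralCost
  fun_prop

lemma measurable_corralRegretPotential (H : IsTuned P c) (u : Fin K) (ε : ℝ) :
    Measurable (corralRegretPotential P u ε) := by
  have hc : 0 < P.c₂ := by rw [H.c₂_eq]; linarith [H.c_ge]
  have h1 := measurable_corralGap P
  have h2 := measurable_cumZ (K := K)
  have h3 : Measurable fun s : CorralState K => leadVal (invRate P s.rounds) P.c₂ (corralGap P s) := by
    refine measurable_comp_countable
      (F := fun n s => leadVal (invRate P n) P.c₂ (corralGap P s)) (fun n => ?_) measurable_rounds
    have h : Measurable fun s => lead (invRate P n) P.c₂ (corralGap P s) :=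
      (lead_antitone (show 0 ≤ invRate P n by linarith [invRate_ge H n]) hc).measurable.comp h1
    have hx : Measurable fun x : ℝ => hybridReg (invRate P n) P.c₂ x := by
      unfold hybridReg
      fun_prop
    have h' : Measurable fun s => hybridReg (invRate P n) P.c₂
        (lead (invRate P n) P.c₂ (corralGap P s)) := hx.comp h
    unfold leadVal
    fun_prop
  have h4 : Measurable fun s : CorralState K => if u = s.xhat then ε else 1 - ε :=
    (Measurable.of_discrete (f := fun x : Fin K => if u = x then ε else 1 - ε)).comp measurable_xhat
  have h5 : Measurable fun s : CorralState K =>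
      if u = s.xhat then 0 else exp3Potential P s.xhat u s.base := by
    have h : ∀ x : Fin K, Measurable fun s : CorralState K =>
        if u = x then (0 : ℝ) else exp3Potential P x u s.base := by
      intro x
      split_ifs
      · exact measurable_const
      · exact (measurable_exp3Potential P x u).comp measurable_base
    exact measurable_comp_countable h measurable_xhat
  exact (h3.sub (h4.mul ((h2 1).sub (h2 0)))).sub h5

/-- The memories of Corral that occur during a run, as a type. -/
abbrev ValidState (K : ℕ) : Type := {s : CorralState K // s.Valid}

/-- The restriction to valid memories is needed because only there the learning rate is known to be
positive and the chosen minimizer is the softmax. -/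
lemma measurable_exp3Prob (H : IsTuned P c) (a : Fin K) :
    Measurable fun s : ValidState K => exp3Prob P s.1.xhat s.1.base (baseProb P s.1) a := by
  classical
  have hq : Measurable fun s : ValidState K => baseProb P s.1 :=
    (measurable_baseProb H).comp measurable_subtype_coe
  have hb : Measurable fun s : ValidState K => s.1.base := measurable_base.comp measurable_subtype_coe
  have hx : Measurable fun s : ValidState K => s.1.xhat := measurable_xhat.comp measurable_subtype_coe
  have hS := Exp3State.measurable_sumInvSqrt.comp hb
  have hm := Exp3State.measurable_minProb.comp hb
  have hL := Exp3State.measurable_cumLoss.comp hb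
  have hη : Measurable fun s : ValidState K => exp3Eta P (s.1.base.receive (baseProb P s.1)) := by
    refine (measurable_exp3Eta P).comp (Exp3State.measurable_mk hL ?_ (hm.min hq))
    exact hS.add (measurable_const.div hq.sqrt)
  have hγ : Measurable fun s : ValidState K => exp3Gamma P s.1.base (baseProb P s.1) := by
    unfold exp3Gamma
    fun_prop
  have hsoft : Measurable fun s : ValidState K => softmax s.1.xhat
      (exp3Eta P (s.1.base.receive (baseProb P s.1))) s.1.base.cumLoss a :=
    measurable_comp_countable (F := fun x (s : ValidState K) => softmax x
      (exp3Eta P (s.1.base.receive (baseProb P s.1))) s.1.base.cumLoss a)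
      (fun x => (measurable_softmax x a).comp (hη.prodMk hL)) hx
  have h : (fun s : ValidState K => exp3Prob P s.1.xhat s.1.base (baseProb P s.1) a)
      = fun s => (1 - exp3Gamma P s.1.base (baseProb P s.1)) * softmax s.1.xhat
      (exp3Eta P (s.1.base.receive (baseProb P s.1))) s.1.base.cumLoss a
      + exp3Gamma P s.1.base (baseProb P s.1) * (if a ∈ P.D then 1 / (P.D.card : ℝ) else 0) := by
    ext s
    unfold exp3Prob
    rw [exp3Leader_eq H _ s.2.base (baseProb_pos H s.1)]
  rw [h]
  fun_prop

lemma measurable_drawProb (H : IsTuned P c) (d : Draw K) :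
    Measurable fun s : ValidState K => drawProb P s.1 d := by
  have h1 := measurable_exp3Prob H d.proposal
  have h2 : Measurable fun s : ValidState K => corralGamma P s.1 :=
    (measurable_corralGamma H).comp measurable_subtype_coe
  have h3 : Measurable fun s : ValidState K => corralLead P s.1 :=
    (measurable_corralLead H).comp measurable_subtype_coe
  unfold drawProb
  refine h1.mul ?_
  split_ifs
  · fun_prop
  · have h4 : Measurable fun s : ValidState K => corralLeader P s.1 d.index := by
      simp only [corralLeader_eq H]
      generalize d.index = i
      fin_cases i
      · simpa using h3.const_sub 1
      · simpa using h3
    fun_prop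

lemma measurable_target (d : Draw K) : Measurable fun s : CorralState K => target s d :=
  (Measurable.of_discrete (f := fun x : Fin K => if d.index = 0 then x else d.proposal)).comp
    measurable_xhat

lemma measurable_action (P : Setup K) (d : Draw K) :
    Measurable fun s : CorralState K => action P s d :=
  (Measurable.of_discrete (f := fun x : Fin K => if d.explore then P.rev x else x)).comp
    (measurable_target d)

lemma measurable_apply_loss {α : Type*} {mα : MeasurableSpace α} {X : α → Fin K}
    {L : α → Fin K → ℝ} (hX : Measurable X) (hL : Measurable L) : Measurable fun a => L a (X a) :=
  measurable_comp_countable (F := fun i a => L a i) (fun i => (measurable_pi_apply i).comp hL) hX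

lemma measurable_lossEstimate (H : IsTuned P c) (d : Draw K) (i : Fin 2) :
    Measurable fun x : CorralState K × (Fin K → ℝ) =>
      lossEstimate P x.1 d (feedback P.G (action P x.1 d) x.2) i := by
  simp only [lossEstimate_eq H]
  split_ifs
  · have h1 : Measurable fun x : CorralState K × (Fin K → ℝ) => x.2 (target x.1 d) :=
      measurable_apply_loss ((measurable_target d).comp measurable_fst) measurable_snd
    have h2 : Measurable fun x : CorralState K × (Fin K → ℝ) => corralGamma P x.1 :=
      (measurable_corralGamma H).comp measurable_fst
    fun_prop
  · exact measurable_const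

lemma measurable_absEstimate (H : IsTuned P c) (d : Draw K) :
    Measurable fun x : CorralState K × (Fin K → ℝ) => absEstimate P x.1 x.2 d := by
  have := measurable_lossEstimate H d
  unfold absEstimate
  fun_prop

lemma measurable_feedback (P : Setup K) (d : Draw K) (i : Fin K) :
    Measurable fun x : CorralState K × (Fin K → ℝ) => feedback P.G (action P x.1 d) x.2 i := by
  classical
  refine measurable_comp_countable (F := fun a (x : CorralState K × (Fin K → ℝ)) =>
    feedback P.G a x.2 i) (fun a => ?_) ((measurable_action P d).comp measurable_fst)
  unfold feedback
  split_ifs <;> fun_prop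

lemma measurable_exp3Estimate (H : IsTuned P c) (d : Draw K) (upd : Prop) (i : Fin K) :
    Measurable fun x : ValidState K × (Fin K → ℝ) =>
      exp3Estimate P x.1.1.xhat x.1.1.base (baseProb P x.1.1) d.proposal upd
        (feedback P.G (action P x.1.1 d) x.2) i := by
  classical
  have h1 : ∀ a, Measurable fun x : ValidState K × (Fin K → ℝ) =>
      exp3Prob P x.1.1.xhat x.1.1.base (baseProb P x.1.1) a := fun a =>
    (measurable_exp3Prob H a).comp measurable_fst
  have h2 : Measurable fun x : ValidState K × (Fin K → ℝ) => baseProb P x.1.1 :=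
    (measurable_baseProb H).comp (measurable_subtype_coe.comp measurable_fst)
  have h3 : Measurable fun x : ValidState K × (Fin K → ℝ) =>
      feedback P.G (action P x.1.1 d) x.2 i :=
    (measurable_feedback P d i).comp
      ((measurable_subtype_coe.comp measurable_fst).prodMk measurable_snd)
  unfold exp3Estimate
  split_ifs
  · fun_prop
  · exact measurable_const

lemma measurable_corralNext (H : IsTuned P c) (d : Draw K) :
    Measurable fun x : ValidState K × (Fin K → ℝ) => corralNext P x.1.1 x.2 d := by
  have h1 : Measurable fun x : ValidState K × (Fin K → ℝ) => x.1.1 :=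
    measurable_subtype_coe.comp measurable_fst
  have hq := (measurable_baseProb H).comp h1
  have hb := measurable_base.comp h1
  refine CorralState.measurable_mk (measurable_xhat.comp h1)
    ((Measurable.of_discrete (f := fun n : ℕ => n + 1)).comp (measurable_rounds.comp h1))
    (measurable_pi_lambda _ fun i => ((measurable_cumZ i).comp h1).add
      ((measurable_lossEstimate H d i).comp (h1.prodMk measurable_snd)))
    ((CorralState.measurable_sumInvSqrt.comp h1).add (measurable_const.div hq.sqrt))
    ((CorralState.measurable_minProb.comp h1).min hq) ?_
  refine Exp3State.measurable_mk (measurable_pi_lambda _ fun i => ?_)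
    ((Exp3State.measurable_sumInvSqrt.comp hb).add (measurable_const.div hq.sqrt))
    ((Exp3State.measurable_minProb.comp hb).min hq)
  exact ((measurable_pi_apply i).comp (Exp3State.measurable_cumLoss.comp hb)).add
    (measurable_exp3Estimate H d _ i)

lemma measurable_corralStart : Measurable (CorralState.start (K := K)) := Measurable.of_discrete

open scoped Classical in
/-- The choice of the next candidate as a function of the set of eligible arms. -/
def pickCandidate (x₀ : Fin K) (A : Set (Fin K)) : Fin K :=
  if h : ∃ x, x ∈ A then h.choose else x₀

/-- The arms that are eligible as next candidate. -/
def eligible (P : Setup K) (s : State K) (d : Draw K) : Set (Fin K) :=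
  {x | x ≠ s.corral.xhat ∧ ((s.corral.rounds + 1 : ℕ) : ℝ) / 2
    ≤ ((s.count x + if action P s.corral d = x then 1 else 0 : ℕ) : ℝ)}

-- The new candidate is exhibited as a function of the set of eligible arms alone. There are
-- finitely many such sets, so any choice rule is measurable.
open scoped Classical in
lemma State.next_eq (P : Setup K) (x₀ : Fin K) (s : State K) (ℓ : Fin K → ℝ) (d : Draw K) :
    s.next P ℓ d =
      if 2 * s.prevLength ≤ ((s.corral.rounds + 1 : ℕ) : ℝ) ∧ (eligible P s d).Nonempty then
        ⟨CorralState.start (pickCandidate x₀ (eligible P s d)), 0, ((s.corral.rounds + 1 : ℕ) : ℝ)⟩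
      else ⟨corralNext P s.corral ℓ d,
        fun x => s.count x + if action P s.corral d = x then 1 else 0, s.prevLength⟩ := by
  by_cases h : 2 * s.prevLength ≤ ((s.corral.rounds + 1 : ℕ) : ℝ) ∧ (eligible P s d).Nonempty
  · rw [if_pos h]
    have h2 : ∃ x, x ∈ eligible P s d := h.2
    unfold pickCandidate
    rw [dif_pos h2]
    exact dif_pos h
  · rw [if_neg h]
    exact dif_neg h

lemma measurable_eligible (P : Setup K) (d : Draw K) : Measurable fun s => eligible P s d := by
  refine measurable_set_iff.2 fun x => ?_
  have h1 : Measurable fun s : State K => (s.corral.xhat, s.corral.rounds, s.count x,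
      action P s.corral d) :=
    (measurable_xhat.comp State.measurable_corral).prodMk
      ((measurable_rounds.comp State.measurable_corral).prodMk
      (((measurable_pi_apply x).comp State.measurable_count).prodMk
        ((measurable_action P d).comp State.measurable_corral)))
  exact (Measurable.of_discrete (f := fun y : Fin K × ℕ × ℕ × Fin K => x ≠ y.1 ∧
    ((y.2.1 + 1 : ℕ) : ℝ) / 2 ≤ ((y.2.2.1 + if y.2.2.2 = x then 1 else 0 : ℕ) : ℝ))).comp h1

lemma measurable_next (H : IsTuned P c) (d : Draw K) :
    Measurable fun x : {s : State K // s.corral.Valid} × (Fin K → ℝ) => x.1.1.next P x.2 d := by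
  classical
  have x₀ : Fin K := ⟨0, by have := H.two_le; omega⟩
  have h1 : Measurable fun x : {s : State K // s.corral.Valid} × (Fin K → ℝ) => x.1.1 :=
    measurable_subtype_coe.comp measurable_fst
  have hc := State.measurable_corral.comp h1
  have hn : Measurable fun x : {s : State K // s.corral.Valid} × (Fin K → ℝ) =>
      ((x.1.1.corral.rounds + 1 : ℕ) : ℝ) :=
    (Measurable.of_discrete (f := fun n : ℕ => ((n + 1 : ℕ) : ℝ))).comp (measurable_rounds.comp hc)
  have hp := State.measurable_prevLength.comp h1
  have he := (measurable_eligible P d).comp h1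
  simp only [State.next_eq P x₀]
  refine Measurable.ite ?_ ?_ ?_
  · refine MeasurableSet.inter (measurableSet_le (measurable_const.mul hp) hn) ?_
    exact he (Set.Finite.measurableSet (Set.toFinite {A : Set (Fin K) | A.Nonempty}))
  · exact State.measurable_mk (measurable_corralStart.comp
      ((measurable_of_finite (pickCandidate x₀)).comp he)) measurable_const hn
  · refine State.measurable_mk ?_ (measurable_pi_lambda _ fun x => ?_) hp
    · have h2 : Measurable fun x : {s : State K // s.corral.Valid} × (Fin K → ℝ) =>
          (⟨x.1.1.corral, x.1.2⟩ : ValidState K) := hc.subtype_mk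
      exact (measurable_corralNext H d).comp (h2.prodMk measurable_snd)
    · refine ((measurable_pi_apply x).comp (State.measurable_count.comp h1)).add ?_
      exact (Measurable.of_discrete (f := fun y : Fin K => if y = x then 1 else 0)).comp
        ((measurable_action P d).comp hc)

end functions

end
end GraphBandit
namespace GraphBandit
noncomputable section
variable {K : ℕ}
variable {P : Setup K} {c : ℝ}

/-! ### Boundedness -/

/-- Quantitative bounds on a memory of Corral after at most `n` rounds. -/
structure CorralState.BoundedBy (n : ℕ) (B : ℝ) (s : CorralState K) : Prop where
  rounds_le : s.rounds ≤ n
  cumZ_le : |s.cumZ 0| + |s.cumZ 1| ≤ B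
  inv_le : 1 / s.minProb ≤ B
  cumLoss_le : ∀ i, |s.base.cumLoss i| ≤ B

lemma CorralState.BoundedBy.mono {n n' : ℕ} {B B' : ℝ} {s : CorralState K} (h : s.BoundedBy n B)
    (hn : n ≤ n') (hB : B ≤ B') : s.BoundedBy n' B' :=
  ⟨h.1.trans hn, h.2.trans hB, h.3.trans hB, fun i => (h.4 i).trans hB⟩

lemma CorralState.boundedBy_start (x : Fin K) (n : ℕ) : (CorralState.start x).BoundedBy n 1 := by
  constructor <;> simp [CorralState.start, Exp3State.start]

lemma invRate_mono (P : Setup K) : Monotone (invRate P) := monotone_nat_of_le_succ (invRate_le_succ P)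

lemma CorralState.BoundedBy.nonneg {n : ℕ} {B : ℝ} {s : CorralState K} (h : s.BoundedBy n B) :
    0 ≤ B := le_trans (by positivity) h.cumZ_le

lemma CorralState.BoundedBy.sum_le {n : ℕ} {B : ℝ} {s : CorralState K} (h : s.BoundedBy n B)
    (hs : s.Valid) : s.sumInvSqrt ≤ n * B := by
  refine hs.sum_le.trans ?_
  rw [div_eq_mul_one_div]
  have h1 : (s.rounds : ℝ) ≤ n := by exact_mod_cast h.rounds_le
  have := one_div_pos.2 hs.min_pos
  exact mul_le_mul h1 h.inv_le this.le (Nat.cast_nonneg _)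

lemma CorralState.BoundedBy.bonus_le (H : IsTuned P c) {n : ℕ} {B : ℝ} {s : CorralState K}
    (h : s.BoundedBy n B) (hs : s.Valid) :
    bonus P s ≤ c ^ (1 / 3 : ℝ) * (n * B) ^ (2 / 3 : ℝ) + c * B := by
  have hc := H.c_ge
  have hS : 0 ≤ s.sumInvSqrt := (Nat.cast_nonneg _).trans hs.rounds_le
  have hB := h.nonneg
  unfold bonus
  rw [H.c₁_eq, H.c₂_eq]
  split_ifs
  · positivity
  · rw [div_eq_mul_one_div c]
    have := h.sum_le hs
    have := h.inv_le
    gcongr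

lemma CorralState.BoundedBy.inv_exp3Eta_le (H : IsTuned P c) {n : ℕ} {B : ℝ} {s : CorralState K}
    (h : s.BoundedBy n B) (hs : s.Valid) : (exp3Eta P s.base)⁻¹
      ≤ (weakDomNumber P.G : ℝ) ^ (1 / 3 : ℝ) * (n * B) ^ (2 / 3 : ℝ)
      / (Real.log K ^ (1 / 3 : ℝ)) ^ 2 + 4 * weakDomNumber P.G * B := by
  rw [exp3Eta_inv H hs.base, hs.base_sum, hs.base_min, div_eq_mul_one_div _ s.minProb]
  have hS : 0 ≤ s.sumInvSqrt := (Nat.cast_nonneg _).trans hs.rounds_le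
  have h1 := h.sum_le hs
  have h2 := h.inv_le
  have h3 := H.log_pos
  gcongr

lemma one_div_corralGamma_le (H : IsTuned P c) (s : CorralState K) :
    1 / corralGamma P s ≤ invRate P (s.rounds + 1) * (1 / baseProb P s) := by
  have hγ := corralGamma_spec H s
  have hq := baseProb_pos H s
  have hA : 0 < invRate P (s.rounds + 1) := by linarith [invRate_ge H (s.rounds + 1)]
  have h1 : corralEta P s * baseProb P s ≤ corralGamma P s := by
    rw [hγ.2.2]
    refine le_max_of_le_right ?_
    have h2 := Real.rpow_le_rpow_of_exponent_ge hq (baseProb_le_one H s)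
      (show (1 / 3 : ℝ) ≤ 1 by norm_num)
    rw [Real.rpow_one] at h2
    exact mul_le_mul_of_nonneg_left h2 (corralEta_pos H s).le
  have h2 := one_div_le_one_div_of_le (mul_pos (corralEta_pos H s) hq) h1
  refine h2.trans (le_of_eq ?_)
  rw [corralEta_eq]
  field_simp

lemma absEstimate_le (H : IsTuned P c) (s : CorralState K) {ℓ : Fin K → ℝ}
    (hℓ : ∀ i, ℓ i ∈ Set.Icc (-1 : ℝ) 1) (d : Draw K) :
    absEstimate P s ℓ d ≤ if d.explore = true then 2 / corralGamma P s else 0 := by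
  have hγ := (corralGamma_spec H s).1
  have h : |2 * ℓ (target s d) / corralGamma P s| ≤ 2 / corralGamma P s := by
    rw [abs_div, abs_of_pos hγ, abs_mul, abs_two]
    have := abs_le.2 (hℓ (target s d))
    gcongr
    linarith
  have h0 : 0 ≤ 2 / corralGamma P s := by positivity
  unfold absEstimate
  simp only [lossEstimate_eq H, Fin.sum_univ_two]
  split_ifs <;> simp_all

/-- Qualitative only: bounded memories have update and exploration probabilities bounded away from
0, hence bounded estimates. The size of the bound is irrelevant; it serves integrability. -/
lemma exists_boundedBy_next (H : IsTuned P c) (n : ℕ) (B : ℝ) : ∃ B', ∀ s : CorralState K, s.Valid →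
    s.BoundedBy n B → ∀ ℓ : Fin K → ℝ, (∀ i, ℓ i ∈ Set.Icc (-1 : ℝ) 1) → ∀ d,
      (corralNext P s ℓ d).BoundedBy (n + 1) B' ∧ absEstimate P s ℓ d ≤ B' := by
  have hc : 0 < c := by linarith [H.c_ge]
  set b := B + (4 + B / (4 * c)) with hb
  set z := 2 * (invRate P (n + 1) * b) with hz
  set e := (weakDomNumber P.G : ℝ) ^ (1 / 3 : ℝ) * ((n + 1 : ℕ) * b) ^ (2 / 3 : ℝ)
      / (Real.log K ^ (1 / 3 : ℝ)) ^ 2 + 4 * weakDomNumber P.G * b with he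
  refine ⟨B + b + z + e, fun s hs hB ℓ hℓ d => ?_⟩
  have hB0 := hB.nonneg
  have h0 : 0 ≤ B / (4 * c) := by positivity
  have hb0 : 0 ≤ b := by positivity
  have hq := baseProb_pos H s
  have hq1 := one_div_baseProb_le H hs hB.cumZ_le
  have hqb : 1 / baseProb P s ≤ b := by linarith
  have hγ := (corralGamma_spec H s).1
  have hA := invRate_ge H (n + 1)
  have hlog := H.log_pos
  have hz0 : 0 ≤ z := by
    have : 0 ≤ invRate P (n + 1) := by linarith
    positivity
  have he0 : 0 ≤ e := by positivity
  have hγz : 2 / corralGamma P s ≤ z := by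
    have h1 := one_div_corralGamma_le H s
    have h2 : invRate P (s.rounds + 1) ≤ invRate P (n + 1) :=
      invRate_mono P (Nat.succ_le_succ hB.rounds_le)
    have h3 : invRate P (s.rounds + 1) * (1 / baseProb P s) ≤ invRate P (n + 1) * b :=
      mul_le_mul h2 hqb (one_div_pos.2 hq).le (by linarith)
    rw [hz]
    calc 2 / corralGamma P s = 2 * (1 / corralGamma P s) := by ring
      _ ≤ _ := by linarith
  have habs : absEstimate P s ℓ d ≤ z := by
    refine (absEstimate_le H s hℓ d).trans ?_
    split_ifs <;> linarith
  have hmin : 1 / (corralNext P s ℓ d).minProb ≤ b := by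
    change 1 / min s.minProb (baseProb P s) ≤ _
    have := hB.inv_le
    rcases min_choice s.minProb (baseProb P s) with h | h <;> rw [h] <;> linarith
  have hv : (corralNext P s ℓ d).Valid := hs.next H d _
  refine ⟨⟨Nat.succ_le_succ hB.rounds_le, ?_, by linarith, fun i => ?_⟩, by linarith⟩
  · have h2 := abs_add_le (s.cumZ 0) (lossEstimate P s d (feedback P.G (action P s d) ℓ) 0)
    have h3 := abs_add_le (s.cumZ 1) (lossEstimate P s d (feedback P.G (action P s d) ℓ) 1)
    unfold absEstimate at habs
    rw [Fin.sum_univ_two] at habs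
    have := hB.cumZ_le
    change |s.cumZ 0 + _| + |s.cumZ 1 + _| ≤ _
    linarith
  · have hη : (exp3Eta P (s.base.receive (baseProb P s)))⁻¹ ≤ e := by
      -- The learning rate of EXP3 depends only on ∑ q^{-1/2} and min q. Setting the losses to zero
      -- yields a bounded valid memory to which `inv_exp3Eta_le` applies before the new losses are
      -- bounded.
      set s' : CorralState K := ⟨s.xhat, s.rounds + 1, 0, (corralNext P s ℓ d).sumInvSqrt,
        (corralNext P s ℓ d).minProb, ⟨0, (corralNext P s ℓ d).base.sumInvSqrt,
          (corralNext P s ℓ d).base.minProb⟩⟩ with hs'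
      have hv' : s'.Valid := ⟨hv.1, hv.2, hv.3, hv.4, hv.5, hv.6, fun h => by simp [hs'] at h⟩
      have hb' : s'.BoundedBy (n + 1) b := ⟨Nat.succ_le_succ hB.rounds_le, by simpa [hs'] using hb0,
        hmin, fun i => by simpa [hs'] using hb0⟩
      exact hb'.inv_exp3Eta_le H hv'
    have hηpos := exp3Eta_pos H (hs.base.receive hq)
    have hest : |exp3Estimate P s.xhat s.base (baseProb P s) d.proposal
        (d.explore = false ∧ d.index = 1) (feedback P.G (action P s d) ℓ) i| ≤ e := by
      by_cases hu : d.explore = false ∧ d.index = 1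
      · have ha : action P s d = d.proposal := by
          simp [action, target, hu.1, hu.2]
        rw [ha, exp3Estimate_of_upd _ _ _ _ _ hu]
        have h1 := abs_eta_mul_iwEstimate_le H s.xhat hs.base hq hℓ d.proposal i
        rw [abs_mul, abs_of_pos hηpos] at h1
        refine le_trans ?_ hη
        rwa [← one_div, le_div_iff₀' hηpos]
      · rw [exp3Estimate_of_not_upd _ _ _ _ _ hu, abs_zero]
        exact he0
    have h1 := abs_add_le (s.base.cumLoss i) (exp3Estimate P s.xhat s.base (baseProb P s) d.proposal
        (d.explore = false ∧ d.index = 1) (feedback P.G (action P s d) ℓ) i)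
    have h2 := hB.cumLoss_le i
    change |s.base.cumLoss i + _| ≤ _
    linarith

lemma exists_abs_corralRegretPotential_le (H : IsTuned P c) (u : Fin K) {ε : ℝ} (hε : 0 < ε)
    (hε2 : ε ≤ 1 / 2) (n : ℕ) (B : ℝ) : ∃ B', ∀ s : CorralState K, s.Valid → s.BoundedBy n B →
      |corralRegretPotential P u ε s| ≤ B' := by
  have hc : 0 < c := by linarith [H.c_ge]
  set g := B + (c ^ (1 / 3 : ℝ) * (n * B) ^ (2 / 3 : ℝ) + c * B) with hg
  refine ⟨8 * c * Real.log (1 / (ε * (1 - ε))) + (g + 3 * invRate P n + B + (B + B)),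
    fun s hs hB => ?_⟩
  have hB0 := hB.nonneg
  have hc2 : 0 < P.c₂ := by rw [H.c₂_eq]; exact hc
  have hA := invRate_ge H s.rounds
  have hA2 : invRate P s.rounds ≤ invRate P n := invRate_mono P hB.rounds_le
  have hbonus := hB.bonus_le H hs
  have hb0 := bonus_nonneg H hs
  have hS : 0 ≤ s.sumInvSqrt := (Nat.cast_nonneg _).trans hs.rounds_le
  have hlog := H.log_pos
  have hG : |corralGap P s| ≤ g := by
    have h2 := hB.cumZ_le
    have h3 := abs_sub (s.cumZ 1) (s.cumZ 0)
    have h4 := abs_sub (s.cumZ 1 - s.cumZ 0) (bonus P s)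
    rw [abs_of_nonneg hb0] at h4
    unfold corralGap
    linarith
  have hZ : |s.cumZ 1 - s.cumZ 0| ≤ B := by
    have h2 := hB.cumZ_le
    have h3 := abs_sub (s.cumZ 1) (s.cumZ 0)
    linarith
  have hw : ∀ w : ℝ, 0 ≤ w → w ≤ 1 → w * (s.cumZ 1 - s.cumZ 0) ≤ B := by
    intro w h0 h1
    have := le_abs_self (s.cumZ 1 - s.cumZ 0)
    nlinarith
  have hV : exp3Potential P s.xhat u s.base ≤ B + B := by
    have h1 := abs_freeEnergy_le H.two_le s.xhat (exp3Eta_pos H hs.base) hB.cumLoss_le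
    have h2 := hB.cumLoss_le u
    have h3 := le_abs_self (s.base.cumLoss u)
    have h4 := le_abs_self (freeEnergy s.xhat (exp3Eta P s.base) s.base.cumLoss)
    have h5 : 0 ≤ 9 / 2 * ((weakDomNumber P.G : ℝ) ^ (1 / 3 : ℝ) * Real.log K ^ (1 / 3 : ℝ))
        * s.base.sumInvSqrt ^ (2 / 3 : ℝ) := by
      rw [hs.base_sum]
      positivity
    unfold exp3Potential
    linarith
  have hl := leadVal_ge (A := invRate P s.rounds) (by linarith) hc2 (corralGap P s)
  have hlow : -(g + 3 * invRate P n + B + (B + B)) ≤ corralRegretPotential P u ε s := by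
    unfold corralRegretPotential
    split_ifs
    · have := hw ε hε.le (by linarith)
      linarith
    · have := hw (1 - ε) (by linarith) (by linarith)
      linarith
  have hup := corralRegretPotential_le H u hε hε2 hs
  have hpos : 0 ≤ Real.log (1 / (ε * (1 - ε))) := by
    apply Real.log_nonneg
    rw [one_le_div (by nlinarith)]
    nlinarith
  have hpos2 : 0 ≤ 8 * c * Real.log (1 / (ε * (1 - ε))) := by positivity
  have hg0 : 0 ≤ g := le_trans (abs_nonneg _) hG
  rw [abs_le]
  constructor <;> linarith

lemma corralCost_nonneg (H : IsTuned P c) {s : CorralState K} (hs : s.Valid) :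
    0 ≤ corralCost P s := by
  have h1 := (corralLead_mem H s).1
  have h2 := nextBonus_sub_nonneg H hs
  unfold corralCost
  positivity

lemma exists_corralCost_le (H : IsTuned P c) (n : ℕ) (B : ℝ) :
    ∃ B', ∀ s : CorralState K, s.Valid → s.BoundedBy n B → corralCost P s ≤ B' := by
  obtain ⟨B₁, hB₁⟩ := exists_boundedBy_next H n B
  refine ⟨8 * (c ^ (1 / 3 : ℝ) * ((n + 1 : ℕ) * B₁) ^ (2 / 3 : ℝ) + c * B₁) + 19 + 2,
    fun s hs hB => ?_⟩
  have x₀ : Fin K := ⟨0, by have := H.two_le; omega⟩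
  have h1 := (hB₁ s hs hB 0 (fun i => by norm_num) ⟨x₀, false, 0⟩).1.bonus_le H (hs.next H _ _)
  rw [bonus_corralNext] at h1
  obtain ⟨h2, h3⟩ := corralLead_mem H s
  have h4 := bonus_nonneg H hs
  have h5 := nextBonus_sub_nonneg H hs
  have h6 : corralLead P s * (nextBonus P s - bonus P s) ≤ nextBonus P s := by nlinarith
  have h7 : ∀ p r : ℝ, 0 ≤ p → 0 ≤ r → corralLead P s ^ p / ((s.rounds + 1 : ℕ) : ℝ) ^ r ≤ 1 := by
    intro p r hp hr
    have e1 := Real.rpow_le_one h2.le h3.le hp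
    have e2 : (1 : ℝ) ≤ ((s.rounds + 1 : ℕ) : ℝ) ^ r :=
      Real.one_le_rpow (by push_cast; linarith [Nat.cast_nonneg (α := ℝ) s.rounds]) hr
    rw [div_le_one (by linarith)]
    linarith
  have h8 := h7 (2 / 3) (1 / 3) (by norm_num) (by norm_num)
  have h9 := h7 (1 / 3) (2 / 3) (by norm_num) (by norm_num)
  unfold corralCost
  linarith

end
end GraphBandit
namespace GraphBandit
noncomputable section
variable {K : ℕ}
variable {P : Setup K} {c : ℝ}

/-! ### Runs -/

section run

variable {Ω : Type*} {mΩ : MeasurableSpace Ω} {μ : Measure Ω} {ℱ : Filtration ℕ mΩ}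
  {ℓ : ℕ → Ω → Fin K → ℝ} {x₁ : Ω → Fin K} {d : ℕ → Ω → Draw K} {s : ℕ → Ω → State K}

lemma IsRun.isPath (hr : IsRun μ P ℱ ℓ x₁ d s) (ω : Ω) :
    IsPath P (fun t => ℓ t ω) (fun t => d t ω) (fun t => s t ω) :=
  ⟨⟨x₁ ω, hr.state_zero ω⟩, fun t ht => hr.state_succ t ht ω⟩

lemma IsRun.valid (hr : IsRun μ P ℱ ℓ x₁ d s) (H : IsTuned P c) {t : ℕ} (ht : t ≤ P.T) (ω : Ω) :
    (s t ω).corral.Valid := (hr.isPath ω).valid H t ht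

lemma IsRun.state_succ_eq (hr : IsRun μ P ℱ ℓ x₁ d s) {t : ℕ} (ht : t < P.T) (ω : Ω) :
    s (t + 1) ω = (s t ω).next P (ℓ t ω) (d t ω) := hr.state_succ t ht ω

lemma IsRun.measurable_draw (hr : IsRun μ P ℱ ℓ x₁ d s) {t : ℕ} (ht : t < P.T) :
    Measurable[ℱ (t + 1)] (d t) :=
  @measurable_to_countable' (Draw K) Ω _ _ (ℱ (t + 1)) (d t) fun e => hr.draw_measurable t ht e

lemma IsRun.measurable_state (hr : IsRun μ P ℱ ℓ x₁ d s) (H : IsTuned P c) :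
    ∀ t ≤ P.T, Measurable[ℱ t] (s t) := by
  intro t
  induction t with
  | zero =>
    intro _
    have : s 0 = fun ω => State.start P (x₁ ω) := funext hr.state_zero
    rw [this]
    exact (Measurable.of_discrete (f := State.start P)).comp hr.candidate_measurable
  | succ t ih =>
    intro ht
    have h1 : Measurable[ℱ (t + 1)] (s t) :=
      (ih (by omega)).mono (ℱ.mono (Nat.le_succ t)) le_rfl
    have h2 : Measurable[ℱ (t + 1)] fun ω => (((⟨s t ω, hr.valid H (by omega) ω⟩ :
        {s : State K // s.corral.Valid}), ℓ t ω) : {s : State K // s.corral.Valid} × (Fin K → ℝ)) :=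
      h1.subtype_mk.prodMk (hr.loss_measurable t ht)
    have h3 : s (t + 1) = fun ω => (s t ω).next P (ℓ t ω) (d t ω) :=
      funext fun ω => hr.state_succ_eq ht ω
    rw [h3]
    exact measurable_comp_countable (F := fun e ω => (s t ω).next P (ℓ t ω) e)
      (fun e => (measurable_next H e).comp h2) (hr.measurable_draw ht)

lemma IsRun.exists_boundedBy (hr : IsRun μ P ℱ ℓ x₁ d s) (H : IsTuned P c) :
    ∀ t ≤ P.T, ∃ B, ∀ ω, (s t ω).corral.BoundedBy t B := by
  intro t
  induction t with
  | zero =>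
    intro _
    exact ⟨1, fun ω => by rw [hr.state_zero]; exact CorralState.boundedBy_start _ _⟩
  | succ t ih =>
    intro ht
    obtain ⟨B, hB⟩ := ih (by omega)
    obtain ⟨B', hB'⟩ := exists_boundedBy_next H t B
    refine ⟨max 1 B', fun ω => ?_⟩
    rw [hr.state_succ_eq ht]
    rcases State.next_cases P (s t ω) (ℓ t ω) (d t ω) with ⟨x, -, -, -, h⟩ | ⟨-, h⟩
    · rw [h]
      exact (CorralState.boundedBy_start x _).mono le_rfl (le_max_left _ _)
    · rw [h]
      exact (hB' _ (hr.valid H (by omega) ω) (hB ω) _ (hr.loss_bounded t ht ω) _).1.mono le_rfl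
        (le_max_right _ _)

/-- The information that determines the law of the draw in round `t`. -/
abbrev roundInfo (ℱ : Filtration ℕ mΩ) (ℓ : ℕ → Ω → Fin K → ℝ) (t : ℕ) : MeasurableSpace Ω :=
  ℱ t ⊔ MeasurableSpace.comap (ℓ t) inferInstance

lemma IsRun.roundInfo_le (hr : IsRun μ P ℱ ℓ x₁ d s) {t : ℕ} (ht : t < P.T) :
    roundInfo ℱ ℓ t ≤ mΩ :=
  sup_le (ℱ.le t) ((hr.loss_measurable t ht).mono (ℱ.le _) le_rfl).comap_le

lemma measurable_loss_roundInfo (ℱ : Filtration ℕ mΩ) (ℓ : ℕ → Ω → Fin K → ℝ) (t : ℕ) :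
    Measurable[roundInfo ℱ ℓ t] (ℓ t) :=
  (comap_measurable (ℓ t)).mono le_sup_right le_rfl

lemma IsRun.measurable_corral (hr : IsRun μ P ℱ ℓ x₁ d s) (H : IsTuned P c) {t : ℕ} (ht : t < P.T) :
    Measurable[ℱ t] fun ω => (s t ω).corral :=
  State.measurable_corral.comp (hr.measurable_state H t ht.le)

lemma IsRun.measurable_validState (hr : IsRun μ P ℱ ℓ x₁ d s) (H : IsTuned P c) {t : ℕ}
    (ht : t < P.T) :
    Measurable[ℱ t] fun ω => (⟨(s t ω).corral, hr.valid H ht.le ω⟩ : ValidState K) :=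
  (hr.measurable_corral H ht).subtype_mk

lemma IsRun.measurable_pair (hr : IsRun μ P ℱ ℓ x₁ d s) (H : IsTuned P c) {t : ℕ} (ht : t < P.T) :
    Measurable[roundInfo ℱ ℓ t] fun ω =>
      (((⟨(s t ω).corral, hr.valid H ht.le ω⟩ : ValidState K), ℓ t ω) :
        ValidState K × (Fin K → ℝ)) :=
  ((hr.measurable_validState H ht).mono le_sup_left le_rfl).prodMk (measurable_loss_roundInfo ℱ ℓ t)

lemma IsRun.measurable_pair' (hr : IsRun μ P ℱ ℓ x₁ d s) (H : IsTuned P c) {t : ℕ} (ht : t < P.T) :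
    Measurable[roundInfo ℱ ℓ t] fun ω =>
      (((s t ω).corral, ℓ t ω) : CorralState K × (Fin K → ℝ)) :=
  ((hr.measurable_corral H ht).mono le_sup_left le_rfl).prodMk (measurable_loss_roundInfo ℱ ℓ t)

lemma integrable_of_bounded [IsProbabilityMeasure μ] {f : Ω → ℝ} (hf : Measurable f) (B : ℝ)
    (hB : ∀ ω, |f ω| ≤ B) : Integrable f μ :=
  Integrable.of_bound hf.aestronglyMeasurable B (Filter.Eventually.of_forall hB)

/-- The expectation over the draw of a round. -/
lemma IsRun.integral_draw [IsProbabilityMeasure μ] (hr : IsRun μ P ℱ ℓ x₁ d s) (H : IsTuned P c)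
    {t : ℕ} (ht : t < P.T) {f : Draw K → Ω → ℝ} (hf : ∀ e, Measurable[roundInfo ℱ ℓ t] (f e))
    (B : ℝ) (hB : ∀ e ω, |f e ω| ≤ B) :
    Integrable (fun ω => f (d t ω) ω) μ ∧
      Integrable (fun ω => ∑ e, drawProb P (s t ω).corral e * f e ω) μ ∧
      ∫ ω, f (d t ω) ω ∂μ = ∫ ω, ∑ e, drawProb P (s t ω).corral e * f e ω ∂μ := by
  classical
  have hle := hr.roundInfo_le ht
  have hf' : ∀ e, Measurable (f e) := fun e => (hf e).mono hle le_rfl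
  have hd : Measurable (d t) := (hr.measurable_draw ht).mono (ℱ.le _) le_rfl
  have hp : ∀ e, Measurable fun ω => drawProb P (s t ω).corral e := fun e =>
    ((measurable_drawProb H e).comp (hr.measurable_validState H ht)).mono (ℱ.le _) le_rfl
  -- Splitting by the finitely many values of the draw separates the known factor f e from the
  -- random indicator.
  have hsum : (fun ω => f (d t ω) ω)
      = fun ω => ∑ e, f e ω * Set.indicator {ω | d t ω = e} (fun _ => (1 : ℝ)) ω := by
    ext ω
    simp [Set.indicator_apply]
  have hset : ∀ e, MeasurableSet {ω | d t ω = e} := fun e => hd (MeasurableSet.singleton e)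
  have hind : ∀ e, Integrable (Set.indicator {ω | d t ω = e} (fun _ => (1 : ℝ))) μ := fun e =>
    (integrable_const 1).indicator (hset e)
  have hterm : ∀ e, Integrable (f e * Set.indicator {ω | d t ω = e} (fun _ => (1 : ℝ))) μ := by
    intro e
    refine integrable_of_bounded ((hf' e).mul (measurable_const.indicator (hset e))) B fun ω => ?_
    have := hB e ω
    by_cases h : d t ω = e
    · simpa [Set.indicator_apply, h] using this
    · simpa [Set.indicator_apply, h] using (abs_nonneg _).trans this
  have hterm' : ∀ e, Integrable
      (fun ω => f e ω * Set.indicator {ω | d t ω = e} (fun _ => (1 : ℝ)) ω) μ := hterm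
  have hterm2 : ∀ e, Integrable (fun ω => drawProb P (s t ω).corral e * f e ω) μ := by
    intro e
    refine integrable_of_bounded ((hp e).mul (hf' e)) B fun ω => ?_
    have hs := hr.valid H ht.le ω
    have h0 := drawProb_nonneg H hs e
    have h1 : drawProb P (s t ω).corral e ≤ 1 := by
      rw [← sum_drawProb H hs]
      exact Finset.single_le_sum (f := drawProb P (s t ω).corral)
        (fun e _ => drawProb_nonneg H hs e) (Finset.mem_univ e)
    rw [abs_mul, abs_of_nonneg h0]
    have := hB e ω
    have := abs_nonneg (f e ω)
    nlinarith
  refine ⟨by rw [hsum]; exact integrable_finsetSum _ fun e _ => hterm' e,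
    integrable_finsetSum _ fun e _ => hterm2 e, ?_⟩
  rw [hsum, integral_finsetSum _ fun e _ => hterm' e, integral_finsetSum _ fun e _ => hterm2 e]
  refine Finset.sum_congr rfl fun e _ => ?_
  -- The known factor is pulled out of the conditional expectation, which the prescribed law of the
  -- draw then evaluates.
  have h1 : μ[f e * Set.indicator {ω | d t ω = e} (fun _ => (1 : ℝ)) | roundInfo ℱ ℓ t]
      =ᵐ[μ] fun ω => drawProb P (s t ω).corral e * f e ω := by
    have h2 := condExp_mul_of_stronglyMeasurable_left (μ := μ) (m := roundInfo ℱ ℓ t)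
      (hf e).stronglyMeasurable (hterm e) (hind e)
    filter_upwards [h2, hr.draw_law t ht e] with ω h3 h4
    rw [h3, Pi.mul_apply, mul_comm]
    exact congrArg (· * f e ω) h4
  have h2 := integral_condExp (μ := μ)
    (f := f e * Set.indicator {ω | d t ω = e} (fun _ => (1 : ℝ))) hle
  exact h2.symm.trans (integral_congr_ae h1)

end run
end
end GraphBandit
namespace GraphBandit
noncomputable section
variable {K : ℕ}
variable {P : Setup K} {c : ℝ}

/-! ### The expected regret -/

lemma log_comparator_le {ρ : ℝ} (hρ : 4 ≤ ρ) :
    Real.log (1 / (1 / ρ * (1 - 1 / ρ))) ≤ 2 * Real.log ρ := by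
  have h1 : 1 / (1 / ρ * (1 - 1 / ρ)) ≤ ρ ^ 2 := by
    have h2 : 1 / ρ * (1 - 1 / ρ) = (ρ - 1) / ρ ^ 2 := by field_simp
    rw [h2, one_div_div, div_le_iff₀ (by linarith)]
    nlinarith [sq_nonneg ρ]
  have h3 : 1 / ρ < 1 := by rw [div_lt_one (by linarith)]; linarith
  have h4 : 0 < 1 / ρ := by positivity
  have := Real.log_le_log (one_div_pos.2 (mul_pos h4 (by linarith))) h1
  rwa [Real.log_pow, Nat.cast_ofNat] at this

lemma div_barrierScale_le (hc : 0 < c) (T : ℕ) : (T : ℝ) / barrierScale c T ≤ 2 * c := by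
  have h := four_le_barrierScale hc T
  rw [div_le_iff₀ (by linarith)]
  unfold barrierScale
  have : 2 * c * (T / (2 * c)) = (T : ℝ) := by field_simp
  rw [mul_add, this]
  linarith

/-- The potential with the comparator that is used for the whole run. -/
def runPotential (P : Setup K) (c : ℝ) (u : Fin K) (s : CorralState K) : ℝ :=
  corralRegretPotential P u (1 / barrierScale c P.T) s

lemma comparator_mem (hc : 0 < c) (T : ℕ) :
    0 < 1 / barrierScale c T ∧ 1 / barrierScale c T ≤ 1 / 2 := by
  have h := four_le_barrierScale hc T
  refine ⟨by positivity, ?_⟩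
  rw [div_le_div_iff₀ (by linarith) (by norm_num)]
  linarith

lemma runPotential_le (H : IsTuned P c) (u : Fin K) {s : CorralState K} (hs : s.Valid) :
    runPotential P c u s ≤ 16 * (c * Real.log (barrierScale c P.T)) := by
  have hc : 0 < c := by linarith [H.c_ge]
  obtain ⟨h1, h2⟩ := comparator_mem hc P.T
  have h3 := corralRegretPotential_le H u h1 h2 hs
  have h4 := log_comparator_le (four_le_barrierScale hc P.T)
  unfold runPotential
  nlinarith

lemma runPotential_start (H : IsTuned P c) (u x : Fin K) :
    -(24 * (c * Real.log (barrierScale c P.T))) ≤ runPotential P c u (CorralState.start x) := by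
  have hc : 0 < c := by linarith [H.c_ge]
  have h1 := corralRegretPotential_start H u x (1 / barrierScale c P.T)
  have h2 := H.rpow_c_le
  have h3 := one_le_log_barrierScale hc P.T
  unfold runPotential
  nlinarith

/-- At a restart the potential falls from at most 16 c log ρ to at least -24 c log ρ; otherwise
nothing is lost. -/
lemma runPotential_corralNext_le (H : IsTuned P c) (u : Fin K) {s : State K} (hs : s.corral.Valid)
    (ℓ : Fin K → ℝ) (d : Draw K) : runPotential P c u (corralNext P s.corral ℓ d)
      ≤ runPotential P c u (s.next P ℓ d).corral
        + 40 * (c * Real.log (barrierScale c P.T))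
          * (if (s.next P ℓ d).corral.rounds = 0 then 1 else 0) := by
  rcases State.next_cases P s ℓ d with ⟨x, -, -, -, h⟩ | ⟨-, h⟩
  · rw [h]
    have h1 := runPotential_le H u (s := corralNext P s.corral ℓ d) (hs.next H _ _)
    have h2 := runPotential_start H u x
    have e : (CorralState.start x).rounds = 0 := rfl
    simp only [e, if_true]
    linarith
  · rw [h]
    have e : (corralNext P s.corral ℓ d).rounds = s.corral.rounds + 1 := rfl
    simp [e]

/-- Estimates of size at most 2/γ occur only with probability γ. -/
lemma sum_drawProb_absEstimate_le (H : IsTuned P c) {s : CorralState K} (hs : s.Valid)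
    {ℓ : Fin K → ℝ} (hℓ : ∀ i, ℓ i ∈ Set.Icc (-1 : ℝ) 1) :
    ∑ e, drawProb P s e * absEstimate P s ℓ e ≤ 2 := by
  have hγ := (corralGamma_spec H s).1
  refine (Finset.sum_le_sum fun e _ => mul_le_mul_of_nonneg_left
    (absEstimate_le H _ hℓ e) (drawProb_nonneg H hs e)).trans (le_of_eq ?_)
  rw [sum_drawProb_mul H]
  simp only [if_true, Bool.false_eq_true, if_false, mul_zero, add_zero]
  rw [← Finset.sum_mul, sum_exp3Prob H _ hs.base (baseProb_pos H _)]
  field_simp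
  norm_num

/-! ### Integration along a run -/

section run

variable {Ω : Type*} {mΩ : MeasurableSpace Ω} {μ : Measure Ω} {ℱ : Filtration ℕ mΩ}
  {ℓ : ℕ → Ω → Fin K → ℝ} {x₁ : Ω → Fin K} {d : ℕ → Ω → Draw K} {s : ℕ → Ω → State K}

lemma abs_sub_le_two {x : Fin K → ℝ} (hx : ∀ i, x i ∈ Set.Icc (-1 : ℝ) 1) (i j : Fin K) :
    |x i - x j| ≤ 2 := by
  have h1 := hx i
  have h2 := hx j
  rw [abs_le]
  constructor <;> linarith [h1.1, h1.2, h2.1, h2.2]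

lemma IsRun.measurable_action_loss (H : IsTuned P c) (hr : IsRun μ P ℱ ℓ x₁ d s)
    {t : ℕ} (ht : t < P.T) (e : Draw K) :
    Measurable[roundInfo ℱ ℓ t] fun ω => ℓ t ω (action P (s t ω).corral e) := by
  have h : Measurable fun x : CorralState K × (Fin K → ℝ) => x.2 (action P x.1 e) :=
    measurable_apply_loss ((measurable_action P e).comp measurable_fst) measurable_snd
  exact h.comp (hr.measurable_pair' H ht)

lemma measurable_loss_apply (ℱ : Filtration ℕ mΩ) (ℓ : ℕ → Ω → Fin K → ℝ) (t : ℕ) (u : Fin K) :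
    Measurable[roundInfo ℱ ℓ t] fun ω => ℓ t ω u :=
  (measurable_pi_apply u).comp (measurable_loss_roundInfo ℱ ℓ t)

lemma IsRun.measurable_absEstimate (hr : IsRun μ P ℱ ℓ x₁ d s) (H : IsTuned P c)
    {t : ℕ} (ht : t < P.T) (e : Draw K) : Measurable[roundInfo ℱ ℓ t]
      fun ω => absEstimate P (s t ω).corral (ℓ t ω) e := by
  have h := (GraphBandit.measurable_absEstimate H e).comp (hr.measurable_pair' H ht)
  exact h

variable [IsProbabilityMeasure μ]

lemma integral_const_add_mul {f : Ω → ℝ} (hf : Integrable f μ) (a b : ℝ) :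
    ∫ ω, (a + b * f ω) ∂μ = a + b * ∫ ω, f ω ∂μ := by
  rw [integral_add (integrable_const _) (hf.const_mul _), integral_const_mul, integral_const,
    probReal_univ, one_smul]

lemma integral_le_const {f : Ω → ℝ} (hf : Integrable f μ) {a : ℝ} (h : ∀ ω, f ω ≤ a) :
    ∫ ω, f ω ∂μ ≤ a := by
  have := integral_mono hf (integrable_const a) h
  rwa [integral_const, probReal_univ, one_smul] at this

lemma const_le_integral {f : Ω → ℝ} (hf : Integrable f μ) {a : ℝ} (h : ∀ ω, a ≤ f ω) :
    a ≤ ∫ ω, f ω ∂μ := by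
  have := integral_mono (integrable_const a) hf h
  rwa [integral_const, probReal_univ, one_smul] at this

lemma IsRun.integrable_runPotential (hr : IsRun μ P ℱ ℓ x₁ d s) (H : IsTuned P c) (u : Fin K)
    {t : ℕ} (ht : t ≤ P.T) : Integrable (fun ω => runPotential P c u (s t ω).corral) μ := by
  obtain ⟨h1, h2⟩ := comparator_mem (show 0 < c by linarith [H.c_ge]) P.T
  obtain ⟨B, hB⟩ := hr.exists_boundedBy H t ht
  obtain ⟨B', hB'⟩ := exists_abs_corralRegretPotential_le H u h1 h2 t B
  refine integrable_of_bounded ?_ B' fun ω => hB' _ (hr.valid H ht ω) (hB ω)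
  exact (measurable_corralRegretPotential H u _).comp (State.measurable_corral.comp
    ((hr.measurable_state H t ht).mono (ℱ.le _) le_rfl))

lemma IsRun.integrable_corralCost (hr : IsRun μ P ℱ ℓ x₁ d s) (H : IsTuned P c)
    {t : ℕ} (ht : t ≤ P.T) : Integrable (fun ω => corralCost P (s t ω).corral) μ := by
  obtain ⟨B, hB⟩ := hr.exists_boundedBy H t ht
  obtain ⟨B', hB'⟩ := exists_corralCost_le H t B
  refine integrable_of_bounded ?_ B' fun ω => ?_
  · exact (measurable_corralCost H).comp (State.measurable_corral.comp
      ((hr.measurable_state H t ht).mono (ℱ.le _) le_rfl))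
  · rw [abs_of_nonneg (corralCost_nonneg H (hr.valid H ht ω))]
    exact hB' _ (hr.valid H ht ω) (hB ω)

lemma IsRun.integrable_restart (hr : IsRun μ P ℱ ℓ x₁ d s) (H : IsTuned P c)
    {t : ℕ} (ht : t ≤ P.T) :
    Integrable (fun ω => if (s t ω).corral.rounds = 0 then (1 : ℝ) else 0) μ := by
  refine integrable_of_bounded ?_ 1 fun ω => by split_ifs <;> simp
  exact (Measurable.of_discrete (f := fun n : ℕ => if n = 0 then (1 : ℝ) else 0)).comp
    (CorralState.measurable_rounds.comp (State.measurable_corral.comp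
      ((hr.measurable_state H t ht).mono (ℱ.le _) le_rfl)))

lemma IsRun.integrable_regret (hr : IsRun μ P ℱ ℓ x₁ d s) (H : IsTuned P c)
    {t : ℕ} (ht : t < P.T) (u : Fin K) :
    Integrable (fun ω => ℓ t ω (action P (s t ω).corral (d t ω)) - ℓ t ω u) μ :=
  (hr.integral_draw H ht (f := fun e ω => ℓ t ω (action P (s t ω).corral e) - ℓ t ω u)
    (fun e => (hr.measurable_action_loss H ht e).sub (measurable_loss_apply ℱ ℓ t u)) 2
    fun _ ω => abs_sub_le_two (hr.loss_bounded t ht ω) _ _).1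

lemma IsRun.integral_regret_le (hr : IsRun μ P ℱ ℓ x₁ d s) (H : IsTuned P c)
    {t : ℕ} (ht : t < P.T) (u : Fin K) :
    ∫ ω, (ℓ t ω (action P (s t ω).corral (d t ω)) - ℓ t ω u) ∂μ
      ≤ ∫ ω, runPotential P c u (s (t + 1) ω).corral ∂μ
        - ∫ ω, runPotential P c u (s t ω).corral ∂μ + ∫ ω, corralCost P (s t ω).corral ∂μ
        + 40 * (c * Real.log (barrierScale c P.T))
          * ∫ ω, (if (s (t + 1) ω).corral.rounds = 0 then (1 : ℝ) else 0) ∂μ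
        + 2 / barrierScale c P.T := by
  obtain ⟨hε, hε2⟩ := comparator_mem (show 0 < c by linarith [H.c_ge]) P.T
  obtain ⟨-, i1, e1⟩ := hr.integral_draw H ht
    (f := fun e ω => ℓ t ω (action P (s t ω).corral e) - ℓ t ω u)
    (fun e => (hr.measurable_action_loss H ht e).sub (measurable_loss_apply ℱ ℓ t u)) 2
    fun _ ω => abs_sub_le_two (hr.loss_bounded t ht ω) _ _
  obtain ⟨B, hB⟩ := hr.exists_boundedBy H t ht.le
  obtain ⟨B₁, hB₁⟩ := exists_boundedBy_next H t B
  obtain ⟨B₂, hB₂⟩ := exists_abs_corralRegretPotential_le H u hε hε2 (t + 1) B₁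
  obtain ⟨i2, i3, e2⟩ := hr.integral_draw H ht
    (f := fun e ω => runPotential P c u (corralNext P (s t ω).corral (ℓ t ω) e))
    (fun e => (measurable_corralRegretPotential H u _).comp
      ((measurable_corralNext H e).comp (hr.measurable_pair H ht))) B₂
    fun _ ω => hB₂ _ ((hr.valid H ht.le ω).next H _ _)
      (hB₁ _ (hr.valid H ht.le ω) (hB ω) _ (hr.loss_bounded t ht ω) _).1
  have j1 := hr.integrable_runPotential H u (t := t) ht.le
  have j2 := hr.integrable_runPotential H u (t := t + 1) ht
  have j3 := hr.integrable_corralCost H (t := t) ht.le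
  have j4 := hr.integrable_restart H (t := t + 1) ht
  have k1 : ∫ ω, ∑ e, drawProb P (s t ω).corral e
        * (ℓ t ω (action P (s t ω).corral e) - ℓ t ω u) ∂μ
      ≤ ∫ ω, (∑ e, drawProb P (s t ω).corral e
        * runPotential P c u (corralNext P (s t ω).corral (ℓ t ω) e)
        - runPotential P c u (s t ω).corral + corralCost P (s t ω).corral
        + 2 / barrierScale c P.T) ∂μ := by
    refine integral_mono i1 (((i3.sub j1).add j3).add (integrable_const _)) fun ω => ?_
    have h := corral_regret_step H (hr.valid H ht.le ω) (hr.loss_bounded t ht ω) u hε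
    refine h.trans (le_of_eq ?_)
    unfold runPotential
    ring
  have k2 : ∫ ω, runPotential P c u (corralNext P (s t ω).corral (ℓ t ω) (d t ω)) ∂μ
      ≤ ∫ ω, (runPotential P c u (s (t + 1) ω).corral
        + 40 * (c * Real.log (barrierScale c P.T))
          * (if (s (t + 1) ω).corral.rounds = 0 then (1 : ℝ) else 0)) ∂μ := by
    refine integral_mono i2 (j2.add (j4.const_mul _)) fun ω => ?_
    change _ ≤ runPotential P c u (s (t + 1) ω).corral
        + 40 * (c * Real.log (barrierScale c P.T))
          * (if (s (t + 1) ω).corral.rounds = 0 then (1 : ℝ) else 0)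
    rw [hr.state_succ_eq ht]
    exact runPotential_corralNext_le H u (hr.valid H ht.le ω) _ _
  have j5 : Integrable (fun ω => ∑ e, drawProb P (s t ω).corral e
      * runPotential P c u (corralNext P (s t ω).corral (ℓ t ω) e)
      - runPotential P c u (s t ω).corral) μ := i3.sub j1
  have j6 : Integrable (fun ω => ∑ e, drawProb P (s t ω).corral e
      * runPotential P c u (corralNext P (s t ω).corral (ℓ t ω) e)
      - runPotential P c u (s t ω).corral + corralCost P (s t ω).corral) μ := j5.add j3
  rw [integral_add j6 (integrable_const _), integral_add j5 j3,
    integral_sub i3 j1, integral_const, probReal_univ, one_smul, ← e2] at k1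
  rw [integral_add j2 (j4.const_mul _), integral_const_mul] at k2
  rw [e1]
  linarith

/-- The pathwise quantity whose expectation bounds the regret. -/
def regretPrice (P : Setup K) (c : ℝ) (s : ℕ → State K) : ℝ :=
  totalCost P s P.T + 40 * (c * Real.log (barrierScale c P.T)) * (restarts s P.T + 1)

lemma IsRun.integrable_regretPrice (hr : IsRun μ P ℱ ℓ x₁ d s) (H : IsTuned P c) :
    Integrable (fun ω => regretPrice P c fun t => s t ω) μ := by
  unfold regretPrice totalCost restarts
  push_cast
  refine (integrable_finsetSum _ fun t ht => ?_).add
    (((integrable_finsetSum _ fun t ht => ?_).add (integrable_const _)).const_mul _)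
  · exact hr.integrable_corralCost H (Finset.mem_range.1 ht).le
  · exact hr.integrable_restart H (t := t + 1) (Finset.mem_range.1 ht)

lemma IsRun.pseudoRegret_eq (hr : IsRun μ P ℱ ℓ x₁ d s) (H : IsTuned P c) (u : Fin K) :
    pseudoRegret μ P ℓ d s u = ∑ t ∈ Finset.range P.T,
      ∫ ω, (ℓ t ω (action P (s t ω).corral (d t ω)) - ℓ t ω u) ∂μ :=
  integral_finsetSum _ fun _ ht => hr.integrable_regret H (Finset.mem_range.1 ht) u

/-- The potential telescopes over rounds. Its initial and final values cost as much as one more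
restart, whence the +1 in `regretPrice`; the boundary terms 2/ρ sum to at most 4c. -/
lemma IsRun.pseudoRegret_le_integral (hr : IsRun μ P ℱ ℓ x₁ d s) (H : IsTuned P c) (u : Fin K) :
    pseudoRegret μ P ℓ d s u ≤ ∫ ω, (regretPrice P c fun t => s t ω) ∂μ + 4 * c := by
  have hc : 0 < c := by linarith [H.c_ge]
  set Λ := c * Real.log (barrierScale c P.T) with hΛ
  have h1 : pseudoRegret μ P ℓ d s u ≤ ∑ t ∈ Finset.range P.T,
      (∫ ω, runPotential P c u (s (t + 1) ω).corral ∂μ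
        - ∫ ω, runPotential P c u (s t ω).corral ∂μ + ∫ ω, corralCost P (s t ω).corral ∂μ
        + 40 * Λ * ∫ ω, (if (s (t + 1) ω).corral.rounds = 0 then (1 : ℝ) else 0) ∂μ
        + 2 / barrierScale c P.T) := by
    rw [hr.pseudoRegret_eq H]
    exact Finset.sum_le_sum fun t ht => hr.integral_regret_le H (Finset.mem_range.1 ht) u
  rw [Finset.sum_add_distrib, Finset.sum_add_distrib, Finset.sum_add_distrib, Finset.sum_const,
    Finset.card_range, nsmul_eq_mul, ← Finset.mul_sum,
    Finset.sum_range_sub (fun t => ∫ ω, runPotential P c u (s t ω).corral ∂μ)] at h1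
  have h2 : ∫ ω, (regretPrice P c fun t => s t ω) ∂μ
      = ∑ t ∈ Finset.range P.T, ∫ ω, corralCost P (s t ω).corral ∂μ
        + 40 * Λ * (∑ t ∈ Finset.range P.T,
          ∫ ω, (if (s (t + 1) ω).corral.rounds = 0 then (1 : ℝ) else 0) ∂μ + 1) := by
    unfold regretPrice totalCost restarts
    push_cast
    have i1 : ∀ t ∈ Finset.range P.T, Integrable (fun ω => corralCost P (s t ω).corral) μ :=
      fun t ht => hr.integrable_corralCost H (Finset.mem_range.1 ht).le
    have i2 : ∀ t ∈ Finset.range P.T, Integrable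
        (fun ω => if (s (t + 1) ω).corral.rounds = 0 then (1 : ℝ) else 0) μ :=
      fun t ht => hr.integrable_restart H (t := t + 1) (Finset.mem_range.1 ht)
    have i3 : Integrable (fun ω => ∑ t ∈ Finset.range P.T,
        (if (s (t + 1) ω).corral.rounds = 0 then (1 : ℝ) else 0) + 1) μ :=
      (integrable_finsetSum _ i2).add (integrable_const 1)
    rw [integral_add (integrable_finsetSum _ i1) (i3.const_mul _), integral_const_mul,
      integral_add (integrable_finsetSum _ i2) (integrable_const _), integral_finsetSum _ i1,
      integral_finsetSum _ i2, integral_const, probReal_univ, one_smul]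
  have h3 : ∫ ω, runPotential P c u (s P.T ω).corral ∂μ ≤ 16 * Λ :=
    integral_le_const (hr.integrable_runPotential H u le_rfl)
      fun ω => runPotential_le H u (hr.valid H le_rfl ω)
  have h4 : -(24 * Λ) ≤ ∫ ω, runPotential P c u (s 0 ω).corral ∂μ :=
    const_le_integral (hr.integrable_runPotential H u (Nat.zero_le _)) fun ω => by
      rw [hr.state_zero]
      exact runPotential_start H u _
  have h5 := div_barrierScale_le hc P.T
  have h6 : (P.T : ℝ) * (2 / barrierScale c P.T) = 2 * (P.T / barrierScale c P.T) := by ring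
  rw [h2]
  linarith

lemma IsRun.integrable_absEstimate (hr : IsRun μ P ℱ ℓ x₁ d s) (H : IsTuned P c)
    {t : ℕ} (ht : t < P.T) :
    Integrable (fun ω => absEstimate P (s t ω).corral (ℓ t ω) (d t ω)) μ ∧
      ∫ ω, absEstimate P (s t ω).corral (ℓ t ω) (d t ω) ∂μ ≤ 2 := by
  obtain ⟨B, hB⟩ := hr.exists_boundedBy H t ht.le
  obtain ⟨B₁, hB₁⟩ := exists_boundedBy_next H t B
  have h : ∀ e ω, |absEstimate P (s t ω).corral (ℓ t ω) e| ≤ B₁ := fun e ω => by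
    rw [abs_of_nonneg (absEstimate_nonneg _ _ _)]
    exact (hB₁ _ (hr.valid H ht.le ω) (hB ω) _ (hr.loss_bounded t ht ω) e).2
  have hm := fun e => hr.measurable_absEstimate H ht e
  have h3 := hr.integral_draw H ht (f := fun e ω => absEstimate P (s t ω).corral (ℓ t ω) e) hm B₁ h
  refine ⟨h3.1, h3.2.2.trans_le ?_⟩
  exact integral_le_const h3.2.1 fun ω =>
    sum_drawProb_absEstimate_le H (hr.valid H ht.le ω) (hr.loss_bounded t ht ω)

lemma IsRun.integrable_totalAbs (hr : IsRun μ P ℱ ℓ x₁ d s) (H : IsTuned P c) :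
    Integrable (fun ω => totalAbs P (fun t => ℓ t ω) (fun t => d t ω) (fun t => s t ω) P.T) μ :=
  integrable_finsetSum _ fun _ ht => (hr.integrable_absEstimate H (Finset.mem_range.1 ht)).1

lemma IsRun.integral_totalAbs_div_le (hr : IsRun μ P ℱ ℓ x₁ d s) (H : IsTuned P c) :
    (∫ ω, totalAbs P (fun t => ℓ t ω) (fun t => d t ω) (fun t => s t ω) P.T ∂μ)
      / barrierScale c P.T ≤ 4 * c := by
  have hc : 0 < c := by linarith [H.c_ge]
  have h4 := four_le_barrierScale hc P.T
  have h1 : ∫ ω, totalAbs P (fun t => ℓ t ω) (fun t => d t ω) (fun t => s t ω) P.T ∂μ ≤ P.T * 2 := by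
    unfold totalAbs
    rw [integral_finsetSum _ fun t ht => (hr.integrable_absEstimate H (Finset.mem_range.1 ht)).1]
    calc _ ≤ ∑ t ∈ Finset.range P.T, (2 : ℝ) :=
          Finset.sum_le_sum fun t ht => (hr.integrable_absEstimate H (Finset.mem_range.1 ht)).2
      _ = _ := by simp
  have h2 := div_barrierScale_le hc P.T
  calc _ ≤ (P.T * 2) / barrierScale c P.T := by gcongr
    _ = 2 * (P.T / barrierScale c P.T) := by ring
    _ ≤ _ := by linarith

/-- The regret in the adversarial regime. -/
lemma IsRun.pseudoRegret_le_adversarial (hr : IsRun μ P ℱ ℓ x₁ d s) (H : IsTuned P c) (u : Fin K) :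
    pseudoRegret μ P ℓ d s u ≤ 1200 * (c ^ (1 / 3 : ℝ) * (P.T : ℝ) ^ (2 / 3 : ℝ)) := by
  have hc1 := H.c_ge
  have hc : 0 < c := by linarith
  -- For T ≤ c the trivial bound 2T is below the claim, since then T^{1/3} ≤ c^{1/3}.
  rcases le_total (P.T : ℝ) c with hT | hT
  · have h1 : pseudoRegret μ P ℓ d s u ≤ 2 * P.T := by
      rw [hr.pseudoRegret_eq H]
      calc _ ≤ ∑ t ∈ Finset.range P.T, (2 : ℝ) := by
            refine Finset.sum_le_sum fun t ht => ?_
            have ht' := Finset.mem_range.1 ht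
            exact integral_le_const (hr.integrable_regret H ht' u)
              fun ω => (le_abs_self _).trans (abs_sub_le_two (hr.loss_bounded t ht' ω) _ _)
        _ = _ := by simp [mul_comm]
    have h2 : (P.T : ℝ) = (P.T : ℝ) ^ (1 / 3 : ℝ) * (P.T : ℝ) ^ (2 / 3 : ℝ) := by
      rw [← Real.rpow_add_of_nonneg (Nat.cast_nonneg _) (by norm_num) (by norm_num)]
      norm_num
    have h3 : (P.T : ℝ) ^ (1 / 3 : ℝ) * (P.T : ℝ) ^ (2 / 3 : ℝ)
        ≤ c ^ (1 / 3 : ℝ) * (P.T : ℝ) ^ (2 / 3 : ℝ) := by gcongr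
    have h4 : 0 ≤ (P.T : ℝ) ^ (1 / 3 : ℝ) * (P.T : ℝ) ^ (2 / 3 : ℝ) := by positivity
    linarith
  · have iW := hr.integrable_totalAbs H
    have h1 := hr.pseudoRegret_le_integral H u
    have h2 := hr.integral_totalAbs_div_le H
    set ρ := barrierScale c P.T with hρ
    have hρ4 : 4 ≤ ρ := four_le_barrierScale hc P.T
    set v := ((P.T : ℝ) / c) ^ (1 / 3 : ℝ) with hv
    have hv3 : v ^ 3 = (P.T : ℝ) / c := rpow_third_pow (by positivity)
    have hv1 : 1 ≤ v := Real.one_le_rpow (by rwa [one_le_div hc]) (by norm_num)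
    set Y := c ^ (1 / 3 : ℝ) * (P.T : ℝ) ^ (2 / 3 : ℝ) with hY
    have hcv : c * v ^ 2 = Y := by
      have e1 : v ^ 2 = ((P.T : ℝ) / c) ^ (2 / 3 : ℝ) := by
        rw [hv, ← Real.rpow_natCast, ← Real.rpow_mul (by positivity)]
        norm_num
      have e2 : c = c ^ (1 / 3 : ℝ) * c ^ (2 / 3 : ℝ) := by
        rw [← Real.rpow_add hc]
        norm_num
      rw [e1, Real.div_rpow (by positivity) hc.le]
      nth_rewrite 1 [e2]
      have : c ^ (2 / 3 : ℝ) ≠ 0 := by positivity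
      rw [hY]
      field_simp
    have h3 := integral_mono (hr.integrable_regretPrice H)
      ((integrable_const (80 * Y + 3 * v * (58 * (c * Real.log ρ)))).add
        (iW.const_mul (3 * v * (5 / 2) / ρ)))
      fun ω => ((hr.isPath ω).cost_adversarial H hT).trans (le_of_eq (by
        change _ = (80 * Y + 3 * v * (58 * (c * Real.log ρ))) + 3 * v * (5 / 2) / ρ * _
        ring))
    simp only [Pi.add_apply] at h3
    rw [integral_const_add_mul iW] at h3
    -- With v = (T/c)^{1/3} there are at most 3v restarts, each costing a multiple of c log ρ.
    -- Bounding log ρ linearly in v makes the product a multiple of c v², the target rate, with no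
    -- logarithm left.
    have hlog : Real.log ρ ≤ 6 * v := by
      have e1 : ρ ≤ (2 * v) ^ 3 := by
        have : ρ = 4 + v ^ 3 / 2 := by
          rw [hρ, hv3, barrierScale]
          field_simp
        have := one_le_pow₀ hv1 (n := 3)
        nlinarith
      have e2 := Real.log_le_log (by linarith) e1
      rw [Real.log_pow] at e2
      have e3 := Real.log_le_sub_one_of_pos (show 0 < 2 * v by linarith)
      push_cast at e2
      linarith
    have h4 : 3 * v * (58 * (c * Real.log ρ) + 5 / 2 * ((∫ ω, totalAbs P (fun t => ℓ t ω)
        (fun t => d t ω) (fun t => s t ω) P.T ∂μ) / ρ)) ≤ 3 * v * (c * (348 * v) + c * (10 * v)) := by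
      have e1 := mul_le_mul_of_nonneg_left hlog hc.le
      have e2 := mul_le_mul_of_nonneg_left hv1 hc.le
      refine mul_le_mul_of_nonneg_left ?_ (by linarith)
      linarith
    have h5 : 3 * v * (c * (348 * v) + c * (10 * v)) = 1074 * Y := by rw [← hcv]; ring
    have h6 : c ≤ Y := by
      rw [← hcv]
      have := one_le_pow₀ hv1 (n := 2)
      nlinarith
    have h7 : 3 * v * (5 / 2) / ρ * ∫ ω, totalAbs P (fun t => ℓ t ω)
        (fun t => d t ω) (fun t => s t ω) P.T ∂μ = 3 * v * (5 / 2 * ((∫ ω, totalAbs P (fun t => ℓ t ω)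
        (fun t => d t ω) (fun t => s t ω) P.T ∂μ) / ρ)) := by ring
    rw [h7] at h3
    rw [h5, mul_add] at h4
    linarith

end run
end
end GraphBandit
namespace GraphBandit
noncomputable section
variable {K : ℕ}
variable {P : Setup K} {c : ℝ}

/-! ### The corrupted stochastic regime -/

/-- The leader of EXP3 gives the candidate weight 0, so EXP3 proposes it only through forced
exploration. -/
lemma exp3Prob_self_le (H : IsTuned P c) (x : Fin K) {s : Exp3State K} (hs : s.Valid) {q : ℝ}
    (hq : 0 < q) : exp3Prob P x s q x ≤ 1 / 2 := by
  classical
  have h1 := exp3Gamma_pos H hs hq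
  have h2 := exp3Gamma_le H hs hq
  have h3 := H.one_le_weakDomNumber
  unfold exp3Prob
  rw [exp3Leader_eq H x hs hq, softmax, if_pos rfl, mul_zero, zero_add, H.card]
  have h4 : (if x ∈ P.D then 1 / (weakDomNumber P.G : ℝ) else 0) ≤ 1 := by
    split_ifs
    · rw [div_le_one (by linarith)]; exact h3
    · exact zero_le_one
  nlinarith

/-- While `x` is the candidate, other arms are played whenever the base algorithm is followed. -/
lemma baseProb_le_sum_drawProb (H : IsTuned P c) {s : CorralState K} (hs : s.Valid) (x : Fin K) :
    (if s.xhat = x then baseProb P s else 0)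
      ≤ 2 * ∑ e, drawProb P s e * (if action P s e = x then 0 else 1) := by
  have hd : ∀ e, 0 ≤ drawProb P s e * (if action P s e = x then 0 else 1) := fun e =>
    mul_nonneg (drawProb_nonneg H hs e) (by split_ifs <;> norm_num)
  split_ifs with hx
  · subst hx
    rw [sum_drawProb_mul H]
    have hp := exp3Prob_nonneg H s.xhat hs.base (baseProb_pos H s)
    have hq := baseProb_pos H s
    obtain ⟨hγ0, hγ1, -⟩ := corralGamma_spec H s
    obtain ⟨hl0, hl1⟩ := corralLead_mem H s
    have hqe := baseProb_eq H s
    have h1 : ∀ a, exp3Prob P s.xhat s.base (baseProb P s) a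
          * (baseProb P s * (if a = s.xhat then 0 else 1))
        ≤ exp3Prob P s.xhat s.base (baseProb P s) a *
          (corralGamma P s / 2 * ((if action P s ⟨a, true, 0⟩ = s.xhat then 0 else 1)
            + (if action P s ⟨a, true, 1⟩ = s.xhat then 0 else 1))
          + (1 - corralGamma P s) * ((1 - corralLead P s)
            * (if action P s ⟨a, false, 0⟩ = s.xhat then 0 else 1)
            + corralLead P s * (if action P s ⟨a, false, 1⟩ = s.xhat then 0 else 1))) := by
      intro a
      refine mul_le_mul_of_nonneg_left ?_ (hp a)
      have e1 : action P s ⟨a, false, 1⟩ = a := rfl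
      rw [e1, hqe]
      have g1 : (0 : ℝ) ≤ if action P s ⟨a, true, 0⟩ = s.xhat then 0 else 1 := by
        split_ifs <;> norm_num
      have g2 : (0 : ℝ) ≤ if action P s ⟨a, true, 1⟩ = s.xhat then 0 else 1 := by
        split_ifs <;> norm_num
      have g3 : (0 : ℝ) ≤ if action P s ⟨a, false, 0⟩ = s.xhat then 0 else 1 := by
        split_ifs <;> norm_num
      have g4 : 0 ≤ corralGamma P s / 2 * ((if action P s ⟨a, true, 0⟩ = s.xhat then 0 else 1)
            + (if action P s ⟨a, true, 1⟩ = s.xhat then 0 else 1)) := by positivity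
      have g5 : 0 ≤ (1 - corralGamma P s) * ((1 - corralLead P s)
            * (if action P s ⟨a, false, 0⟩ = s.xhat then 0 else 1)) :=
        mul_nonneg (by linarith) (mul_nonneg (by linarith) g3)
      linarith
    have h2 := Finset.sum_le_sum fun a (_ : a ∈ Finset.univ) => h1 a
    refine le_trans ?_ (mul_le_mul_of_nonneg_left h2 zero_le_two)
    have h3 : ∑ a, exp3Prob P s.xhat s.base (baseProb P s) a
          * (baseProb P s * (if a = s.xhat then 0 else 1))
        = baseProb P s * (1 - exp3Prob P s.xhat s.base (baseProb P s) s.xhat) := by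
      have e1 : ∀ a, exp3Prob P s.xhat s.base (baseProb P s) a
          * (baseProb P s * (if a = s.xhat then 0 else 1))
        = baseProb P s * (exp3Prob P s.xhat s.base (baseProb P s) a
          - if a = s.xhat then exp3Prob P s.xhat s.base (baseProb P s) a else 0) := by
        intro a
        split_ifs <;> ring
      simp only [e1]
      rw [← Finset.mul_sum, Finset.sum_sub_distrib, sum_exp3Prob H _ hs.base hq,
        Finset.sum_ite_eq' Finset.univ s.xhat, if_pos (Finset.mem_univ _)]
    rw [h3]
    have h4 := exp3Prob_self_le H s.xhat hs.base hq
    nlinarith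
  · exact mul_nonneg zero_le_two (Finset.sum_nonneg fun e _ => hd e)

/-- The probability that the arm `x` is played. -/
def playProb (P : Setup K) (s : CorralState K) (x : Fin K) : ℝ :=
  ∑ e, drawProb P s e * (if action P s e = x then 1 else 0)

lemma playProb_nonneg (H : IsTuned P c) {s : CorralState K} (hs : s.Valid) (x : Fin K) :
    0 ≤ playProb P s x :=
  Finset.sum_nonneg fun e _ => mul_nonneg (drawProb_nonneg H hs e) (by split_ifs <;> norm_num)

lemma playProb_le_one (H : IsTuned P c) {s : CorralState K} (hs : s.Valid) (x : Fin K) :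
    playProb P s x ≤ 1 := by
  rw [← sum_drawProb H hs]
  refine Finset.sum_le_sum fun e _ => ?_
  have := drawProb_nonneg H hs e
  split_ifs <;> simp [this]

lemma measurable_playProb (H : IsTuned P c) (x : Fin K) :
    Measurable fun s : ValidState K => playProb P s.1 x := by
  have h1 := measurable_drawProb H
  have h2 : ∀ e, Measurable fun s : ValidState K => if action P s.1 e = x then (1 : ℝ) else 0 :=
    fun e => (Measurable.of_discrete (f := fun y : Fin K => if y = x then (1 : ℝ) else 0)).comp
      ((measurable_action P e).comp measurable_subtype_coe)
  unfold playProb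
  fun_prop

/-! ### Expected plays of arms other than the best one -/

section run

variable {Ω : Type*} {mΩ : MeasurableSpace Ω} {μ : Measure Ω} {ℱ : Filtration ℕ mΩ}
  {ℓ : ℕ → Ω → Fin K → ℝ} {x₁ : Ω → Fin K} {d : ℕ → Ω → Draw K} {s : ℕ → Ω → State K}

lemma IsRun.measurable_miss (hr : IsRun μ P ℱ ℓ x₁ d s) (H : IsTuned P c) {t : ℕ} (ht : t < P.T)
    (x : Fin K) (a b : ℝ) (e : Draw K) : Measurable[roundInfo ℱ ℓ t]
      fun ω => if action P (s t ω).corral e = x then a else b := by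
  have h : Measurable fun y : CorralState K × (Fin K → ℝ) => if action P y.1 e = x then a else b :=
    (Measurable.of_discrete (f := fun y : Fin K => if y = x then a else b)).comp
      ((measurable_action P e).comp measurable_fst)
  exact h.comp (hr.measurable_pair' H ht)

lemma IsRun.measurable_playProb (hr : IsRun μ P ℱ ℓ x₁ d s) (H : IsTuned P c) {t : ℕ} (ht : t < P.T)
    (x : Fin K) : Measurable[ℱ t] fun ω => playProb P (s t ω).corral x := by
  have h := (GraphBandit.measurable_playProb H x).comp (hr.measurable_validState H ht)
  exact h

variable [IsProbabilityMeasure μ]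

lemma IsRun.integral_miss (hr : IsRun μ P ℱ ℓ x₁ d s) (H : IsTuned P c) {t : ℕ} (ht : t < P.T)
    (x : Fin K) :
    Integrable (fun ω => if action P (s t ω).corral (d t ω) = x then (0 : ℝ) else 1) μ ∧
      Integrable (fun ω => ∑ e, drawProb P (s t ω).corral e
        * (if action P (s t ω).corral e = x then (0 : ℝ) else 1)) μ ∧
      ∫ ω, (if action P (s t ω).corral (d t ω) = x then (0 : ℝ) else 1) ∂μ
        = ∫ ω, ∑ e, drawProb P (s t ω).corral e
          * (if action P (s t ω).corral e = x then (0 : ℝ) else 1) ∂μ :=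
  hr.integral_draw H ht (f := fun e ω => if action P (s t ω).corral e = x then (0 : ℝ) else 1)
    (hr.measurable_miss H ht x 0 1) 1 fun e ω => by split_ifs <;> simp

lemma IsRun.integrable_baseMass_term (hr : IsRun μ P ℱ ℓ x₁ d s) (H : IsTuned P c) {t : ℕ}
    (ht : t < P.T) (x : Fin K) :
    Integrable (fun ω => if (s t ω).corral.xhat = x then baseProb P (s t ω).corral else 0) μ := by
  have h1 : Measurable fun ω => (s t ω).corral :=
    (hr.measurable_corral H ht).mono (ℱ.le _) le_rfl
  refine integrable_of_bounded ?_ 1 fun ω => ?_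
  · refine Measurable.ite ?_ ((measurable_baseProb H).comp h1) measurable_const
    exact (CorralState.measurable_xhat.comp h1) (MeasurableSet.singleton x)
  · have h2 := baseProb_pos H (s t ω).corral
    have h3 := baseProb_le_one H (s t ω).corral
    split_ifs
    · rwa [abs_of_pos h2]
    · simp

lemma IsRun.integrable_missCount (hr : IsRun μ P ℱ ℓ x₁ d s) (H : IsTuned P c) (x : Fin K) :
    Integrable (fun ω => missCount P x (fun t => d t ω) (fun t => s t ω) P.T) μ :=
  integrable_finsetSum _ fun _ ht => (hr.integral_miss H (Finset.mem_range.1 ht) x).1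

lemma IsRun.integrable_baseMass (hr : IsRun μ P ℱ ℓ x₁ d s) (H : IsTuned P c) (x : Fin K) :
    Integrable (fun ω => baseMass P x (fun t => s t ω) P.T) μ :=
  integrable_finsetSum _ fun _ ht => hr.integrable_baseMass_term H (Finset.mem_range.1 ht) x

lemma IsRun.integral_missCount_eq (hr : IsRun μ P ℱ ℓ x₁ d s) (H : IsTuned P c) (x : Fin K) :
    ∫ ω, missCount P x (fun t => d t ω) (fun t => s t ω) P.T ∂μ = ∑ t ∈ Finset.range P.T,
      ∫ ω, (if action P (s t ω).corral (d t ω) = x then (0 : ℝ) else 1) ∂μ :=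
  integral_finsetSum _ fun _ ht => (hr.integral_miss H (Finset.mem_range.1 ht) x).1

lemma IsRun.integral_baseMass_le (hr : IsRun μ P ℱ ℓ x₁ d s) (H : IsTuned P c) (x : Fin K) :
    ∫ ω, baseMass P x (fun t => s t ω) P.T ∂μ
      ≤ 2 * ∫ ω, missCount P x (fun t => d t ω) (fun t => s t ω) P.T ∂μ := by
  rw [hr.integral_missCount_eq H, Finset.mul_sum]
  unfold baseMass
  rw [integral_finsetSum _ fun _ ht => hr.integrable_baseMass_term H (Finset.mem_range.1 ht) x]
  refine Finset.sum_le_sum fun t ht => ?_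
  have ht' := Finset.mem_range.1 ht
  obtain ⟨-, i1, e1⟩ := hr.integral_miss H ht' x
  rw [e1, ← integral_const_mul]
  exact integral_mono (hr.integrable_baseMass_term H ht' x) (i1.const_mul 2)
    fun ω => baseProb_le_sum_drawProb H (hr.valid H ht'.le ω) x

/-- The regret against `x`, up to a multiple of the expected number of plays of other arms. -/
lemma IsRun.pseudoRegret_le_tradeoff (hr : IsRun μ P ℱ ℓ x₁ d s) (H : IsTuned P c) (hT : 2 ≤ P.T)
    (u x : Fin K) {lam : ℝ} (hl : 0 < lam) (hl2 : lam ≤ 2) :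
    pseudoRegret μ P ℓ d s u
      ≤ 4102 * (lam * ∫ ω, missCount P x (fun t => d t ω) (fun t => s t ω) P.T ∂μ)
        + 42300 * (c * Real.log P.T / lam ^ 2) := by
  have hc : 0 < c := by linarith [H.c_ge]
  have iW := hr.integrable_totalAbs H
  have iN := hr.integrable_missCount H x
  have iQ := hr.integrable_baseMass H x
  have h1 := hr.pseudoRegret_le_integral H u
  have h2 := hr.integral_totalAbs_div_le H
  have h3 := hr.integral_baseMass_le H x
  have hlog := log_natCast_ge hT
  set ρ := barrierScale c P.T with hρ
  set B := c * Real.log P.T / lam ^ 2 with hB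
  have j1 : Integrable (fun ω => 4032 * lam * missCount P x (fun t => d t ω) (fun t => s t ω) P.T
      + 35 * lam * baseMass P x (fun t => s t ω) P.T) μ := (iN.const_mul _).add (iQ.const_mul _)
  have j2 : Integrable (fun ω => 42000 * B + (15 / 2 * Real.log P.T + 9 / lam ^ 2) / ρ
      * totalAbs P (fun t => ℓ t ω) (fun t => d t ω) (fun t => s t ω) P.T) μ :=
    (integrable_const _).add (iW.const_mul _)
  have h4 := integral_mono (hr.integrable_regretPrice H) (j1.add j2)
    fun ω => ((hr.isPath ω).cost_stochastic H hT x hl hl2).trans (le_of_eq (by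
      simp only [Pi.add_apply]
      ring))
  simp only [Pi.add_apply] at h4
  rw [integral_add j1 j2, integral_add (iN.const_mul _) (iQ.const_mul _), integral_const_mul,
    integral_const_mul, integral_const_add_mul iW] at h4
  set W := ∫ ω, totalAbs P (fun t => ℓ t ω) (fun t => d t ω) (fun t => s t ω) P.T ∂μ
  set N := ∫ ω, missCount P x (fun t => d t ω) (fun t => s t ω) P.T ∂μ
  set Q := ∫ ω, baseMass P x (fun t => s t ω) P.T ∂μ
  have h5 : (15 / 2 * Real.log P.T + 9 / lam ^ 2) / ρ * W
      ≤ (15 / 2 * Real.log P.T + 9 / lam ^ 2) * (4 * c) := by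
    rw [div_mul_eq_mul_div, mul_div_assoc]
    exact mul_le_mul_of_nonneg_left h2 (by positivity)
  have hl4 : lam ^ 2 ≤ 4 := by nlinarith
  have hl0 : 0 < lam ^ 2 := by positivity
  have hBl : c * Real.log P.T = lam ^ 2 * B := by rw [hB]; field_simp
  have hB0 : 0 < B := by positivity
  have h6 : c * Real.log P.T ≤ 4 * B := by
    rw [hBl]; exact mul_le_mul_of_nonneg_right hl4 hB0.le
  have h7 : c ≤ 2 * (c * Real.log P.T) := by nlinarith
  have h8 : c / lam ^ 2 ≤ 2 * B := by
    rw [hB, ← mul_div_assoc]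
    gcongr
  have h9 : (15 / 2 * Real.log P.T + 9 / lam ^ 2) * (4 * c)
      = 30 * (c * Real.log P.T) + 36 * (c / lam ^ 2) := by ring
  have h10 := mul_le_mul_of_nonneg_left h3 hl.le
  rw [h9] at h5
  linarith

lemma IsRun.integrable_lossGap (hr : IsRun μ P ℱ ℓ x₁ d s) {t : ℕ} (ht : t < P.T) (x y : Fin K) :
    Integrable (fun ω => ℓ t ω x - ℓ t ω y) μ := by
  have h : Measurable (ℓ t) := (hr.loss_measurable t ht).mono (ℱ.le _) le_rfl
  exact integrable_of_bounded (((measurable_pi_apply x).comp h).sub ((measurable_pi_apply y).comp h)) 2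
    fun ω => abs_sub_le_two (hr.loss_bounded t ht ω) _ _

/-- Weighted by the past, a loss difference is at least its conditional lower bound. -/
lemma IsRun.integral_mul_lossGap_ge (hr : IsRun μ P ℱ ℓ x₁ d s) {t : ℕ} (ht : t < P.T) {x y : Fin K}
    {g : ℝ} (hg : ∀ᵐ ω ∂μ, g ≤ (μ[fun ω' => ℓ t ω' x - ℓ t ω' y | ℱ t]) ω) {w : Ω → ℝ}
    (hw : Measurable[ℱ t] w) (hw0 : ∀ ω, 0 ≤ w ω) (hw1 : ∀ ω, w ω ≤ 1) :
    g * ∫ ω, w ω ∂μ ≤ ∫ ω, w ω * (ℓ t ω x - ℓ t ω y) ∂μ := by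
  have hw' : Measurable w := hw.mono (ℱ.le t) le_rfl
  have iw : Integrable w μ := integrable_of_bounded hw' 1 fun ω => by
    rw [abs_of_nonneg (hw0 ω)]; exact hw1 ω
  have il := hr.integrable_lossGap ht x y
  have iwl : Integrable (w * fun ω => ℓ t ω x - ℓ t ω y) μ := by
    refine il.bdd_mul (c := 1) hw'.aestronglyMeasurable (Filter.Eventually.of_forall fun ω => ?_)
    rw [Real.norm_eq_abs, abs_of_nonneg (hw0 ω)]
    exact hw1 ω
  have h1 := condExp_mul_of_stronglyMeasurable_left (μ := μ) hw.stronglyMeasurable iwl il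
  have h2 := integral_condExp (μ := μ) (f := w * fun ω => ℓ t ω x - ℓ t ω y) (ℱ.le t)
  have h3 : ∫ ω, w ω * (ℓ t ω x - ℓ t ω y) ∂μ
      = ∫ ω, w ω * (μ[fun ω' => ℓ t ω' x - ℓ t ω' y | ℱ t]) ω ∂μ :=
    h2.symm.trans (integral_congr_ae h1)
  rw [h3, ← integral_const_mul]
  refine integral_mono_ae (iw.const_mul g) ?_ ?_
  · exact integrable_condExp.congr h1
  · filter_upwards [hg] with ω hω
    rw [mul_comm]
    exact mul_le_mul_of_nonneg_left hω (hw0 ω)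

/-- The regret is split by the played arm. Integrating out the draw first replaces each indicator by
`playProb`, which is determined by the past, and only then does the gap condition given the past
apply. The bound g may be negative. -/
lemma IsRun.integral_regret_ge (hr : IsRun μ P ℱ ℓ x₁ d s) (H : IsTuned P c) {t : ℕ} (ht : t < P.T)
    {y : Fin K} {g : ℝ}
    (hg : ∀ x, x ≠ y → ∀ᵐ ω ∂μ, g ≤ (μ[fun ω' => ℓ t ω' x - ℓ t ω' y | ℱ t]) ω) :
    g * ∫ ω, (if action P (s t ω).corral (d t ω) = y then (0 : ℝ) else 1) ∂μ
      ≤ ∫ ω, (ℓ t ω (action P (s t ω).corral (d t ω)) - ℓ t ω y) ∂μ := by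
  have hplay : ∀ x, ∫ ω, (if action P (s t ω).corral (d t ω) = x then (1 : ℝ) else 0) ∂μ
      = ∫ ω, playProb P (s t ω).corral x ∂μ := fun x =>
    (hr.integral_draw H ht (f := fun e ω => if action P (s t ω).corral e = x then (1 : ℝ) else 0)
      (hr.measurable_miss H ht x 1 0) 1 fun e ω => by split_ifs <;> simp).2.2
  have iplay : ∀ x, Integrable
      (fun ω => if action P (s t ω).corral (d t ω) = x then (1 : ℝ) else 0) μ := fun x =>
    (hr.integral_draw H ht (f := fun e ω => if action P (s t ω).corral e = x then (1 : ℝ) else 0)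
      (hr.measurable_miss H ht x 1 0) 1 fun e ω => by split_ifs <;> simp).1
  have hterm : ∀ x, Integrable (fun ω => (if action P (s t ω).corral (d t ω) = x then (1 : ℝ) else 0)
        * (ℓ t ω x - ℓ t ω y)) μ ∧
      ∫ ω, (if action P (s t ω).corral (d t ω) = x then (1 : ℝ) else 0)
        * (ℓ t ω x - ℓ t ω y) ∂μ
      = ∫ ω, playProb P (s t ω).corral x * (ℓ t ω x - ℓ t ω y) ∂μ := by
    intro x
    have h := hr.integral_draw H ht
      (f := fun e ω => (if action P (s t ω).corral e = x then (1 : ℝ) else 0)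
        * (ℓ t ω x - ℓ t ω y))
      (fun e => (hr.measurable_miss H ht x 1 0 e).mul
        ((measurable_loss_apply ℱ ℓ t x).sub (measurable_loss_apply ℱ ℓ t y))) 2 fun e ω => by
        have := abs_sub_le_two (hr.loss_bounded t ht ω) x y
        split_ifs
        · rwa [one_mul]
        · simp
    refine ⟨h.1, h.2.2.trans (integral_congr_ae (Filter.Eventually.of_forall fun ω => ?_))⟩
    simp only [playProb, Finset.sum_mul]
    exact Finset.sum_congr rfl fun e _ => by ring
  have hsum1 : (fun ω => ℓ t ω (action P (s t ω).corral (d t ω)) - ℓ t ω y)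
      = fun ω => ∑ x ∈ Finset.univ.erase y,
        (if action P (s t ω).corral (d t ω) = x then (1 : ℝ) else 0) * (ℓ t ω x - ℓ t ω y) := by
    ext ω
    rw [Finset.sum_erase _ (by rw [sub_self, mul_zero])]
    simp [ite_mul]
  have hsum2 : (fun ω => if action P (s t ω).corral (d t ω) = y then (0 : ℝ) else 1)
      = fun ω => ∑ x ∈ Finset.univ.erase y,
        (if action P (s t ω).corral (d t ω) = x then (1 : ℝ) else 0) := by
    ext ω
    simp only [Finset.sum_ite_eq, Finset.mem_erase, Finset.mem_univ, and_true, ne_eq]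
    by_cases h : action P (s t ω).corral (d t ω) = y <;> simp [h]
  rw [hsum1, hsum2, integral_finsetSum _ fun x _ => iplay x,
    integral_finsetSum _ fun x _ => (hterm x).1, Finset.mul_sum]
  refine Finset.sum_le_sum fun x hx => ?_
  rw [hplay, (hterm x).2]
  exact hr.integral_mul_lossGap_ge ht (hg x (Finset.ne_of_mem_erase hx))
    (hr.measurable_playProb H ht x)
    (fun ω => playProb_nonneg H (hr.valid H ht.le ω) x)
    (fun ω => playProb_le_one H (hr.valid H ht.le ω) x)

lemma IsRun.integral_lossGap_ge (hr : IsRun μ P ℱ ℓ x₁ d s) {t : ℕ} (ht : t < P.T) {x y : Fin K}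
    {g : ℝ} (hg : ∀ᵐ ω ∂μ, g ≤ (μ[fun ω' => ℓ t ω' x - ℓ t ω' y | ℱ t]) ω) :
    g ≤ ∫ ω, (ℓ t ω x - ℓ t ω y) ∂μ := by
  have h := hr.integral_mul_lossGap_ge ht hg (w := fun _ => 1) measurable_const
    (fun _ => zero_le_one) (fun _ => le_rfl)
  simpa using h

variable {y : Fin K} {Δ : ℝ} {C : ℕ → ℝ}

lemma IsRun.pseudoRegret_ge (hr : IsRun μ P ℱ ℓ x₁ d s) (H : IsTuned P c)
    (hC : IsCorruptedStochastic μ P.T ℱ ℓ y Δ C) :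
    Δ * ∫ ω, missCount P y (fun t => d t ω) (fun t => s t ω) P.T ∂μ - ∑ t ∈ Finset.range P.T, C t
      ≤ pseudoRegret μ P ℓ d s y := by
  rw [hr.pseudoRegret_eq H, hr.integral_missCount_eq H, Finset.mul_sum, ← Finset.sum_sub_distrib]
  refine Finset.sum_le_sum fun t ht => ?_
  have ht' := Finset.mem_range.1 ht
  have h1 := hr.integral_regret_ge H ht' (hC t ht').2
  have h2 : ∫ ω, (if action P (s t ω).corral (d t ω) = y then (0 : ℝ) else 1) ∂μ ≤ 1 :=
    integral_le_const (hr.integral_miss H ht' y).1 fun ω => by split_ifs <;> norm_num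
  have h3 := (hC t ht').1
  nlinarith

/-- Every other arm has itself an expected excess loss of at least Δ - C_t over y in each round. -/
lemma IsRun.pseudoRegret_le_add (hr : IsRun μ P ℱ ℓ x₁ d s) (H : IsTuned P c)
    (hC : IsCorruptedStochastic μ P.T ℱ ℓ y Δ C) {u : Fin K} (hu : u ≠ y) :
    pseudoRegret μ P ℓ d s u
      ≤ pseudoRegret μ P ℓ d s y + ∑ t ∈ Finset.range P.T, C t - P.T * Δ := by
  have h1 : (P.T : ℝ) * Δ = ∑ t ∈ Finset.range P.T, Δ := by simp
  rw [h1, hr.pseudoRegret_eq H, hr.pseudoRegret_eq H, ← Finset.sum_add_distrib,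
    ← Finset.sum_sub_distrib]
  refine Finset.sum_le_sum fun t ht => ?_
  have ht' := Finset.mem_range.1 ht
  have h2 := hr.integral_lossGap_ge ht' ((hC t ht').2 u hu)
  have i1 := hr.integrable_regret H ht' u
  have i2 := hr.integrable_regret H ht' y
  have h3 := integral_sub i2 i1
  have h4 : ∫ ω, (ℓ t ω u - ℓ t ω y) ∂μ
      = ∫ ω, (ℓ t ω (action P (s t ω).corral (d t ω)) - ℓ t ω y
        - (ℓ t ω (action P (s t ω).corral (d t ω)) - ℓ t ω u)) ∂μ :=
    integral_congr_ae (Filter.Eventually.of_forall fun ω => by ring)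
  rw [h4, h3] at h2
  linarith

/-- A large gap forces a large corruption. -/
lemma IsRun.gap_le (hr : IsRun μ P ℱ ℓ x₁ d s) (H : IsTuned P c)
    (hC : IsCorruptedStochastic μ P.T ℱ ℓ y Δ C) :
    P.T * (Δ - 2) ≤ ∑ t ∈ Finset.range P.T, C t := by
  have : Nontrivial (Fin K) := Fin.nontrivial_iff_two_le.2 H.two_le
  obtain ⟨x, hx⟩ := exists_ne y
  have h1 : (P.T : ℝ) * (Δ - 2) = ∑ t ∈ Finset.range P.T, (Δ - 2) := by
    rw [Finset.sum_const, Finset.card_range, nsmul_eq_mul]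
  rw [h1]
  refine Finset.sum_le_sum fun t ht => ?_
  have ht' := Finset.mem_range.1 ht
  have h2 := hr.integral_lossGap_ge ht' ((hC t ht').2 x hx)
  have h3 : ∫ ω, (ℓ t ω x - ℓ t ω y) ∂μ ≤ 2 := integral_le_const (hr.integrable_lossGap ht' x y)
    fun ω => (le_abs_self _).trans (abs_sub_le_two (hr.loss_bounded t ht' ω) _ _)
  linarith

end run
end
end GraphBandit
namespace GraphBandit
noncomputable section
variable {K : ℕ}

/-! ### The two regimes -/

/-- Self-bounding: an upper bound with a free parameter and a lower bound on the regret. -/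
lemma self_bounding {a b R N S C Δ : ℝ} (ha : 1 ≤ a) (hb : 0 ≤ b) (hS : 0 < S) (hC : 0 ≤ C)
    (hΔ : 0 < Δ) (hΔ4 : Δ ≤ 4) (hN : 0 ≤ N)
    (hup : ∀ lam, 0 < lam → lam ≤ 2 → R ≤ a * (lam * N) + b * (S / lam ^ 2))
    (hlow : Δ * N - C ≤ R) :
    R ≤ (8 * a ^ 2 * b + 1) * (S / Δ ^ 2 + (C ^ 2 * S / Δ ^ 2) ^ (1 / 3 : ℝ)) := by
  -- R is written as (1 + κ)R - κR, with the upper bound in the first term and the lower bound in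
  -- the second. The choice λ = κΔ/(2a) cancels N; Δ ≤ 4 ensures λ ≤ 2.
  have key : ∀ κ, 0 < κ → κ ≤ 1 → R ≤ 8 * a ^ 2 * b * (S / (κ ^ 2 * Δ ^ 2)) + κ * C := by
    intro κ hκ hκ1
    have hl : 0 < κ * Δ / (2 * a) := by positivity
    have hl2 : κ * Δ / (2 * a) ≤ 2 := by
      rw [div_le_iff₀ (by linarith)]
      nlinarith
    have h1 := hup _ hl hl2
    have h2 : b * (S / (κ * Δ / (2 * a)) ^ 2) = 4 * a ^ 2 * b * (S / (κ ^ 2 * Δ ^ 2)) := by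
      field_simp
      ring
    have h3 : a * (κ * Δ / (2 * a) * N) = κ * (Δ * N) / 2 := by field_simp
    rw [h2, h3] at h1
    have h4 := mul_le_mul_of_nonneg_left hlow hκ.le
    have h5 : 0 ≤ 4 * a ^ 2 * b * (S / (κ ^ 2 * Δ ^ 2)) := by positivity
    have h6 : 0 ≤ κ * (Δ * N) := by positivity
    rcases le_total R 0 with hR | hR
    · have : 0 ≤ κ * C := by positivity
      linarith
    · have h7 : (1 + κ) * R ≤ (1 + κ) * (κ * (Δ * N) / 2 + 4 * a ^ 2 * b * (S / (κ ^ 2 * Δ ^ 2))) :=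
        mul_le_mul_of_nonneg_left h1 (by linarith)
      have h8 : (1 + κ) * (κ * (Δ * N) / 2) ≤ κ * (Δ * N) := by nlinarith
      have h9 : (1 + κ) * (4 * a ^ 2 * b * (S / (κ ^ 2 * Δ ^ 2)))
          ≤ 2 * (4 * a ^ 2 * b * (S / (κ ^ 2 * Δ ^ 2))) :=
        mul_le_mul_of_nonneg_right (by linarith) h5
      linarith
  have hm : 0 ≤ 8 * a ^ 2 * b := by positivity
  have hY0 : 0 ≤ (C ^ 2 * S / Δ ^ 2) ^ (1 / 3 : ℝ) := by positivity
  have hX0 : 0 ≤ S / Δ ^ 2 := by positivity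
  rcases le_total (C * Δ ^ 2) S with h | h
  · have h1 := key 1 one_pos le_rfl
    rw [one_pow, one_mul, one_mul] at h1
    have h2 : C ≤ S / Δ ^ 2 := by rwa [le_div_iff₀ (by positivity)]
    have h3 := mul_nonneg hm hY0
    linarith
  · have hC0 : 0 < C := by
      by_contra hlt
      have : C = 0 := le_antisymm (not_lt.1 hlt) hC
      rw [this] at h
      linarith
    -- This κ equates S/(κ²Δ²) with κC. It is at most 1 in the present case; otherwise κ = 1 was
    -- used.
    set κ := (S / (C * Δ ^ 2)) ^ (1 / 3 : ℝ) with hκ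
    have hκ0 : 0 < κ := by positivity
    have hκ1 : κ ≤ 1 := by
      refine Real.rpow_le_one (by positivity) ?_ (by norm_num)
      rw [div_le_one (by positivity)]
      exact h
    have hκ3 : κ ^ 3 = S / (C * Δ ^ 2) := rpow_third_pow (by positivity)
    have hY : (C ^ 2 * S / Δ ^ 2) ^ (1 / 3 : ℝ) = κ * C := by
      have e1 : C ^ 2 * S / Δ ^ 2 = (κ * C) ^ 3 := by
        rw [mul_pow, hκ3]
        field_simp
      rw [e1, ← Real.rpow_natCast, ← Real.rpow_mul (by positivity)]
      norm_num
    have h1 := key κ hκ0 hκ1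
    have h2 : S / (κ ^ 2 * Δ ^ 2) = κ * C := by
      have e1 : S = κ ^ 3 * (C * Δ ^ 2) := by rw [hκ3]; field_simp
      rw [div_eq_iff (by positivity)]
      nth_rewrite 1 [e1]
      ring
    rw [h2] at h1
    rw [hY]
    have h3 := mul_nonneg hm hX0
    linarith

lemma isTuned_tunedSetup {T : ℕ} {G : Digraph (Fin K)} {D : Finset (Fin K)} {rev : Fin K → Fin K}
    (hK : 2 ≤ K) (hD : IsWeaklyDominating G D) (hcard : D.card = weakDomNumber G)
    (hrev : ∀ i, G.Adj (rev i) i) :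
    IsTuned (tunedSetup 1728 1 G D rev T) (1728 * (weakDomNumber G * Real.log K)) where
  two_le := hK
  c₁_eq := rfl
  c₂_eq := rfl
  c₃_eq := one_mul _
  c_eq := rfl
  dom := hD
  card := hcard
  rev := hrev

section

variable {T : ℕ} {G : Digraph (Fin K)} {D : Finset (Fin K)} {rev : Fin K → Fin K}
  {Ω : Type*} {mΩ : MeasurableSpace Ω} {μ : Measure Ω} [IsProbabilityMeasure μ]
  {ℱ : Filtration ℕ mΩ} {ℓ : ℕ → Ω → Fin K → ℝ} {x₁ : Ω → Fin K} {d : ℕ → Ω → Draw K}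
  {s : ℕ → Ω → State K}

lemma adversarial_regret (H : IsTuned (tunedSetup 1728 1 G D rev T)
      (1728 * (weakDomNumber G * Real.log K)))
    (hr : IsRun μ (tunedSetup 1728 1 G D rev T) ℱ ℓ x₁ d s) (u : Fin K) :
    pseudoRegret μ (tunedSetup 1728 1 G D rev T) ℓ d s u
      ≤ 14400 * ((weakDomNumber G * Real.log K) ^ (1 / 3 : ℝ) * (T : ℝ) ^ (2 / 3 : ℝ)) := by
  have h := hr.pseudoRegret_le_adversarial H u
  have h1 : (1728 * (weakDomNumber G * Real.log K)) ^ (1 / 3 : ℝ)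
      = 12 * (weakDomNumber G * Real.log K) ^ (1 / 3 : ℝ) := by
    rw [Real.mul_rpow (by norm_num) (mul_nonneg (Nat.cast_nonneg _) H.log_pos.le)]
    congr 1
    rw [show (1728 : ℝ) = 12 ^ (3 : ℝ) by norm_num, ← Real.rpow_mul (by norm_num)]
    norm_num
  rw [h1] at h
  change _ ≤ 1200 * (12 * _ * (T : ℝ) ^ (2 / 3 : ℝ)) at h
  linarith

lemma stochastic_regret (H : IsTuned (tunedSetup 1728 1 G D rev T)
      (1728 * (weakDomNumber G * Real.log K)))
    (hr : IsRun μ (tunedSetup 1728 1 G D rev T) ℱ ℓ x₁ d s) (hT : 2 ≤ T) {y : Fin K} {Δ : ℝ}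
    {C : ℕ → ℝ} (hΔ : 0 < Δ) (hC : IsCorruptedStochastic μ T ℱ ℓ y Δ C) (u : Fin K) :
    pseudoRegret μ (tunedSetup 1728 1 G D rev T) ℓ d s u
      ≤ (8 * 4102 ^ 2 * (42300 * 1728) + 1) * (weakDomNumber G * Real.log K * Real.log T / Δ ^ 2
        + ((∑ t ∈ Finset.range T, C t) ^ 2 * (weakDomNumber G * Real.log K * Real.log T)
          / Δ ^ 2) ^ (1 / 3 : ℝ)) := by
  have hδ : 1 ≤ (weakDomNumber G : ℝ) := H.one_le_weakDomNumber
  have hK := H.log_pos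
  have hlog := log_natCast_ge hT
  have hT2 : (2 : ℝ) ≤ T := by exact_mod_cast hT
  set A := (weakDomNumber G : ℝ) * Real.log K with hA
  set Cs := ∑ t ∈ Finset.range T, C t with hCs
  have hA0 : 0 < A := by positivity
  have hS0 : 0 < A * Real.log T := by positivity
  have hCs0 : 0 ≤ Cs := Finset.sum_nonneg fun t ht => (hC t (Finset.mem_range.1 ht)).1
  have hY0 : 0 ≤ (Cs ^ 2 * (A * Real.log T) / Δ ^ 2) ^ (1 / 3 : ℝ) := by positivity
  have hX0 : 0 ≤ A * Real.log T / Δ ^ 2 := by positivity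
  -- Large corruption makes the second term of the claim at least a constant times the adversarial
  -- bound. Small corruption forces Δ ≤ 4, since gaps are at most 2, and makes y a better comparator
  -- than any other arm.
  rcases le_total (T * Δ / 2) Cs with h | h
  · have h1 := adversarial_regret H hr u
    have h2 : A ^ (1 / 3 : ℝ) * (T : ℝ) ^ (2 / 3 : ℝ)
        ≤ 2 * (Cs ^ 2 * (A * Real.log T) / Δ ^ 2) ^ (1 / 3 : ℝ) := by
      have e1 : (A ^ (1 / 3 : ℝ) * (T : ℝ) ^ (2 / 3 : ℝ)) ^ 3 = A * T ^ 2 := by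
        rw [rpow_two_thirds_eq (by positivity), mul_pow, rpow_third_pow hA0.le, ← pow_mul, mul_comm 2 3,
          pow_mul, rpow_third_pow (by positivity)]
      have e2 : A * T ^ 2 ≤ 8 * (Cs ^ 2 * (A * Real.log T) / Δ ^ 2) := by
        have e3 : (T * Δ / 2) ^ 2 ≤ Cs ^ 2 := pow_le_pow_left₀ (by positivity) h 2
        rw [← mul_div_assoc, le_div_iff₀ (by positivity)]
        have e4 : 1 / 2 * A ≤ A * Real.log T := by nlinarith
        have e5 := mul_le_mul e3 e4 (by positivity) (by positivity)
        nlinarith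
      refine le_of_pow_le_pow_left₀ (n := 3) (by norm_num) (by positivity) ?_
      rw [e1, mul_pow, rpow_third_pow (by positivity)]
      linarith
    linarith
  · have hΔ4 : Δ ≤ 4 := by
      have h1 : (T : ℝ) * (Δ - 2) ≤ Cs := hr.gap_le H hC
      nlinarith
    have hreg : pseudoRegret μ (tunedSetup 1728 1 G D rev T) ℓ d s y
        ≤ (8 * 4102 ^ 2 * (42300 * 1728) + 1) * (A * Real.log T / Δ ^ 2
          + (Cs ^ 2 * (A * Real.log T) / Δ ^ 2) ^ (1 / 3 : ℝ)) := by
      refine self_bounding (by norm_num) (by norm_num) hS0 hCs0 hΔ hΔ4 (integral_nonneg fun ω =>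
        missCount_nonneg (P := tunedSetup 1728 1 G D rev T) (d := fun t => d t ω)
          (s := fun t => s t ω) y T) (fun lam hl hl2 => ?_) (hr.pseudoRegret_ge H hC)
      have h1 := hr.pseudoRegret_le_tradeoff H hT y y hl hl2
      change _ ≤ _ + 42300 * (1728 * A * Real.log T / lam ^ 2) at h1
      refine h1.trans (le_of_eq ?_)
      rw [show 42300 * (1728 * A * Real.log T / lam ^ 2)
        = 42300 * 1728 * (A * Real.log T / lam ^ 2) by ring]
      rfl
    by_cases hu : u = y
    · rw [hu]
      exact hreg
    · have h1 : pseudoRegret μ (tunedSetup 1728 1 G D rev T) ℓ d s u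
          ≤ pseudoRegret μ (tunedSetup 1728 1 G D rev T) ℓ d s y + Cs - T * Δ :=
        hr.pseudoRegret_le_add H hC hu
      have : 0 < T * Δ := by positivity
      linarith

end

end
end GraphBandit

theorem mainTheorem9 :
    ∃ a b M : ℝ, 0 < a ∧ 0 < b ∧ 0 < M ∧
      ∀ (K T : ℕ) (G : Digraph (Fin K)) (D : Finset (Fin K)) (rev : Fin K → Fin K),
        2 ≤ K →
        GraphBandit.IsWeaklyObservable G →
        GraphBandit.IsWeaklyDominating G D →
        D.card = GraphBandit.weakDomNumber G →
        (∀ i, G.Adj (rev i) i) →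
        ∀ (Ω : Type*) [mΩ : MeasurableSpace Ω] (μ : MeasureTheory.Measure Ω)
          [MeasureTheory.IsProbabilityMeasure μ] (ℱ : MeasureTheory.Filtration ℕ mΩ)
          (ℓ : ℕ → Ω → Fin K → ℝ) (x₁ : Ω → Fin K) (d : ℕ → Ω → GraphBandit.Draw K)
          (s : ℕ → Ω → GraphBandit.State K),
          GraphBandit.IsRun μ (GraphBandit.tunedSetup a b G D rev T) ℱ ℓ x₁ d s →
          (∀ u : Fin K,
            GraphBandit.pseudoRegret μ (GraphBandit.tunedSetup a b G D rev T) ℓ d s u ≤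
              M * (((GraphBandit.weakDomNumber G : ℝ) * Real.log K) ^ (1 / 3 : ℝ)
                * (T : ℝ) ^ (2 / 3 : ℝ))) ∧
          (2 ≤ T →
            ∀ (xstar : Fin K) (Δ : ℝ) (C : ℕ → ℝ), 0 < Δ →
              GraphBandit.IsCorruptedStochastic μ T ℱ ℓ xstar Δ C →
              ∀ u : Fin K,
                GraphBandit.pseudoRegret μ (GraphBandit.tunedSetup a b G D rev T) ℓ d s u ≤
                  M * ((GraphBandit.weakDomNumber G : ℝ) * Real.log K * Real.log T / Δ ^ 2
                    + ((∑ t ∈ Finset.range T, C t) ^ 2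
                        * ((GraphBandit.weakDomNumber G : ℝ) * Real.log K * Real.log T)
                        / Δ ^ 2) ^ (1 / 3 : ℝ))) := by
  -- M is 8a²b + 1 from `self_bounding` with a = 4102 and b = 42300 · 1728, the factor 1728 coming
  -- from c.
  refine ⟨1728, 1, 8 * 4102 ^ 2 * (42300 * 1728) + 1, by norm_num, by norm_num, by norm_num, ?_⟩
  intro K T G D rev hK _ hD hcard hrev Ω mΩ μ _ ℱ ℓ x₁ d s hr
  have H := GraphBandit.isTuned_tunedSetup (T := T) hK hD hcard hrev
  refine ⟨fun u => ?_, fun hT xstar Δ C hΔ hC u => GraphBandit.stochastic_regret H hr hT hΔ hC u⟩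
  have h1 := GraphBandit.adversarial_regret H hr u
  have h2 : 0 ≤ ((GraphBandit.weakDomNumber G : ℝ) * Real.log K) ^ (1 / 3 : ℝ)
      * (T : ℝ) ^ (2 / 3 : ℝ) := by
    have := H.log_pos
    positivity
  linarith
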